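/- **Conventions.** Let $\mathbf T^3=(\mathbf R/\mathbf Z)^3$, $e_k(x)=e^{2\pi\mathsf i k\cdot x}$, $\mu>0$, $\nu\in\mathbf C$, $T>0$ and $0<\kappa<\kappa'<1/18$. Fix a dyadic partition of unity $\{\rho_m\}_{m\ge-1}$ on $\mathbf R^3$: the $\rho_m:\mathbf R^3\to[0,1]$ are smooth and radial, $\operatorname{supp}\rho_{-1}\subset B(0,\frac43)$, $\operatorname{supp}\rho_0\subset B(0,\frac83)\setminus B(0,\frac34)$, $\rho_m=\rho_0(2^{-m}\cdot)$ for $m\ge0$, $\sum_m\rho_m=1$. Set $\Delta_mf=\sum_k\rho_m(k)\hat f(k)e_k$. Let $\mathcal C^\alpha$ be the completion of $C^\infty(\mathbf T^3,\mathbf C)$ in the norm $\|f\|_\alpha=\sup_{m\ge-1}2^{m\alpha}\|\Delta_mf\|_{L^\infty}$, a space of distributions. Set $$f\prec g=\sum_{m_1+2\le m_2}\Delta_{m_1}f\,\Delta_{m_2}g,\qquad f\succ g=g\prec f,\qquad f\odot g=\sum_{|m_1-m_2|\le1}\Delta_{m_1}f\,\Delta_{m_2}g,$$ and $fg=f\prec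 g+f\odot g+f\succ g$. Let $R(f,g,h)$ be the extension by continuity, from smooth functions to $\mathcal C^\alpha\times\mathcal C^\beta\times\mathcal C^\gamma$ with $0<\alpha<1$, $\beta+\gamma<0<\alpha+\beta+\gamma$, of $(f\prec g)\odot h-f(g\odot h)$. *Spaces.* $C_T\mathcal C^\alpha=C([0,T],\mathcal C^\alpha)$; $C^\delta_T\mathcal C^\alpha$: the $\delta$-Hölder functions $[0,T]\to\mathcal C^\alpha$; $\mathcal E^\eta_T\mathcal C^\alpha$ (resp. $\mathcal E^{\eta,\delta}_T\mathcal C^\alpha$): the $u\in C((0,T],\mathcal C^\alpha)$ with $\sup_{0<t\le T}t^\eta\|u_t\|_\alpha<\infty$ (resp. $\sup_{0<s<t\le T}s^\eta|t-s|^{-\delta}\|u_t-u_s\|_\alpha<\infty$); $\mathcal L_T^{\alpha,\delta}=C_T\mathcal C^\alpha\cap C_T^\delta\mathcal C^{\alpha-2\delta}$; $\mathcal L_T^{\eta,\alpha,\delta}=\mathcal E_T^\eta\mathcal C^\alpha\cap C_T\mathcal C^{\alpha-2\eta}\cap\mathcal E_T^{\eta,\delta}\mathcal C^{\alpha-2\delta}$.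 *Integration.* $I(u_0,f)_t=P^1_tu_0+\int_0^tP^1_{t-s}f_s\,ds$ with $P^1_t=e^{t\{(\mathsf i+\mu)\triangle-1\}}$. **Driving vectors.** A driving vector on $[0,T]$ is a 14-tuple $X=(Z,A,B,A',B',W;X^1,X^2,X^3,X^4,X^5,X^6;X^7,X^8)$ in $$C_T\mathcal C^{-\frac12-\kappa}\times(C_T\mathcal C^{-1-\kappa})^2\times(C_T\mathcal C^{1-\kappa})^2\times\mathcal L_T^{\frac12-\kappa,\frac14-\frac\kappa2}\times(C_T\mathcal C^{-\kappa})^6\times(C_T\mathcal C^{-\frac12-\kappa})^2$$ with $A'=I(A'_0,A)$ and $B'=I(B'_0,B)$. Put $WZ=W\prec Z+W\succ Z+X^1$, $W\bar Z=W\prec\bar Z+W\succ\bar Z+X^2$, $\bar WZ=\overline{W\bar Z}$ and $$W^2\bar Z=2WX^2+R(W,\bar Z,W)+(W\prec\bar Z)\prec W+(W\prec\bar Z)\succ W+W(W\succ\bar Z),$$ $$W\bar WZ=\bar WX^1+W\overline{X^2}+R(\bar W,Z,W)+(\bar W\prec Z)\prec W+(\bar W\prec Z)\succ W+W(\bar W\succ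 Z).$$ **Paracontrolled solutions.** With $u_2=v+w$ let $$F(v,w)=-\nu\{2(-\nu W+u_2)\prec B+(-\bar\nu\bar W+\bar u_2)\prec A\},\qquad \hat v=I(v_0,F(v,w)),$$ $$\mathrm{com}=\hat v+\nu\{2(-\nu W+u_2)\prec B'+(-\bar\nu\bar W+\bar u_2)\prec A'\},$$ and $G(v,w)=G_1+\dots+G_8$, where - $G_1=-\nu u_2^2\bar u_2$ and $G_2=-\nu\{u_2^2(\bar Z-\bar\nu\bar W)+2u_2\bar u_2(Z-\nu W)\}$; - $G_3=-\nu\{u_2(2\nu\bar\nu W\bar W-2\nu W\bar Z-2\bar\nu\bar WZ-4\nu X^5-\bar\nu\overline{X^4})+\bar u_2(\nu^2W^2-2\nu WZ-2\bar\nu\overline{X^6}-2\nu X^3)\}+(\nu+1)u_2$; - $G_4=-\nu\{-\nu^2\bar\nu W^2\bar W+\nu^2W^2\bar Z+2\nu\bar\nu W\bar WZ+4\nu^2WX^5+4\nu^2R(W,B',B)+2\bar\nu^2\bar W\,\overline{X^6}+2\bar\nu^2R(\bar W,\overline{B'},A)+2\nu\bar\nu\bar WX^3+2\nu\bar\nu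 R(\bar W,A',B)+\nu\bar\nu W\overline{X^4}+\nu\bar\nu R(W,\overline{A'},A)-2\nu X^7-2\nu W\succ B-\bar\nu\overline{X^8}-\bar\nu\bar W\succ A\}+(\nu+1)(Z-\nu W)$; - $G_5=-\nu\{-4\nu R(u_2,B',B)-2\nu R(\bar u_2,A',B)-2\bar\nu R(\bar u_2,\overline{B'},A)-\bar\nu R(u_2,\overline{A'},A)\}$; - $G_6=-\nu\{2\,\mathrm{com}\odot B+\overline{\mathrm{com}}\odot A\}$, $G_7=-\nu\{2w\odot B+\bar w\odot A\}$, $G_8=-\nu\{2u_2\succ B+\bar u_2\succ A\}$. A paracontrolled solution on $[0,T]$ driven by $X$ with initial condition $(v_0,w_0)$ is a pair $$(v,w)\in\mathcal L_T^{\frac56-\kappa',1-\kappa',1-\frac{\kappa'}2}\times\mathcal L_T^{1-\kappa'+\kappa,\frac32-2\kappa',1-\kappa'}$$ such that $v=I(v_0,F(v,w))$ and $w=I(w_0,G(v,w))$ on $[0,T]$. **Theorem.** Let $c_1,c_{2,1},c_{2,2}\in\mathbf C$, $\beta>-2$, $\xi\in C_T\mathcal C^\beta$ and $Z_0,A'_0,B'_0,W_0\in\mathcal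 C^{\beta+2}$. Define $$Z=I(Z_0,\xi),\quad A=Z^2,\quad B=Z\bar Z-c_1,\quad A'=I(A'_0,A),\quad B'=I(B'_0,B),\quad W=I(W_0,Z^2\bar Z-2c_1Z),$$ $$X^1=W\odot Z,\quad X^2=W\odot\bar Z,\quad X^3=A'\odot B,\quad X^4=A'\odot\bar Z^2-2c_{2,1},\quad X^5=B'\odot B-c_{2,2},\quad X^6=B'\odot\bar Z^2,$$ $$X^7=W\odot B-2c_{2,2}Z,\qquad X^8=W\odot\bar Z^2-2c_{2,1}\bar Z,$$ where $Z$ is a continuous function and its powers are the usual pointwise ones, and suppose that the vector $X$ so obtained is a driving vector on $[0,T]$. Let $(v_0,w_0)\in\mathcal C^{-\frac23+\kappa'}\times\mathcal C^{-\frac12-2\kappa}$ and let $(v,w)$ be a paracontrolled solution on $[0,T]$ driven by $X$ with initial condition $(v_0,w_0)$. Put $$u=Z-\nu W+v+w,\qquad c=2(c_1-\bar\nu\,\overline{c_{2,1}}-2\nu c_{2,2}).$$ Then $u$ is a mild solution on $[0,T]$ of $$\partial_tu=(\mathsf i+\mu)\triangle u+\nu(1-|u|^2)u+\nu cu+\xi,\qquad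 u_0=Z_0-\nu W_0+v_0+w_0,$$ that is: on $(0,T]$, $u$ is a continuous function of time with values in $C(\mathbf T^3,\mathbf C)$, $\int_0^T\|u_t\|_{L^\infty}^3dt<\infty$, and for all $t\in[0,T]$, as distributions, $$u_t=e^{t(\mathsf i+\mu)\triangle}u_0+\int_0^te^{(t-s)(\mathsf i+\mu)\triangle}\{\nu(1-|u_s|^2)u_s+\nu cu_s+\xi_s\}\,ds.$$ -/

import Mathlib

open Set Filter Topology MeasureTheory
open scoped ENNReal ContDiff

noncomputable section

namespace CGL

/-! ### Periodic distributions -/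

/-- The torus `(ℝ/ℤ)^3`. -/
abbrev T3 : Type := UnitAddTorus (Fin 3)

/-- The frequency space `ℝ^3` with its Euclidean norm. -/
abbrev E3 : Type := EuclideanSpace ℝ (Fin 3)

/-- The lattice point `k ∈ ℤ^3` as a point of `ℝ^3`. -/
def latticePoint (k : Fin 3 → ℤ) : E3 := WithLp.toLp 2 (fun i => (k i : ℝ))

/-- Formal Fourier series `∑ₖ f(k) e^{2πi k·x}` on the torus, stored as the family of their Fourier
coefficients. Distributions on the torus are the ones of polynomial growth (`IsDistribution`),
smooth functions the rapidly decreasing ones (`IsSmooth`). -/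
abbrev PerDist : Type := (Fin 3 → ℤ) → ℂ

/-- `f` is a distribution on the torus. -/
def IsDistribution (f : PerDist) : Prop :=
  ∃ (C : ℝ) (N : ℕ), ∀ k, ‖f k‖ ≤ C * (1 + ‖latticePoint k‖) ^ N

/-- `f` is a smooth function on the torus. -/
def IsSmooth (f : PerDist) : Prop :=
  ∀ N : ℕ, ∃ C : ℝ, ∀ k, (1 + ‖latticePoint k‖) ^ N * ‖f k‖ ≤ C

/-- The distribution given by a function on the torus. -/
def ofFun (F : T3 → ℂ) : PerDist := fun k => UnitAddTorus.mFourierCoeff F k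

open Classical in
/-- The continuous function which represents the distribution `f` (and `0` if there is none). -/
def toFun (f : PerDist) : C(T3, ℂ) :=
  if h : ∃ F : C(T3, ℂ), ofFun F = f then h.choose else 0

/-- The usual (pointwise) product of distributions that are continuous functions. -/
def fnMul (f g : PerDist) : PerDist := ofFun (fun x => toFun f x * toFun g x)

/-- The complex conjugate of a distribution. -/
def bar (f : PerDist) : PerDist := fun k => star (f (-k))

/-- The constant function `c`. -/
def const (c : ℂ) : PerDist := fun k => if k = 0 then c else 0

/-! ### Littlewood-Paley theory

The block `Δ_m`, `m ≥ -1`, carries the index `i = m + 1 : ℕ`. -/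

/-- The functions `ρ_m`, `m = i - 1`, made from `ρ_{-1} = chi` and `ρ_0 = phi`. -/
def bump (chi phi : E3 → ℝ) : ℕ → E3 → ℝ
  | 0, x => chi x
  | j + 1, x => phi (((2 : ℝ) ^ j)⁻¹ • x)

/-- A dyadic partition of unity, `chi = ρ_{-1}` and `phi = ρ_0`. -/
structure DyadicPartition where
  chi : E3 → ℝ
  phi : E3 → ℝ
  chi_mem : ∀ x, chi x ∈ Icc (0 : ℝ) 1
  phi_mem : ∀ x, phi x ∈ Icc (0 : ℝ) 1
  chi_smooth : ContDiff ℝ ∞ chi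
  phi_smooth : ContDiff ℝ ∞ phi
  chi_radial : ∀ x y, ‖x‖ = ‖y‖ → chi x = chi y
  phi_radial : ∀ x y, ‖x‖ = ‖y‖ → phi x = phi y
  chi_supp : tsupport chi ⊆ Metric.ball 0 (4 / 3)
  phi_supp : tsupport phi ⊆ Metric.ball 0 (8 / 3) \ Metric.ball 0 (3 / 4)
  sum_eq_one : ∀ x, HasSum (fun i => bump chi phi i x) 1

namespace DyadicPartition

variable (P : DyadicPartition)

/-- The value `ρ_{i-1}(k)`. -/
def weight (i : ℕ) (k : Fin 3 → ℤ) : ℝ := bump P.chi P.phi i (latticePoint k)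

/-- The Littlewood-Paley block `Δ_{i-1} f`, a trigonometric polynomial (all but finitely many terms
of the sum are zero). -/
def block (i : ℕ) (f : PerDist) (x : T3) : ℂ :=
  ∑' k, (P.weight i k : ℂ) * f k * UnitAddTorus.mFourier k x

/-- The norm of the Besov-Hölder space `C^α`, with the value `∞` allowed. -/
def besovNorm (α : ℝ) (f : PerDist) : ℝ≥0∞ :=
  ⨆ i : ℕ, (2 : ℝ≥0∞) ^ (((i : ℝ) - 1) * α) * ⨆ x : T3, ‖P.block i f x‖ₑ

/-- The Besov-Hölder space `C^α`: the completion of the smooth functions in the norm `besovNorm α`,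
realised inside the distributions. -/
def besov (α : ℝ) : Set PerDist :=
  {f | IsDistribution f ∧ ∀ ε : ℝ≥0∞, 0 < ε → ∃ g, IsSmooth g ∧ P.besovNorm α (f - g) < ε}

/-- The product `Δ_{i-1} f · Δ_{j-1} g` of two trigonometric polynomials. -/
def blockMul (i j : ℕ) (f g : PerDist) : PerDist :=
  ofFun (fun x => P.block i f x * P.block j g x)

/-- The paraproduct `f ≺ g`; the paraproduct `f ≻ g` is `para g f`. -/
def para (f g : PerDist) : PerDist := fun k =>
  ∑' p : ℕ × ℕ, if p.1 + 2 ≤ p.2 then P.blockMul p.1 p.2 f g k else 0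

/-- The resonant product `f ⊙ g`. -/
def reso (f g : PerDist) : PerDist := fun k =>
  ∑' p : ℕ × ℕ, if p.1 ≤ p.2 + 1 ∧ p.2 ≤ p.1 + 1 then P.blockMul p.1 p.2 f g k else 0

/-- The sum `f (≺ + ≻) g` of the two paraproducts. -/
def paras (f g : PerDist) : PerDist := P.para f g + P.para g f

/-- The product `f g` of distributions, `f ≺ g + f ⊙ g + f ≻ g`. -/
def mul (f g : PerDist) : PerDist := P.para f g + P.reso f g + P.para g f

/-- The smooth approximation `∑_{m < n - 1} Δ_m f` of `f`. -/
def trunc (n : ℕ) (f : PerDist) : PerDist := fun k =>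
  ∑ i ∈ Finset.range n, (P.weight i k : ℂ) * f k

/-- The commutator `(f ≺ g) ⊙ h - f (g ⊙ h)` of smooth functions. -/
def commSmooth (f g h : PerDist) : PerDist :=
  P.reso (P.para f g) h - P.mul f (P.reso g h)

/-- The extension by continuity `R(f, g, h)` of the commutator of smooth functions, as the limit along
the smooth approximations of `f`, `g` and `h`. -/
def comm (f g h : PerDist) : PerDist := fun k =>
  limUnder atTop (fun n : ℕ => P.commSmooth (P.trunc n f) (P.trunc n g) (P.trunc n h) k)

/-! ### Spaces of functions of time -/

/-- Continuity on `S` with values in `C^α`. -/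
def ContOn (S : Set ℝ) (α : ℝ) (u : ℝ → PerDist) : Prop :=
  (∀ t ∈ S, u t ∈ P.besov α) ∧
    ∀ t ∈ S, Tendsto (fun s => P.besovNorm α (u s - u t)) (𝓝[S] t) (𝓝 0)

/-- `C_T C^α`. -/
def spaceC (T α : ℝ) : Set (ℝ → PerDist) := {u | P.ContOn (Icc 0 T) α u}

/-- `C_T^δ C^α`. -/
def spaceHolder (T δ α : ℝ) : Set (ℝ → PerDist) :=
  {u | (∀ t ∈ Icc 0 T, u t ∈ P.besov α) ∧
    ∃ C : ℝ, ∀ s t, 0 ≤ s → s < t → t ≤ T →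
      P.besovNorm α (u t - u s) ≤ ENNReal.ofReal (C * (t - s) ^ δ)}

/-- `E_T^η C^α`. -/
def spaceE (T η α : ℝ) : Set (ℝ → PerDist) :=
  {u | P.ContOn (Ioc 0 T) α u ∧
    ∃ C : ℝ, ∀ t ∈ Ioc 0 T, ENNReal.ofReal (t ^ η) * P.besovNorm α (u t) ≤ ENNReal.ofReal C}

/-- `E_T^{η,δ} C^α`. -/
def spaceEHolder (T η δ α : ℝ) : Set (ℝ → PerDist) :=
  {u | P.ContOn (Ioc 0 T) α u ∧
    ∃ C : ℝ, ∀ s t, 0 < s → s < t → t ≤ T →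
      ENNReal.ofReal (s ^ η) * P.besovNorm α (u t - u s) ≤ ENNReal.ofReal (C * (t - s) ^ δ)}

/-- `L_T^{α,δ}`. -/
def spaceL (T α δ : ℝ) : Set (ℝ → PerDist) :=
  P.spaceC T α ∩ P.spaceHolder T δ (α - 2 * δ)

/-- `L_T^{η,α,δ}`. -/
def spaceLE (T η α δ : ℝ) : Set (ℝ → PerDist) :=
  P.spaceE T η α ∩ P.spaceC T (α - 2 * η) ∩ P.spaceEHolder T η δ (α - 2 * δ)

end DyadicPartition

/-! ### Integration map -/

/-- The eigenvalue `(i + μ) 4π²|k|²` of `-(i + μ)Δ` at `e^{2πi k·x}`. -/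
def symbol (μ : ℝ) (k : Fin 3 → ℤ) : ℂ :=
  (Complex.I + (μ : ℂ)) * ((4 * Real.pi ^ 2 * ‖latticePoint k‖ ^ 2 : ℝ) : ℂ)

/-- The integration map
`I(u₀, v)_t = P¹_t u₀ + ∫₀ᵗ P¹_{t-s} v_s ds` with `P¹_t = exp(t((i + μ)Δ - 1))`. -/
def integ (μ : ℝ) (u₀ : PerDist) (v : ℝ → PerDist) (t : ℝ) : PerDist := fun k =>
  Complex.exp (-(t : ℂ) * (symbol μ k + 1)) * u₀ k +
    ∫ s in (0 : ℝ)..t, Complex.exp (-((t - s : ℝ) : ℂ) * (symbol μ k + 1)) * v s k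

/-! ### Driving vectors -/

/-- The values at one time of the fourteen components of a driving vector. In the names, `Z` and `b`
stand for the noise and the conjugated noise (`ZZb` for `Z Z̄`, `bb` for `Z̄²`), `I` for the
integration map, `o` for the resonant product, and `W` for `I(Z² Z̄)`. -/
structure Driver where
  Z : PerDist
  ZZ : PerDist
  ZZb : PerDist
  IZZ : PerDist
  IZZb : PerDist
  W : PerDist
  WoZ : PerDist
  WoB : PerDist
  IZZoZZb : PerDist
  IZZobb : PerDist
  IZZboZZb : PerDist
  IZZbobb : PerDist
  WoZZb : PerDist
  Wobb : PerDist

/-- `X` is a driving vector on `[0, T]`. -/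
structure IsDrivingVector (P : DyadicPartition) (μ T κ : ℝ) (X : ℝ → Driver) : Prop where
  Z : (fun t => (X t).Z) ∈ P.spaceC T (-1 / 2 - κ)
  ZZ : (fun t => (X t).ZZ) ∈ P.spaceC T (-1 - κ)
  ZZb : (fun t => (X t).ZZb) ∈ P.spaceC T (-1 - κ)
  IZZ : (fun t => (X t).IZZ) ∈ P.spaceC T (1 - κ)
  IZZb : (fun t => (X t).IZZb) ∈ P.spaceC T (1 - κ)
  W : (fun t => (X t).W) ∈ P.spaceL T (1 / 2 - κ) (1 / 4 - κ / 2)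
  WoZ : (fun t => (X t).WoZ) ∈ P.spaceC T (-κ)
  WoB : (fun t => (X t).WoB) ∈ P.spaceC T (-κ)
  IZZoZZb : (fun t => (X t).IZZoZZb) ∈ P.spaceC T (-κ)
  IZZobb : (fun t => (X t).IZZobb) ∈ P.spaceC T (-κ)
  IZZboZZb : (fun t => (X t).IZZboZZb) ∈ P.spaceC T (-κ)
  IZZbobb : (fun t => (X t).IZZbobb) ∈ P.spaceC T (-κ)
  WoZZb : (fun t => (X t).WoZZb) ∈ P.spaceC T (-1 / 2 - κ)
  Wobb : (fun t => (X t).Wobb) ∈ P.spaceC T (-1 / 2 - κ)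
  integ_ZZ : ∀ t ∈ Icc 0 T, (X t).IZZ = integ μ (X 0).IZZ (fun s => (X s).ZZ) t
  integ_ZZb : ∀ t ∈ Icc 0 T, (X t).IZZb = integ μ (X 0).IZZb (fun s => (X s).ZZb) t

/-! ### The paracontrolled system -/

namespace DyadicPartition

variable (P : DyadicPartition)

/-- The product `W Z`. -/
def prodWZ (X : Driver) : PerDist := P.paras X.W X.Z + X.WoZ

/-- The product `W Z̄`. -/
def prodWB (X : Driver) : PerDist := P.paras X.W (bar X.Z) + X.WoB

/-- The product `W² Z̄`. -/
def prodWWB (X : Driver) : PerDist :=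
  (2 : ℂ) • P.mul X.W X.WoB + P.comm X.W (bar X.Z) X.W
    + P.paras (P.para X.W (bar X.Z)) X.W + P.mul X.W (P.para (bar X.Z) X.W)

/-- The product `W W̄ Z`. -/
def prodWWbZ (X : Driver) : PerDist :=
  P.mul (bar X.W) X.WoZ + P.mul X.W (bar X.WoB) + P.comm (bar X.W) X.Z X.W
    + P.paras (P.para (bar X.W) X.Z) X.W + P.mul X.W (P.para X.Z (bar X.W))

/-- The map `F(v, w)`, at one time. -/
def mapF (ν : ℂ) (X : Driver) (v w : PerDist) : PerDist :=
  (-ν) • ((2 : ℂ) • P.para (-(ν • X.W) + v + w) X.ZZb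
    + P.para (-(star ν • bar X.W) + bar v + bar w) X.ZZ)

/-- `com(v, w)` at one time, in terms of the value `vhat` at that time of
`I(v₀, F(v, w))`. -/
def com (ν : ℂ) (X : Driver) (vhat v w : PerDist) : PerDist :=
  vhat + ν • ((2 : ℂ) • P.para (-(ν • X.W) + v + w) X.IZZb
    + P.para (-(star ν • bar X.W) + bar v + bar w) X.IZZ)

/-- `G₁`, in terms of `u₂ = v + w`. -/
def mapG₁ (ν : ℂ) (u₂ : PerDist) : PerDist := (-ν) • P.mul (P.mul u₂ u₂) (bar u₂)

/-- `G₂`. -/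
def mapG₂ (ν : ℂ) (X : Driver) (u₂ : PerDist) : PerDist :=
  (-ν) • (P.mul (P.mul u₂ u₂) (bar X.Z - star ν • bar X.W)
    + (2 : ℂ) • P.mul (P.mul u₂ (bar u₂)) (X.Z - ν • X.W))

/-- `G₃`. -/
def mapG₃ (ν : ℂ) (X : Driver) (u₂ : PerDist) : PerDist :=
  (-ν) • (P.mul u₂
      ((2 * ν * star ν) • P.mul X.W (bar X.W) - (2 * ν) • P.prodWB X
        - (2 * star ν) • bar (P.prodWB X) - (4 * ν) • X.IZZboZZb - star ν • bar X.IZZobb)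
    + P.mul (bar u₂)
      (ν ^ 2 • P.mul X.W X.W - (2 * ν) • P.prodWZ X
        - (2 * star ν) • bar X.IZZbobb - (2 * ν) • X.IZZoZZb))
    + (ν + 1) • u₂

/-- `G₄`. -/
def mapG₄ (ν : ℂ) (X : Driver) : PerDist :=
  (-ν) • (-((ν ^ 2 * star ν) • P.mul (P.mul X.W X.W) (bar X.W)) + ν ^ 2 • P.prodWWB X
      + (2 * ν * star ν) • P.prodWWbZ X
      + (4 * ν ^ 2) • P.mul X.W X.IZZboZZb + (4 * ν ^ 2) • P.comm X.W X.IZZb X.ZZb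
      + (2 * star ν ^ 2) • P.mul (bar X.W) (bar X.IZZbobb)
      + (2 * star ν ^ 2) • P.comm (bar X.W) (bar X.IZZb) X.ZZ
      + (2 * ν * star ν) • P.mul (bar X.W) X.IZZoZZb
      + (2 * ν * star ν) • P.comm (bar X.W) X.IZZ X.ZZb
      + (ν * star ν) • P.mul X.W (bar X.IZZobb)
      + (ν * star ν) • P.comm X.W (bar X.IZZ) X.ZZ
      - (2 * ν) • X.WoZZb - (2 * ν) • P.para X.ZZb X.W
      - star ν • bar X.Wobb - star ν • P.para X.ZZ (bar X.W))
    + (ν + 1) • (X.Z - ν • X.W)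

/-- `G₅`. -/
def mapG₅ (ν : ℂ) (X : Driver) (u₂ : PerDist) : PerDist :=
  (-ν) • (-((4 * ν) • P.comm u₂ X.IZZb X.ZZb) - (2 * ν) • P.comm (bar u₂) X.IZZ X.ZZb
    - (2 * star ν) • P.comm (bar u₂) (bar X.IZZb) X.ZZ
    - star ν • P.comm u₂ (bar X.IZZ) X.ZZ)

/-- `G₆`, in terms of `c = com(v, w)`. -/
def mapG₆ (ν : ℂ) (X : Driver) (c : PerDist) : PerDist :=
  (-ν) • ((2 : ℂ) • P.reso c X.ZZb + P.reso (bar c) X.ZZ)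

/-- `G₇`. -/
def mapG₇ (ν : ℂ) (X : Driver) (w : PerDist) : PerDist :=
  (-ν) • ((2 : ℂ) • P.reso w X.ZZb + P.reso (bar w) X.ZZ)

/-- `G₈`. -/
def mapG₈ (ν : ℂ) (X : Driver) (u₂ : PerDist) : PerDist :=
  (-ν) • ((2 : ℂ) • P.para X.ZZb u₂ + P.para X.ZZ (bar u₂))

/-- The map `G = G₁ + ⋯ + G₈` at one time, in terms of the value `vhat` of `I(v₀, F(v, w))`. -/
def mapG (ν : ℂ) (X : Driver) (vhat v w : PerDist) : PerDist :=
  P.mapG₁ ν (v + w) + P.mapG₂ ν X (v + w) + P.mapG₃ ν X (v + w) + P.mapG₄ ν X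
    + P.mapG₅ ν X (v + w) + P.mapG₆ ν X (P.com ν X vhat v w) + P.mapG₇ ν X w
    + P.mapG₈ ν X (v + w)

/-- The first component of the map `M`. -/
def mapM₁ (μ : ℝ) (ν : ℂ) (X : ℝ → Driver) (v₀ : PerDist) (v w : ℝ → PerDist) :
    ℝ → PerDist :=
  integ μ v₀ (fun s => P.mapF ν (X s) (v s) (w s))

/-- The second component of the map `M`. -/
def mapM₂ (μ : ℝ) (ν : ℂ) (X : ℝ → Driver) (v₀ w₀ : PerDist) (v w : ℝ → PerDist) :
    ℝ → PerDist :=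
  integ μ w₀ (fun s => P.mapG ν (X s) (P.mapM₁ μ ν X v₀ v w s) (v s) (w s))

end DyadicPartition

/-- `(v, w)` is a solution on `[0, T]`, in the paracontrolled sense, for the driving vector `X` and
the initial data `(v₀, w₀)`. -/
structure IsParacontrolledSolution (P : DyadicPartition) (μ : ℝ) (ν : ℂ) (T κ κ' : ℝ)
    (X : ℝ → Driver) (v₀ w₀ : PerDist) (v w : ℝ → PerDist) : Prop where
  mem_v : v ∈ P.spaceLE T (5 / 6 - κ') (1 - κ') (1 - κ' / 2)
  mem_w : w ∈ P.spaceLE T (1 - κ' + κ) (3 / 2 - 2 * κ') (1 - κ')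
  eq_v : ∀ t ∈ Icc 0 T, v t = P.mapM₁ μ ν X v₀ v w t
  eq_w : ∀ t ∈ Icc 0 T, w t = P.mapM₂ μ ν X v₀ w₀ v w t

/-! ### The driving vector of a regular forcing -/

/-- The process `Z = I(Z₀, ξ)`. -/
def tableZ (μ : ℝ) (ξ : ℝ → PerDist) (Z₀ : PerDist) : ℝ → PerDist := integ μ Z₀ ξ

/-- The renormalized product `Z Z̄ - c₁`. -/
def tableZZb (c₁ : ℂ) (z : PerDist) : PerDist := fnMul z (bar z) - const c₁

/-- The renormalized product `Z² Z̄ - 2 c₁ Z`. -/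
def tableZZZb (c₁ : ℂ) (z : PerDist) : PerDist := fnMul (fnMul z z) (bar z) - (2 * c₁) • z

/-- The driving vector built from the forcing `ξ`, the initial values `Z₀`, `IZZ₀`, `IZZb₀`, `W₀`
and the constants `c₁`, `c₂₁`, `c₂₂`. -/
def tableDriver (P : DyadicPartition) (μ : ℝ) (c₁ c₂₁ c₂₂ : ℂ) (ξ : ℝ → PerDist)
    (Z₀ IZZ₀ IZZb₀ W₀ : PerDist) (t : ℝ) : Driver :=
  let Z := tableZ μ ξ Z₀
  let ZZ := fun s => fnMul (Z s) (Z s)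
  let ZZb := fun s => tableZZb c₁ (Z s)
  let bb := fun s => fnMul (bar (Z s)) (bar (Z s))
  let IZZ := integ μ IZZ₀ ZZ
  let IZZb := integ μ IZZb₀ ZZb
  let W := integ μ W₀ (fun s => tableZZZb c₁ (Z s))
  { Z := Z t
    ZZ := ZZ t
    ZZb := ZZb t
    IZZ := IZZ t
    IZZb := IZZb t
    W := W t
    WoZ := P.reso (W t) (Z t)
    WoB := P.reso (W t) (bar (Z t))
    IZZoZZb := P.reso (IZZ t) (ZZb t)
    IZZobb := P.reso (IZZ t) (bb t) - const (2 * c₂₁)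
    IZZboZZb := P.reso (IZZb t) (ZZb t) - const c₂₂
    IZZbobb := P.reso (IZZb t) (bb t)
    WoZZb := P.reso (W t) (ZZb t) - (2 * c₂₂) • Z t
    Wobb := P.reso (W t) (bb t) - (2 * c₂₁) • bar (Z t) }

/-! ### Mild solutions of the renormalized equation -/

/-- `u` is a mild solution on `[0, T]`, with initial value `u₀`, of
`∂ₜ u = (i + μ)Δu + ν(1 - |u|²)u + ν c u + ξ`.

At positive times `u` is a continuous function `U`, locally bounded in time with `∫ ‖U_t‖³ dt < ∞`,
so that the nonlinearity is the pointwise one, and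
`u_t = e^{t(i + μ)Δ} u₀ + ∫₀ᵗ e^{(t-s)(i + μ)Δ} (ν(1 - |u_s|²)u_s + ν c u_s + ξ_s) ds`,
where the integral is a convergent integral of distributions. -/
def IsMildSolution (μ : ℝ) (ν c : ℂ) (ξ : ℝ → PerDist) (T : ℝ) (u₀ : PerDist)
    (u : ℝ → PerDist) : Prop :=
  ∃ U : ℝ → C(T3, ℂ),
    (∀ t ∈ Ioc 0 T, ofFun (U t) = u t) ∧
    ContinuousOn U (Ioc 0 T) ∧
    IntegrableOn (fun t => ‖U t‖ ^ 3) (Ioc 0 T) ∧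
    ∀ t ∈ Icc 0 T, ∀ k : Fin 3 → ℤ,
      let N : ℝ → ℂ := fun s => Complex.exp (-((t - s : ℝ) : ℂ) * symbol μ k) *
        (ofFun (fun x => ν * (1 - (‖U s x‖ : ℂ) ^ 2) * U s x + ν * c * U s x) k + ξ s k)
      IntervalIntegrable N volume 0 t ∧
        u t k = Complex.exp (-(t : ℂ) * symbol μ k) * u₀ k + ∫ s in (0 : ℝ)..t, N s

end CGL

end

/-!
All objects of the statement are far more regular than the paracontrolled calculus requires, and
the proof undoes that calculus: for regular objects every extended product and every commutator is
the classical one, the right-hand sides of the system add up to the renormalized nonlinearity, and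
the integral equations of `Z`, `W`, `v`, `w` add up to the mild equation of `u = Z - νW + v + w`.

*Algebra.* Paraproducts and resonant products are bilinear Fourier multipliers with symbols in
`[0, 1]` (`para_eq_bilin`, `reso_eq_bilin`), so they are defined on pairs of `L²` functions, and
there `f ≺ g + f ⊙ g + f ≻ g` is the product of functions (`mul_eq_conv`). If one of the factors
in each product of `R(f, g, h)` has absolutely summable Fourier coefficients, dominated
convergence along the truncations identifies `R(f, g, h)` with `(f ≺ g) ⊙ h - f (g ⊙ h)`
(`comm_eq`). Once the extended products and commutators are expanded, what is left of the sum of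
`F`, `G` and `-ν(Z²Z̄ - 2c₁Z)` is an identity between polynomials in continuous functions, in
which the resonances with `A'`, `B'` and `W` cancel and the constants subtracted in the driving
vector produce the counterterm `νcu` (`DyadicPartition.mapF_add_mapG`).

*Regularity.* This algebra asks for `Z`, `W`, `v`, `w` to be continuous functions and for `A'`,
`B'`, `W` to lie in the Wiener algebra at positive times. As `β > -2`, the Schauder estimate
`exists_besovNorm_integ_le` bounds `Z` in a space of positive regularity; it rests on the
smoothing of the complex heat semigroup, where the gain of two derivatives comes from the
boundedness of complex Gaussian multipliers and Cauchy's estimate in the complex time.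
Interpolation with the continuity of `Z` in a space of negative regularity makes `Z` continuous in
space and time (`continuousOn_toFun_of_bounded`). Then `A'`, `B'`, `W` are integrals of continuous
functions, hence in the Wiener algebra by Cauchy-Schwarz: in dimension three, the heat factor has
decay in frequency that is square-summable, at the price of a singularity in time that is
integrable (`wiener_integ_ofFun`).

*Integrability.* The spaces of `v` and `w` interpolate between an explosion in positive regularity
and boundedness in a regularity above `-2/3`, so that the sup norms are at most `C t^{-r}` with
`r < 1/3` (`exists_norm_toFun_le_rpow`). Thus `‖u‖³` is integrable in time, and so are all the terms
of the integral equations, `G` included because it equals a combination of the others. The damping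
`-1` of the linear part is finally traded for the term `+u` of the right-hand side
(`eq_of_damped`).
-/

noncomputable section

namespace CGL

open UnitAddTorus

/-! ### Fourier coefficients of continuous functions -/

/-- The Haar probability measure of the torus, with respect to which Fourier coefficients are
taken. -/
abbrev haarT3 : Measure T3 := Measure.pi (fun _ => AddCircle.haarAddCircle)

lemma ofFun_apply (F : T3 → ℂ) (k : Fin 3 → ℤ) :
    ofFun F k = ∫ x, mFourier (-k) x * F x ∂haarT3 := rfl

lemma integrable_mFourier_mul (F : C(T3, ℂ)) (k : Fin 3 → ℤ) :
    Integrable (fun x => mFourier k x * F x) haarT3 := by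
  have h : Continuous (fun x => mFourier k x * F x) := by fun_prop
  exact h.integrable_of_hasCompactSupport (HasCompactSupport.of_compactSpace _)

lemma norm_mFourier_apply (k : Fin 3 → ℤ) (x : T3) : ‖mFourier k x‖ = 1 := by
  simp only [mFourier, fourier_apply, ContinuousMap.coe_mk, norm_prod, Circle.norm_coe,
    Finset.prod_const_one]

lemma ofFun_add (F G : C(T3, ℂ)) : ofFun (F + G : C(T3, ℂ)) = ofFun F + ofFun G := by
  funext k
  simp only [ofFun_apply, Pi.add_apply]
  rw [← integral_add (integrable_mFourier_mul F _) (integrable_mFourier_mul G _)]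
  simp [mul_add]

lemma ofFun_smul (c : ℂ) (F : C(T3, ℂ)) : ofFun (c • F : C(T3, ℂ)) = c • ofFun F := by
  funext k
  simp only [ofFun_apply, Pi.smul_apply, smul_eq_mul]
  rw [← integral_const_mul]
  congr 1; ext x; simp; ring

lemma ofFun_neg (F : C(T3, ℂ)) : ofFun (-F : C(T3, ℂ)) = -ofFun F := by
  simpa using ofFun_smul (-1) F

lemma ofFun_sub (F G : C(T3, ℂ)) : ofFun (F - G : C(T3, ℂ)) = ofFun F - ofFun G := by
  rw [sub_eq_add_neg, ofFun_add, ofFun_neg, sub_eq_add_neg]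

lemma norm_ofFun_le_of_forall {F : T3 → ℂ} {C : ℝ} (h : ∀ x, ‖F x‖ ≤ C) (k : Fin 3 → ℤ) :
    ‖ofFun F k‖ ≤ C := by
  rw [ofFun_apply]
  refine (norm_integral_le_of_norm_le_const (C := C) (ae_of_all _ fun x => ?_)).trans ?_
  · simpa [norm_mFourier_apply] using h x
  · simp

lemma norm_ofFun_le (F : C(T3, ℂ)) (k : Fin 3 → ℤ) : ‖ofFun F k‖ ≤ ‖F‖ :=
  norm_ofFun_le_of_forall F.norm_coe_le_norm k

lemma ofFun_mFourier (m k : Fin 3 → ℤ) :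
    ofFun (mFourier m) k = if k = m then 1 else 0 := by
  have := orthonormal_iff_ite.mp (orthonormal_mFourier (d := Fin 3)) k m
  rw [← this, ContinuousMap.inner_toLp, ofFun_apply]
  simp only [mFourier_neg]
  congr 1; ext x; ring

lemma ofFun_star (F : C(T3, ℂ)) : ofFun (star F : C(T3, ℂ)) = bar (ofFun F) := by
  funext k
  simp only [bar, ofFun_apply, neg_neg]
  rw [← starRingEnd_apply, ← integral_conj]
  congr 1; ext x
  simp [mFourier_neg]

lemma hasSum_sq_ofFun (F : C(T3, ℂ)) :
    HasSum (fun k => ‖ofFun F k‖ ^ 2) (∫ x, ‖F x‖ ^ 2 ∂haarT3) := by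
  have h := hasSum_sq_mFourierCoeff (ContinuousMap.toLp 2 haarT3 ℂ F)
  have hc (k) : mFourierCoeff (ContinuousMap.toLp 2 haarT3 ℂ F) k = ofFun F k :=
    mFourierCoeff_toLp F k
  simp only [hc] at h
  convert h using 1
  refine integral_congr_ae ?_
  filter_upwards [ContinuousMap.coeFn_toLp (p := 2) (𝕜 := ℂ) haarT3 F] with x hx
  rw [← hx]

/-- Bessel's inequality with the sup norm on the right. -/
lemma sum_sq_ofFun_le (F : C(T3, ℂ)) :
    Summable (fun k => ‖ofFun F k‖ ^ 2) ∧ ∑' k, ‖ofFun F k‖ ^ 2 ≤ ‖F‖ ^ 2 := by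
  have h := hasSum_sq_ofFun F
  refine ⟨h.summable, ?_⟩
  rw [h.tsum_eq]
  refine (le_abs_self _).trans ?_
  rw [← Real.norm_eq_abs]
  refine (norm_integral_le_of_norm_le_const (C := ‖F‖ ^ 2) (ae_of_all _ fun x => ?_)).trans ?_
  · rw [norm_pow, norm_norm]
    gcongr
    exact F.norm_coe_le_norm x
  · simp

/-- The Fourier coefficients of a product are the convolution of the Fourier coefficients. -/
lemma hasSum_ofFun_mul (F G : C(T3, ℂ)) (k : Fin 3 → ℤ) :
    HasSum (fun l => ofFun F l * ofFun G (k - l)) (ofFun (F * G : C(T3, ℂ)) k) := by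
  have h := hasSum_prod_mFourierCoeff (ContinuousMap.toLp 2 haarT3 ℂ (mFourier k * star G))
    (ContinuousMap.toLp 2 haarT3 ℂ F)
  have hc (G : C(T3, ℂ)) (k) : mFourierCoeff (ContinuousMap.toLp 2 haarT3 ℂ G) k = ofFun G k :=
    mFourierCoeff_toLp G k
  simp only [hc] at h
  convert h using 1
  · funext l
    have : (starRingEnd ℂ) (ofFun (mFourier k * star G : C(T3, ℂ)) l) = ofFun G (k - l) := by
      rw [ofFun_apply, ofFun_apply, ← integral_conj]
      congr 1; ext x
      simp only [ContinuousMap.mul_apply, ContinuousMap.star_apply, map_mul]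
      rw [← mFourier_neg, ← mFourier_neg, neg_neg, ← mul_assoc, ← mFourier_add]
      simp [sub_eq_add_neg]
    rw [this]
    ring
  · rw [ofFun_apply]
    refine integral_congr_ae ?_
    filter_upwards [ContinuousMap.coeFn_toLp (p := 2) (𝕜 := ℂ) haarT3 F,
      ContinuousMap.coeFn_toLp (p := 2) (𝕜 := ℂ) haarT3 (mFourier k * star G)] with x h1 h2
    have h1' : (ContinuousMap.toLp 2 haarT3 ℂ F) x = F x := h1
    have h2' : (ContinuousMap.toLp 2 haarT3 ℂ (mFourier k * star G))
        x = mFourier k x * star (G x) := h2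
    simp only [h1', h2', mFourier_neg, map_mul, ContinuousMap.mul_apply]
    simp; ring

lemma ofFun_injective {F G : C(T3, ℂ)} (h : ofFun F = ofFun G) : F = G := by
  have h0 : ofFun (F - G : C(T3, ℂ)) = 0 := by rw [ofFun_sub, h, sub_self]
  have h1 := hasSum_sq_ofFun (F - G)
  simp only [h0, Pi.zero_apply, norm_zero] at h1
  have h2 : ∫ x, ‖(F - G) x‖ ^ 2 ∂haarT3 = 0 := by
    have := h1.tsum_eq; simpa using this.symm
  have hc : Continuous (fun x => ‖(F - G) x‖ ^ 2) := by fun_prop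
  rw [integral_eq_zero_iff_of_nonneg (fun x => by positivity)
    (hc.integrable_of_hasCompactSupport (HasCompactSupport.of_compactSpace _))] at h2
  have h3 : (fun x => ‖(F - G) x‖ ^ 2) = fun _ => (0 : ℝ) :=
    (Continuous.ae_eq_iff_eq haarT3 hc continuous_const).mp h2
  ext x
  have := congrFun h3 x
  rwa [pow_eq_zero_iff two_ne_zero, norm_eq_zero, ContinuousMap.sub_apply, sub_eq_zero] at this

/-- `f` is a continuous function. -/
def IsCont (f : PerDist) : Prop := ∃ F : C(T3, ℂ), ofFun F = f

lemma ofFun_toFun {f : PerDist} (h : IsCont f) : ofFun (toFun f) = f := by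
  unfold toFun
  have h' : ∃ F : C(T3, ℂ), ofFun F = f := h
  rw [dif_pos h']
  exact h'.choose_spec

lemma toFun_ofFun (F : C(T3, ℂ)) : toFun (ofFun F) = F :=
  ofFun_injective (ofFun_toFun ⟨F, rfl⟩)

lemma fnMul_ofFun (F G : C(T3, ℂ)) : fnMul (ofFun F) (ofFun G) = ofFun (F * G : C(T3, ℂ)) := by
  unfold fnMul
  rw [toFun_ofFun, toFun_ofFun]; rfl

lemma const_eq_ofFun (c : ℂ) : const c = ofFun (ContinuousMap.const T3 c) := by
  have : ContinuousMap.const T3 c = c • mFourier (0 : Fin 3 → ℤ) := by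
    ext x; simp [mFourier_zero]
  rw [this, ofFun_smul]
  funext k
  simp [const, ofFun_mFourier]

/-! ### Littlewood-Paley weights and blocks -/

lemma latticePoint_neg (k : Fin 3 → ℤ) : latticePoint (-k) = -latticePoint k := by
  ext i; simp [latticePoint]

lemma abs_le_norm_latticePoint (k : Fin 3 → ℤ) (i : Fin 3) : |(k i : ℝ)| ≤ ‖latticePoint k‖ :=
  PiLp.norm_apply_le (latticePoint k) i

lemma finite_norm_latticePoint_le (R : ℝ) : {k | ‖latticePoint k‖ ≤ R}.Finite := by
  refine (Set.finite_Icc (fun _ : Fin 3 => -⌈R⌉) (fun _ => ⌈R⌉)).subset fun k hk => ?_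
  have h i : |k i| ≤ ⌈R⌉ := by
    have : |(k i : ℝ)| ≤ ⌈R⌉ := ((abs_le_norm_latticePoint k i).trans hk).trans (Int.le_ceil R)
    exact_mod_cast this
  exact ⟨fun i => (abs_le.mp (h i)).1, fun i => (abs_le.mp (h i)).2⟩

namespace DyadicPartition

variable (P : DyadicPartition)

lemma weight_nonneg (i : ℕ) (k : Fin 3 → ℤ) : 0 ≤ P.weight i k := by
  cases i with
  | zero => exact (P.chi_mem _).1
  | succ j => exact (P.phi_mem _).1

lemma weight_le_one (i : ℕ) (k : Fin 3 → ℤ) : P.weight i k ≤ 1 := by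
  cases i with
  | zero => exact (P.chi_mem _).2
  | succ j => exact (P.phi_mem _).2

lemma weight_neg (i : ℕ) (k : Fin 3 → ℤ) : P.weight i (-k) = P.weight i k := by
  cases i with
  | zero => exact P.chi_radial _ _ (by rw [latticePoint_neg, norm_neg])
  | succ j => exact P.phi_radial _ _ (by rw [latticePoint_neg, smul_neg, norm_neg])

lemma hasSum_weight (k : Fin 3 → ℤ) : HasSum (fun i => P.weight i k) 1 :=
  P.sum_eq_one (latticePoint k)

lemma phi_eq_zero_of_le {x : E3} (hx : 8 / 3 ≤ ‖x‖) : P.phi x = 0 := by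
  by_contra h
  have := (P.phi_supp (subset_tsupport _ h)).1
  rw [mem_ball_zero_iff] at this
  linarith

lemma phi_eq_zero_of_lt {x : E3} (hx : ‖x‖ < 3 / 4) : P.phi x = 0 := by
  by_contra h
  exact (P.phi_supp (subset_tsupport _ h)).2 (by rwa [mem_ball_zero_iff])

lemma norm_smul_latticePoint (j : ℕ) (k : Fin 3 → ℤ) :
    ‖((2 : ℝ) ^ j)⁻¹ • latticePoint k‖ = ‖latticePoint k‖ / 2 ^ j := by
  rw [norm_smul, norm_inv, norm_pow, Real.norm_ofNat, inv_mul_eq_div]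

lemma weight_eq_zero_of_le {i : ℕ} {k : Fin 3 → ℤ} (h : 8 / 3 * 2 ^ i ≤ ‖latticePoint k‖) :
    P.weight i k = 0 := by
  cases i with
  | zero =>
    by_contra hne
    have := P.chi_supp (subset_tsupport _ hne)
    rw [mem_ball_zero_iff] at this
    linarith
  | succ j =>
    refine P.phi_eq_zero_of_le ?_
    rw [norm_smul_latticePoint, le_div_iff₀ (by positivity)]
    refine le_trans ?_ h
    gcongr <;> norm_num

lemma weight_eq_zero_of_lt {j : ℕ} {k : Fin 3 → ℤ} (h : ‖latticePoint k‖ < 3 / 4 * 2 ^ j) :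
    P.weight (j + 1) k = 0 := by
  refine P.phi_eq_zero_of_lt ?_
  rwa [norm_smul_latticePoint, div_lt_iff₀ (by positivity)]

lemma finite_support_weight (i : ℕ) : {k | P.weight i k ≠ 0}.Finite := by
  refine (finite_norm_latticePoint_le (8 / 3 * 2 ^ i)).subset fun k hk => ?_
  by_contra h
  exact hk (P.weight_eq_zero_of_le (not_le.mp h).le)

/-- The finite set of frequencies of the `i`-th block. -/
def freq (i : ℕ) : Finset (Fin 3 → ℤ) := (P.finite_support_weight i).toFinset

lemma weight_eq_zero_of_notMem {i : ℕ} {k : Fin 3 → ℤ} (h : k ∉ P.freq i) : P.weight i k = 0 := by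
  simpa [freq] using h

/-- The `i`-th block as a continuous function. -/
def blockC (i : ℕ) (f : PerDist) : C(T3, ℂ) :=
  ∑ k ∈ P.freq i, ((P.weight i k : ℂ) * f k) • mFourier k

lemma block_eq_sum (i : ℕ) (f : PerDist) (x : T3) :
    P.block i f x = ∑ k ∈ P.freq i, (P.weight i k : ℂ) * f k * mFourier k x :=
  tsum_eq_sum fun k hk => by simp [P.weight_eq_zero_of_notMem hk]

lemma coe_blockC (i : ℕ) (f : PerDist) : ⇑(P.blockC i f) = P.block i f := by
  funext x
  rw [block_eq_sum, blockC, ContinuousMap.sum_apply]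
  simp

lemma ofFun_sum_smul_mFourier (s : Finset (Fin 3 → ℤ)) (c : (Fin 3 → ℤ) → ℂ) (k : Fin 3 → ℤ) :
    ofFun (∑ m ∈ s, c m • mFourier m : C(T3, ℂ)) k = if k ∈ s then c k else 0 := by
  classical
  induction s using Finset.induction_on with
  | empty =>
    simp [ofFun_apply]
  | insert a s ha ih =>
    rw [Finset.sum_insert ha, ofFun_add, Pi.add_apply, ih, ofFun_smul, Pi.smul_apply,
      ofFun_mFourier]
    by_cases h : k = a
    · subst h; simp [ha]
    · simp [h]

lemma ofFun_blockC (i : ℕ) (f : PerDist) (k : Fin 3 → ℤ) :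
    ofFun (P.blockC i f) k = P.weight i k * f k := by
  rw [blockC, ofFun_sum_smul_mFourier]
  split_ifs with h
  · rfl
  · simp [P.weight_eq_zero_of_notMem h]

lemma blockMul_eq_tsum (i j : ℕ) (f g : PerDist) (k : Fin 3 → ℤ) :
    P.blockMul i j f g k =
      ∑' l, ((P.weight i l * P.weight j (k - l) : ℝ) : ℂ) * (f l * g (k - l)) := by
  have h := (hasSum_ofFun_mul (P.blockC i f) (P.blockC j g) k).tsum_eq
  simp only [ofFun_blockC] at h
  rw [blockMul, ← coe_blockC, ← coe_blockC]
  refine h.symm.trans (tsum_congr fun l => ?_)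
  push_cast; ring

end DyadicPartition

/-! ### Square-summable and absolutely summable Fourier coefficients -/

/-- The Fourier coefficients of `f` are square-summable, that is, `f ∈ L²`. -/
def L2 (f : PerDist) : Prop := Summable fun k => ‖f k‖ ^ 2

/-- The Fourier coefficients of `f` are absolutely summable, that is, `f` belongs to the Wiener
algebra. -/
def Wiener (f : PerDist) : Prop := Summable fun k => ‖f k‖

lemma L2.mono {f g : PerDist} (hg : L2 g) (h : ∀ k, ‖f k‖ ≤ ‖g k‖) : L2 f :=
  Summable.of_nonneg_of_le (fun _ => by positivity) (fun k => by gcongr; exact h k) hg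

lemma L2.add {f g : PerDist} (hf : L2 f) (hg : L2 g) : L2 (f + g) := by
  refine Summable.of_nonneg_of_le (fun _ => by positivity) (fun k => ?_)
    ((Summable.mul_left 2 hf).add (Summable.mul_left 2 hg))
  have : ‖(f + g) k‖ ≤ ‖f k‖ + ‖g k‖ := norm_add_le _ _
  nlinarith [sq_nonneg (‖f k‖ - ‖g k‖), norm_nonneg ((f + g) k), norm_nonneg (f k),
    norm_nonneg (g k)]

lemma L2.smul {f : PerDist} (hf : L2 f) (c : ℂ) : L2 (c • f) := by
  refine (Summable.mul_left (‖c‖ ^ 2) hf).congr fun k => ?_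
  simp [mul_pow]

lemma L2.neg {f : PerDist} (hf : L2 f) : L2 (-f) := by
  simpa using hf.smul (-1)

lemma L2.sub {f g : PerDist} (hf : L2 f) (hg : L2 g) : L2 (f - g) := by
  simpa [sub_eq_add_neg] using hf.add hg.neg

lemma L2.bar {f : PerDist} (hf : L2 f) : L2 (bar f) := by
  have := (Equiv.neg (Fin 3 → ℤ)).summable_iff.mpr hf
  refine this.congr fun k => ?_
  simp [CGL.bar]

lemma Wiener.bar {f : PerDist} (hf : Wiener f) : Wiener (bar f) := by
  have := (Equiv.neg (Fin 3 → ℤ)).summable_iff.mpr hf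
  refine this.congr fun k => ?_
  simp [CGL.bar]

lemma Wiener.l2 {f : PerDist} (hf : Wiener f) : L2 f := by
  have h : ∀ k, ‖f k‖ ≤ ∑' k, ‖f k‖ := fun k => hf.le_tsum k fun _ _ => norm_nonneg _
  refine Summable.of_nonneg_of_le (fun _ => by positivity) (fun k => ?_)
    (hf.mul_left (∑' k, ‖f k‖))
  rw [sq]
  exact mul_le_mul_of_nonneg_right (h k) (norm_nonneg _)

lemma L2_ofFun (F : C(T3, ℂ)) : L2 (ofFun F) := (sum_sq_ofFun_le F).1

lemma L2_const (c : ℂ) : L2 (const c) := by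
  rw [const_eq_ofFun]; exact L2_ofFun _

lemma bar_add (f g : PerDist) : bar (f + g) = bar f + bar g := by
  funext k; simp [bar]

lemma bar_sub (f g : PerDist) : bar (f - g) = bar f - bar g := by
  funext k; simp [bar]

lemma bar_neg (f : PerDist) : bar (-f) = -bar f := by
  funext k; simp [bar]

lemma bar_smul (c : ℂ) (f : PerDist) : bar (c • f) = star c • bar f := by
  funext k; simp [bar]

lemma bar_bar (f : PerDist) : bar (bar f) = f := by
  funext k; simp [bar]

lemma bar_const (c : ℂ) : bar (const c) = const (star c) := by
  funext k
  by_cases h : k = 0 <;> simp [bar, const, h]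

lemma L2.summable_mul {f g : PerDist} (hf : L2 f) (hg : L2 g) (k : Fin 3 → ℤ) :
    Summable fun l => ‖f l‖ * ‖g (k - l)‖ := by
  have hg' : Summable fun l => ‖g (k - l)‖ ^ 2 := (Equiv.subLeft k).summable_iff.mpr hg
  refine Summable.of_nonneg_of_le (fun _ => by positivity) (fun l => ?_) (Summable.add hf hg')
  nlinarith [sq_nonneg (‖f l‖ - ‖g (k - l)‖), sq_nonneg (‖f l‖), sq_nonneg (‖g (k - l)‖)]

lemma L2.tsum_mul_le {f g : PerDist} (hf : L2 f) (hg : L2 g) (k : Fin 3 → ℤ) :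
    ∑' l, ‖f l‖ * ‖g (k - l)‖ ≤ √(∑' l, ‖f l‖ ^ 2) * √(∑' l, ‖g l‖ ^ 2) := by
  have hg' : Summable fun l => ‖g (k - l)‖ ^ 2 := (Equiv.subLeft k).summable_iff.mpr hg
  have h := Real.inner_le_Lp_mul_Lq_tsum_of_nonneg Real.HolderConjugate.two_two
    (f := fun l => ‖f l‖) (g := fun l => ‖g (k - l)‖) (fun _ => norm_nonneg _)
    (fun _ => norm_nonneg _) (by simpa [L2] using hf) (by simpa using hg')
  have e : ∑' l, ‖g (k - l)‖ ^ 2 = ∑' l, ‖g l‖ ^ 2 :=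
    (Equiv.subLeft k).tsum_eq (fun l => ‖g l‖ ^ 2)
  simpa [Real.sqrt_eq_rpow, e] using h

/-! ### Bilinear Fourier multipliers -/

/-- The bilinear Fourier multiplier `∑ₖ ∑ₗ σ(l, k - l) f(l) g(k - l) e_k`. -/
def bilin (σ : (Fin 3 → ℤ) → (Fin 3 → ℤ) → ℝ) (f g : PerDist) : PerDist := fun k =>
  ∑' l, (σ l (k - l) : ℂ) * (f l * g (k - l))

/-- `σ` is the symbol of a bilinear Fourier multiplier bounded by the product: its values are in
`[0, 1]`. No regularity is asked. -/
def IsSymbol (σ : (Fin 3 → ℤ) → (Fin 3 → ℤ) → ℝ) : Prop := ∀ a b, σ a b ∈ Icc (0 : ℝ) 1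

section bilin

variable {σ : (Fin 3 → ℤ) → (Fin 3 → ℤ) → ℝ}

lemma IsSymbol.norm_le (hσ : IsSymbol σ) (f g : PerDist) (k l : Fin 3 → ℤ) :
    ‖(σ l (k - l) : ℂ) * (f l * g (k - l))‖ ≤ ‖f l‖ * ‖g (k - l)‖ := by
  rw [norm_mul, norm_mul, Complex.norm_real, Real.norm_eq_abs, abs_of_nonneg (hσ _ _).1]
  exact mul_le_of_le_one_left (by positivity) (hσ _ _).2

lemma IsSymbol.summable (hσ : IsSymbol σ) {f g : PerDist} (hf : L2 f) (hg : L2 g) (k : Fin 3 → ℤ) :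
    Summable fun l => (σ l (k - l) : ℂ) * (f l * g (k - l)) :=
  Summable.of_norm_bounded (hf.summable_mul hg k) (hσ.norm_le f g k)

lemma IsSymbol.norm_bilin_le_tsum (hσ : IsSymbol σ) {f g : PerDist} (hf : L2 f) (hg : L2 g)
    (k : Fin 3 → ℤ) :
    ‖bilin σ f g k‖ ≤ ∑' l, ‖f l‖ * ‖g (k - l)‖ :=
  tsum_of_norm_bounded (hf.summable_mul hg k).hasSum (hσ.norm_le f g k)

lemma IsSymbol.norm_bilin_le (hσ : IsSymbol σ) {f g : PerDist} (hf : L2 f) (hg : L2 g)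
    (k : Fin 3 → ℤ) :
    ‖bilin σ f g k‖ ≤ √(∑' l, ‖f l‖ ^ 2) * √(∑' l, ‖g l‖ ^ 2) :=
  (hσ.norm_bilin_le_tsum hf hg k).trans (hf.tsum_mul_le hg k)

lemma IsSymbol.bilin_add_left (hσ : IsSymbol σ) {f f' g : PerDist} (hf : L2 f) (hf' : L2 f')
    (hg : L2 g) :
    bilin σ (f + f') g = bilin σ f g + bilin σ f' g := by
  funext k
  simp only [bilin, Pi.add_apply]
  rw [← (hσ.summable hf hg k).tsum_add (hσ.summable hf' hg k)]
  exact tsum_congr fun l => by ring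

lemma IsSymbol.bilin_add_right (hσ : IsSymbol σ) {f g g' : PerDist} (hf : L2 f) (hg : L2 g)
    (hg' : L2 g') :
    bilin σ f (g + g') = bilin σ f g + bilin σ f g' := by
  funext k
  simp only [bilin, Pi.add_apply]
  rw [← (hσ.summable hf hg k).tsum_add (hσ.summable hf hg' k)]
  exact tsum_congr fun l => by ring

lemma bilin_smul_left (c : ℂ) (f g : PerDist) : bilin σ (c • f) g = c • bilin σ f g := by
  funext k
  simp only [bilin, Pi.smul_apply, smul_eq_mul, ← tsum_mul_left]
  exact tsum_congr fun l => by ring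

lemma bilin_smul_right (c : ℂ) (f g : PerDist) : bilin σ f (c • g) = c • bilin σ f g := by
  funext k
  simp only [bilin, Pi.smul_apply, smul_eq_mul, ← tsum_mul_left]
  exact tsum_congr fun l => by ring

lemma bilin_swap (f g : PerDist) : bilin (fun a b => σ b a) f g = bilin σ g f := by
  funext k
  rw [bilin, bilin, ← (Equiv.subLeft k).tsum_eq]
  refine tsum_congr fun l => ?_
  simp only [Equiv.subLeft_apply, sub_sub_cancel]
  ring

lemma bar_bilin (h : ∀ a b, σ (-a) (-b) = σ a b) (f g : PerDist) :
    bar (bilin σ f g) = bilin σ (bar f) (bar g) := by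
  funext k
  simp only [bar, bilin]
  rw [← starRingEnd_apply, Complex.conj_tsum, ← (Equiv.neg _).tsum_eq]
  refine tsum_congr fun l => ?_
  have : -k - -l = -(k - l) := by abel
  simp only [Equiv.neg_apply, map_mul, Complex.conj_ofReal, this, h]
  rfl

/-- Dominated convergence for bilinear Fourier multipliers. -/
lemma IsSymbol.tendsto_bilin (hσ : IsSymbol σ) {f g F G : PerDist} {fn gn : ℕ → PerDist}
    (hF : L2 F) (hG : L2 G)
    (hf : ∀ k, Tendsto (fun n => fn n k) atTop (𝓝 (f k)))
    (hg : ∀ k, Tendsto (fun n => gn n k) atTop (𝓝 (g k)))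
    (hfF : ∀ n k, ‖fn n k‖ ≤ ‖F k‖) (hgG : ∀ n k, ‖gn n k‖ ≤ ‖G k‖) (k : Fin 3 → ℤ) :
    Tendsto (fun n => bilin σ (fn n) (gn n) k) atTop (𝓝 (bilin σ f g k)) := by
  refine tendsto_tsum_of_dominated_convergence (hF.summable_mul hG k)
    (fun l => ((hf l).mul (hg _)).const_mul _) (Eventually.of_forall fun n l => ?_)
  exact (hσ.norm_le _ _ k l).trans (by gcongr <;> apply_assumption)

end bilin

/-- The convolution of the moduli of the Fourier coefficients. -/
def absConv (f g : PerDist) : PerDist := fun k => ((∑' l, ‖f l‖ * ‖g (k - l)‖ : ℝ) : ℂ)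

lemma norm_absConv (f g : PerDist) (k : Fin 3 → ℤ) :
    ‖absConv f g k‖ = ∑' l, ‖f l‖ * ‖g (k - l)‖ := by
  rw [absConv, Complex.norm_real, Real.norm_of_nonneg (tsum_nonneg fun _ => by positivity)]

lemma absConv_comm (f g : PerDist) : absConv f g = absConv g f := by
  funext k
  rw [absConv, absConv, ← (Equiv.subLeft k).tsum_eq]
  congr 1
  refine tsum_congr fun l => ?_
  simp [mul_comm]

/-- Young's inequality `ℓ¹ * ℓ² ⊆ ℓ²`. -/
lemma Wiener.L2_absConv {f g : PerDist} (hf : Wiener f) (hg : L2 g) : L2 (absConv f g) := by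
  set e : (Fin 3 → ℤ) × (Fin 3 → ℤ) ≃ (Fin 3 → ℤ) × (Fin 3 → ℤ) :=
    { toFun := fun p => (p.2, p.1 - p.2)
      invFun := fun p => (p.1 + p.2, p.1)
      left_inv := fun p => by simp
      right_inv := fun p => by simp }
  have h2 : Summable fun p : (Fin 3 → ℤ) × (Fin 3 → ℤ) => ‖f p.1‖ * ‖g p.2‖ ^ 2 :=
    Summable.mul_of_nonneg (f := fun l => ‖f l‖) (g := fun l => ‖g l‖ ^ 2) hf hg
      (fun _ => norm_nonneg _) (fun _ => by positivity)
  have h3 := e.summable_iff.mpr h2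
  have h4 : ∀ k, Summable fun l => ‖f l‖ * ‖g (k - l)‖ ^ 2 := fun k => h3.prod_factor k
  have h5 : Summable fun k => ∑' l, ‖f l‖ * ‖g (k - l)‖ ^ 2 := h3.prod
  refine Summable.of_nonneg_of_le (fun _ => by positivity) (fun k => ?_)
    (h5.mul_left (∑' l, ‖f l‖))
  rw [norm_absConv]
  have h := Real.inner_le_Lp_mul_Lq_tsum_of_nonneg Real.HolderConjugate.two_two
    (f := fun l => √‖f l‖) (g := fun l => √‖f l‖ * ‖g (k - l)‖) (fun _ => by positivity)
    (fun _ => by positivity)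
    (by simpa [Real.sq_sqrt, Wiener] using hf)
    (by simpa [mul_pow, Real.sq_sqrt] using h4 k)
  have e1 : ∀ l, √‖f l‖ * (√‖f l‖ * ‖g (k - l)‖) = ‖f l‖ * ‖g (k - l)‖ := fun l => by
    rw [← mul_assoc, Real.mul_self_sqrt (norm_nonneg _)]
  simp only [e1, Real.rpow_ofNat, mul_pow, Real.sq_sqrt (norm_nonneg _),
    ← Real.sqrt_eq_rpow] at h
  have hn : 0 ≤ ∑' l, ‖f l‖ * ‖g (k - l)‖ := tsum_nonneg fun _ => by positivity
  calc _ ≤ (√(∑' l, ‖f l‖) * √(∑' l, ‖f l‖ * ‖g (k - l)‖ ^ 2)) ^ 2 := by gcongr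
    _ = _ := by
      rw [mul_pow, Real.sq_sqrt (tsum_nonneg fun _ => norm_nonneg _),
        Real.sq_sqrt (tsum_nonneg fun _ => by positivity)]

lemma L2.L2_absConv {f g : PerDist} (hf : L2 f) (hg : Wiener g) : L2 (absConv f g) := by
  rw [absConv_comm]; exact hg.L2_absConv hf

lemma IsSymbol.L2_bilin {σ : (Fin 3 → ℤ) → (Fin 3 → ℤ) → ℝ} (hσ : IsSymbol σ) {f g : PerDist}
    (hf : L2 f) (hg : L2 g) (h : L2 (absConv f g)) : L2 (bilin σ f g) :=
  h.mono fun k => by rw [norm_absConv]; exact hσ.norm_bilin_le_tsum hf hg k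

/-! ### Paraproducts, resonant products and products of square-integrable functions -/

namespace DyadicPartition

variable (P : DyadicPartition)

/-- The symbol `∑_{(i, j) ∈ S} ρ_i(a) ρ_j(b)` of the bilinear operator
`∑_{(i, j) ∈ S} Δ_i f Δ_j g`. -/
def sym (S : Set (ℕ × ℕ)) (a b : Fin 3 → ℤ) : ℝ :=
  ∑' p, S.indicator (fun p => P.weight p.1 a * P.weight p.2 b) p

lemma hasSum_weight_mul (a b : Fin 3 → ℤ) :
    HasSum (fun p : ℕ × ℕ => P.weight p.1 a * P.weight p.2 b) 1 := by
  have h := Summable.mul_of_nonneg (P.hasSum_weight a).summable (P.hasSum_weight b).summable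
    (fun i => P.weight_nonneg i a) (fun i => P.weight_nonneg i b)
  simpa using (P.hasSum_weight a).mul (P.hasSum_weight b) h

lemma weight_mul_nonneg (a b : Fin 3 → ℤ) (p : ℕ × ℕ) :
    0 ≤ P.weight p.1 a * P.weight p.2 b :=
  mul_nonneg (P.weight_nonneg _ _) (P.weight_nonneg _ _)

lemma summable_indicator_weight (S : Set (ℕ × ℕ)) (a b : Fin 3 → ℤ) :
    Summable (S.indicator (fun p : ℕ × ℕ => P.weight p.1 a * P.weight p.2 b)) :=
  (P.hasSum_weight_mul a b).summable.indicator S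

lemma isSymbol_sym (S : Set (ℕ × ℕ)) : IsSymbol (P.sym S) := fun a b => by
  refine ⟨tsum_nonneg fun p => indicator_nonneg (fun p _ => P.weight_mul_nonneg a b p) p, ?_⟩
  rw [← (P.hasSum_weight_mul a b).tsum_eq]
  exact (P.summable_indicator_weight S a b).tsum_le_tsum
    (fun p => indicator_le_self' (fun _ _ => P.weight_mul_nonneg a b _) p)
    (P.hasSum_weight_mul a b).summable

lemma sym_neg (S : Set (ℕ × ℕ)) (a b : Fin 3 → ℤ) : P.sym S (-a) (-b) = P.sym S a b := by
  simp only [sym, weight_neg]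

open Classical in
lemma tsum_ite_blockMul (S : Set (ℕ × ℕ)) {f g : PerDist} (hf : L2 f) (hg : L2 g)
    (k : Fin 3 → ℤ) :
    ∑' p : ℕ × ℕ, (if p ∈ S then P.blockMul p.1 p.2 f g k else 0) = bilin (P.sym S) f g k := by
  set φ : (Fin 3 → ℤ) → ℕ × ℕ → ℂ := fun l p =>
    ((S.indicator (fun p => P.weight p.1 l * P.weight p.2 (k - l)) p : ℝ) : ℂ) * (f l * g (k - l))
    with hφ
  have hS : Summable (Function.uncurry φ) := by
    set D : (Fin 3 → ℤ) × (ℕ × ℕ) → ℝ := fun q =>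
      P.weight q.2.1 q.1 * P.weight q.2.2 (k - q.1) * (‖f q.1‖ * ‖g (k - q.1)‖) with hD
    have hnn : 0 ≤ D := fun q =>
      mul_nonneg (P.weight_mul_nonneg q.1 (k - q.1) q.2) (by positivity)
    have hd : Summable D := by
      refine (summable_prod_of_nonneg hnn).2
        ⟨fun l => (P.hasSum_weight_mul l (k - l)).summable.mul_right (‖f l‖ * ‖g (k - l)‖), ?_⟩
      refine (hf.summable_mul hg k).congr fun l => ?_
      simp only [hD]
      rw [tsum_mul_right, (P.hasSum_weight_mul l (k - l)).tsum_eq, one_mul]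
    refine Summable.of_norm_bounded hd fun q => ?_
    simp only [Function.uncurry_def, hφ, hD]
    rw [norm_mul, norm_mul, Complex.norm_real, Real.norm_of_nonneg
      (indicator_nonneg (fun p _ => P.weight_mul_nonneg q.1 (k - q.1) p) _)]
    exact mul_le_mul_of_nonneg_right
      (indicator_le_self' (fun p _ => P.weight_mul_nonneg q.1 (k - q.1) p) _) (by positivity)
  have h1 := hS.tsum_comm
  have h2 : ∀ p, (if p ∈ S then P.blockMul p.1 p.2 f g k else 0) = ∑' l, φ l p := fun p => by
    by_cases hp : p ∈ S
    · simp only [hp, if_true, hφ, indicator_of_mem, blockMul_eq_tsum]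
    · simp [hp, hφ]
  rw [tsum_congr h2, h1]
  refine tsum_congr fun l => ?_
  rw [hφ, tsum_mul_right, sym, Complex.ofReal_tsum]

/-- The pairs of indices of the paraproduct. -/
def lowSet : Set (ℕ × ℕ) := {p | p.1 + 2 ≤ p.2}

/-- The pairs of indices of the resonant product. -/
def resSet : Set (ℕ × ℕ) := {p | p.1 ≤ p.2 + 1 ∧ p.2 ≤ p.1 + 1}

variable {P} {f g h : PerDist}

lemma para_eq_bilin (hf : L2 f) (hg : L2 g) : P.para f g = bilin (P.sym lowSet) f g := by
  funext k
  rw [← P.tsum_ite_blockMul lowSet hf hg k, para]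
  exact tsum_congr fun p => by by_cases h : p.1 + 2 ≤ p.2 <;> simp [lowSet, h]

lemma reso_eq_bilin (hf : L2 f) (hg : L2 g) : P.reso f g = bilin (P.sym resSet) f g := by
  funext k
  rw [← P.tsum_ite_blockMul resSet hf hg k, reso]
  exact tsum_congr fun p => by
    by_cases h : p.1 ≤ p.2 + 1 ∧ p.2 ≤ p.1 + 1 <;> simp [resSet, h]

lemma sym_add (P : DyadicPartition) (a b : Fin 3 → ℤ) :
    P.sym lowSet a b + P.sym resSet a b + P.sym lowSet b a = 1 := by
  have e : P.sym lowSet b a =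
      ∑' p, {p : ℕ × ℕ | p.2 + 2 ≤ p.1}.indicator (fun p => P.weight p.1 a * P.weight p.2 b) p := by
    rw [sym, ← (Equiv.prodComm ℕ ℕ).tsum_eq]
    refine tsum_congr fun p => ?_
    simp [indicator_apply, lowSet, mul_comm]
  rw [e, sym, sym, ← (P.summable_indicator_weight _ a b).tsum_add
      (P.summable_indicator_weight _ a b),
    ← ((P.summable_indicator_weight _ a b).add (P.summable_indicator_weight _ a b)).tsum_add
      (P.summable_indicator_weight _ a b), ← (P.hasSum_weight_mul a b).tsum_eq]
  refine tsum_congr fun p => ?_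
  simp only [indicator_apply, lowSet, resSet, mem_ofPred_eq]
  by_cases h1 : p.1 + 2 ≤ p.2
  · have h2 : ¬ (p.1 ≤ p.2 + 1 ∧ p.2 ≤ p.1 + 1) := by omega
    have h3 : ¬ (p.2 + 2 ≤ p.1) := by omega
    simp [h1, h2, h3]
  · by_cases h3 : p.2 + 2 ≤ p.1
    · have h2 : ¬ (p.1 ≤ p.2 + 1 ∧ p.2 ≤ p.1 + 1) := by omega
      simp [h1, h2, h3]
    · have h2 : p.1 ≤ p.2 + 1 ∧ p.2 ≤ p.1 + 1 := by omega
      simp [h1, h2, h3]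

end DyadicPartition

/-- The convolution of Fourier coefficients, that is, the product of functions. -/
abbrev conv (f g : PerDist) : PerDist := bilin (fun _ _ => 1) f g

lemma isSymbol_one : IsSymbol fun _ _ => 1 := fun _ _ => ⟨zero_le_one, le_rfl⟩

lemma conv_comm (f g : PerDist) : conv f g = conv g f := bilin_swap (σ := fun _ _ => 1) f g

lemma conv_ofFun (F G : C(T3, ℂ)) : conv (ofFun F) (ofFun G) = ofFun (F * G : C(T3, ℂ)) := by
  funext k
  rw [← (hasSum_ofFun_mul F G k).tsum_eq]
  exact tsum_congr fun l => by simp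

namespace DyadicPartition

variable {P : DyadicPartition} {f g h : PerDist}

/-- On `L²` the Littlewood-Paley decomposition of the product recovers the product. -/
lemma mul_eq_conv (hf : L2 f) (hg : L2 g) : P.mul f g = conv f g := by
  rw [mul, para_eq_bilin hf hg, reso_eq_bilin hf hg, para_eq_bilin hg hf,
    ← bilin_swap (σ := P.sym lowSet) f g]
  have hs : IsSymbol fun a b => P.sym lowSet b a := fun a b => P.isSymbol_sym _ b a
  funext k
  simp only [Pi.add_apply, bilin, conv]
  rw [← ((P.isSymbol_sym _).summable hf hg k).tsum_add ((P.isSymbol_sym _).summable hf hg k),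
    ← (((P.isSymbol_sym _).summable hf hg k).add ((P.isSymbol_sym _).summable hf hg k)).tsum_add
      (hs.summable hf hg k)]
  refine tsum_congr fun l => ?_
  rw [← add_mul, ← add_mul, ← Complex.ofReal_add, ← Complex.ofReal_add, P.sym_add]

lemma mul_ofFun (F G : C(T3, ℂ)) :
    P.mul (ofFun F) (ofFun G) = ofFun (F * G : C(T3, ℂ)) := by
  rw [mul_eq_conv (L2_ofFun F) (L2_ofFun G), conv_ofFun]

lemma mul_comm_of_L2 (hf : L2 f) (hg : L2 g) : P.mul f g = P.mul g f := by
  rw [mul_eq_conv hf hg, mul_eq_conv hg hf, conv_comm]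

lemma mul_add_right (hf : L2 f) (hg : L2 g) (hh : L2 h) :
    P.mul f (g + h) = P.mul f g + P.mul f h := by
  rw [mul_eq_conv hf (hg.add hh), mul_eq_conv hf hg, mul_eq_conv hf hh, conv, conv, conv,
    isSymbol_one.bilin_add_right hf hg hh]

lemma mul_add_left (hf : L2 f) (hg : L2 g) (hh : L2 h) :
    P.mul (f + g) h = P.mul f h + P.mul g h := by
  rw [mul_eq_conv (hf.add hg) hh, mul_eq_conv hf hh, mul_eq_conv hg hh, conv, conv, conv,
    isSymbol_one.bilin_add_left hf hg hh]

lemma mul_smul_left (hf : L2 f) (hg : L2 g) (c : ℂ) : P.mul (c • f) g = c • P.mul f g := by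
  rw [mul_eq_conv (hf.smul c) hg, mul_eq_conv hf hg, conv, conv, bilin_smul_left]

lemma mul_smul_right (hf : L2 f) (hg : L2 g) (c : ℂ) : P.mul f (c • g) = c • P.mul f g := by
  rw [mul_eq_conv hf (hg.smul c), mul_eq_conv hf hg, conv, conv, bilin_smul_right]

lemma mul_const (hf : L2 f) (c : ℂ) : P.mul f (const c) = c • f := by
  rw [mul_eq_conv hf (L2_const c)]
  funext k
  rw [conv, bilin, tsum_eq_single k]
  · simp [const]; ring
  · intro l hl
    simp [const, sub_eq_zero, hl.symm]

lemma para_add_left (hf : L2 f) (hg : L2 g) (hh : L2 h) :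
    P.para (f + g) h = P.para f h + P.para g h := by
  rw [para_eq_bilin (hf.add hg) hh, para_eq_bilin hf hh, para_eq_bilin hg hh,
    (P.isSymbol_sym _).bilin_add_left hf hg hh]

lemma para_add_right (hf : L2 f) (hg : L2 g) (hh : L2 h) :
    P.para f (g + h) = P.para f g + P.para f h := by
  rw [para_eq_bilin hf (hg.add hh), para_eq_bilin hf hg, para_eq_bilin hf hh,
    (P.isSymbol_sym _).bilin_add_right hf hg hh]

lemma para_smul_right (hf : L2 f) (hg : L2 g) (c : ℂ) : P.para f (c • g) = c • P.para f g := by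
  rw [para_eq_bilin hf (hg.smul c), para_eq_bilin hf hg, bilin_smul_right]

lemma reso_add_left (hf : L2 f) (hg : L2 g) (hh : L2 h) :
    P.reso (f + g) h = P.reso f h + P.reso g h := by
  rw [reso_eq_bilin (hf.add hg) hh, reso_eq_bilin hf hh, reso_eq_bilin hg hh,
    (P.isSymbol_sym _).bilin_add_left hf hg hh]

lemma para_smul_left (hf : L2 f) (hg : L2 g) (c : ℂ) : P.para (c • f) g = c • P.para f g := by
  rw [para_eq_bilin (hf.smul c) hg, para_eq_bilin hf hg, bilin_smul_left]

lemma reso_smul_left (hf : L2 f) (hg : L2 g) (c : ℂ) : P.reso (c • f) g = c • P.reso f g := by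
  rw [reso_eq_bilin (hf.smul c) hg, reso_eq_bilin hf hg, bilin_smul_left]

lemma sym_resSet_comm (P : DyadicPartition) (a b : Fin 3 → ℤ) :
    P.sym resSet a b = P.sym resSet b a := by
  rw [sym, sym, ← (Equiv.prodComm ℕ ℕ).tsum_eq]
  refine tsum_congr fun p => ?_
  simp [indicator_apply, resSet, mul_comm, and_comm]

lemma reso_comm (hf : L2 f) (hg : L2 g) : P.reso f g = P.reso g f := by
  rw [reso_eq_bilin hf hg, reso_eq_bilin hg hf, ← bilin_swap]
  congr 1
  funext a b
  exact P.sym_resSet_comm b a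

lemma bar_para (hf : L2 f) (hg : L2 g) : bar (P.para f g) = P.para (bar f) (bar g) := by
  rw [para_eq_bilin hf hg, para_eq_bilin hf.bar hg.bar, bar_bilin (P.sym_neg _)]

lemma bar_reso (hf : L2 f) (hg : L2 g) : bar (P.reso f g) = P.reso (bar f) (bar g) := by
  rw [reso_eq_bilin hf hg, reso_eq_bilin hf.bar hg.bar, bar_bilin (P.sym_neg _)]

lemma L2_para (hf : L2 f) (hg : L2 g) (h : L2 (absConv f g)) : L2 (P.para f g) := by
  rw [para_eq_bilin hf hg]; exact (P.isSymbol_sym _).L2_bilin hf hg h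

lemma L2_reso (hf : L2 f) (hg : L2 g) (h : L2 (absConv f g)) : L2 (P.reso f g) := by
  rw [reso_eq_bilin hf hg]; exact (P.isSymbol_sym _).L2_bilin hf hg h

/-! ### The commutator of regular functions -/

/-- The symbol of the truncation. -/
def truncWeight (P : DyadicPartition) (n : ℕ) (k : Fin 3 → ℤ) : ℝ :=
  ∑ i ∈ Finset.range n, P.weight i k

lemma trunc_eq (n : ℕ) (f : PerDist) (k : Fin 3 → ℤ) :
    P.trunc n f k = P.truncWeight n k * f k := by
  rw [trunc, truncWeight, ← Finset.sum_mul]; push_cast; rfl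

lemma norm_trunc_le (n : ℕ) (f : PerDist) (k : Fin 3 → ℤ) : ‖P.trunc n f k‖ ≤ ‖f k‖ := by
  rw [trunc_eq, norm_mul, Complex.norm_real, truncWeight, Real.norm_of_nonneg
    (Finset.sum_nonneg fun i _ => P.weight_nonneg i k)]
  refine mul_le_of_le_one_left (norm_nonneg _) ?_
  exact sum_le_hasSum _ (fun i _ => P.weight_nonneg i k) (P.hasSum_weight k)

lemma tendsto_trunc (f : PerDist) (k : Fin 3 → ℤ) :
    Tendsto (fun n => P.trunc n f k) atTop (𝓝 (f k)) := by
  simp only [trunc_eq]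
  have h := (Complex.continuous_ofReal.tendsto _).comp (P.hasSum_weight k).tendsto_sum_nat
  simpa [truncWeight] using h.mul_const (f k)

/-- When the triple convolutions converge absolutely, the extended commutator is the commutator. -/
lemma comm_eq (hf : L2 f) (hg : L2 g) (hh : L2 h) (hfg : L2 (absConv f g))
    (hgh : L2 (absConv g h)) :
    P.comm f g h = P.reso (P.para f g) h - P.mul f (P.reso g h) := by
  funext k
  have t2 : ∀ {u : PerDist}, L2 u → ∀ n, L2 (P.trunc n u) := fun hu n => hu.mono (norm_trunc_le n _)
  have habs : ∀ {u v : PerDist}, L2 u → L2 v → ∀ n k,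
      ‖absConv (P.trunc n u) (P.trunc n v) k‖ ≤ ‖absConv u v k‖ := fun {u v} hu hv n k => by
    rw [norm_absConv, norm_absConv]
    refine ((t2 hu n).summable_mul (t2 hv n) k).tsum_le_tsum (fun l => ?_) (hu.summable_mul hv k)
    gcongr <;> exact norm_trunc_le _ _ _
  have hlo : ∀ {S : Set (ℕ × ℕ)} {u v : PerDist}, L2 u → L2 v → ∀ n k,
      ‖bilin (P.sym S) (P.trunc n u) (P.trunc n v) k‖ ≤ ‖absConv u v k‖ := fun hu hv n k =>
    ((P.isSymbol_sym _).norm_bilin_le_tsum (t2 hu n) (t2 hv n) k).trans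
      ((norm_absConv _ _ _).ge.trans (habs hu hv n k))
  have e : ∀ n, P.commSmooth (P.trunc n f) (P.trunc n g) (P.trunc n h) k =
      bilin (P.sym resSet) (bilin (P.sym lowSet) (P.trunc n f) (P.trunc n g)) (P.trunc n h) k -
      conv (P.trunc n f) (bilin (P.sym resSet) (P.trunc n g) (P.trunc n h)) k := fun n => by
    have a1 : L2 (absConv (P.trunc n f) (P.trunc n g)) := hfg.mono (habs hf hg n)
    have a2 : L2 (absConv (P.trunc n g) (P.trunc n h)) := hgh.mono (habs hg hh n)
    rw [commSmooth, Pi.sub_apply,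
      reso_eq_bilin (L2_para (t2 hf n) (t2 hg n) a1) (t2 hh n), para_eq_bilin (t2 hf n) (t2 hg n),
      mul_eq_conv (t2 hf n) (L2_reso (t2 hg n) (t2 hh n) a2), reso_eq_bilin (t2 hg n) (t2 hh n)]
  rw [comm]
  refine Tendsto.limUnder_eq ?_
  simp only [e]
  rw [Pi.sub_apply, reso_eq_bilin (L2_para hf hg hfg) hh, para_eq_bilin hf hg,
      mul_eq_conv hf (L2_reso hg hh hgh), reso_eq_bilin hg hh]
  refine Tendsto.sub ?_ ?_
  · refine (P.isSymbol_sym _).tendsto_bilin hfg hh (fun k => ?_) (tendsto_trunc h)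
      (fun n k => hlo hf hg n k) (fun n k => norm_trunc_le n h k) k
    exact (P.isSymbol_sym _).tendsto_bilin hf hg (tendsto_trunc f) (tendsto_trunc g)
      (fun n k => norm_trunc_le n f k) (fun n k => norm_trunc_le n g k) k
  · refine isSymbol_one.tendsto_bilin hf hgh (tendsto_trunc f) (fun k => ?_)
      (fun n k => norm_trunc_le n f k) (fun n k => hlo hg hh n k) k
    exact (P.isSymbol_sym _).tendsto_bilin hg hh (tendsto_trunc g) (tendsto_trunc h)
      (fun n k => norm_trunc_le n g k) (fun n k => norm_trunc_le n h k) k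

end DyadicPartition

/-! ### The paracontrolled right-hand side is the renormalized nonlinearity -/

/-- The driving vector, at one time, whose components `Z`, `A'`, `B'`, `W` are `z`, `a`, `b`, `y`:
the other components are the renormalized products of these. -/
def driverOf (P : DyadicPartition) (c₁ c₂₁ c₂₂ : ℂ) (z a b y : PerDist) : Driver :=
  { Z := z
    ZZ := fnMul z z
    ZZb := tableZZb c₁ z
    IZZ := a
    IZZb := b
    W := y
    WoZ := P.reso y z
    WoB := P.reso y (bar z)
    IZZoZZb := P.reso a (tableZZb c₁ z)
    IZZobb := P.reso a (fnMul (bar z) (bar z)) - const (2 * c₂₁)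
    IZZboZZb := P.reso b (tableZZb c₁ z) - const c₂₂
    IZZbobb := P.reso b (fnMul (bar z) (bar z))
    WoZZb := P.reso y (tableZZb c₁ z) - (2 * c₂₂) • z
    Wobb := P.reso y (fnMul (bar z) (bar z)) - (2 * c₂₁) • bar z }

/-- The nonlinearity `ν(1 - |U|²)U + ν c U`. -/
def nonlin (ν c : ℂ) (U : C(T3, ℂ)) : C(T3, ℂ) := ν • (U - U * U * star U) + (ν * c) • U

lemma nonlin_apply (ν c : ℂ) (U : C(T3, ℂ)) (x : T3) :
    nonlin ν c U x = ν * (1 - (‖U x‖ : ℂ) ^ 2) * U x + ν * c * U x := by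
  have : (‖U x‖ : ℂ) ^ 2 = U x * star (U x) := by
    rw [← Complex.ofReal_pow, ← Complex.normSq_eq_norm_sq, ← Complex.mul_conj]; rfl
  rw [this]
  simp [nonlin]; ring

namespace DyadicPartition

variable {P : DyadicPartition} {f f' g h : PerDist}

lemma comm_eq_of_wiener_mid (hf : L2 f) (hg : Wiener g) (hh : L2 h) :
    P.comm f g h = P.reso (P.para f g) h - P.mul f (P.reso g h) :=
  comm_eq hf hg.l2 hh (hf.L2_absConv hg) (hg.L2_absConv hh)

/-- The expansion of `((-a f + f') ≺ g) ⊙ h` behind the remainders `R` of the equation. -/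
lemma reso_para_expand (hf : L2 f) (hf' : L2 f') (hg : Wiener g) (hh : L2 h) (a : ℂ) :
    P.reso (P.para (-(a • f) + f') g) h =
      (-a) • P.comm f g h + P.comm f' g h + P.mul (-(a • f) + f') (P.reso g h) := by
  have e : -(a • f) = (-a) • f := by simp
  have h1 := L2_para (P := P) hf hg.l2 (hf.L2_absConv hg)
  have h2 := L2_para (P := P) hf' hg.l2 (hf'.L2_absConv hg)
  have h3 := L2_reso (P := P) hg.l2 hh (hg.L2_absConv hh)
  rw [e, comm_eq_of_wiener_mid hf hg hh, comm_eq_of_wiener_mid hf' hg hh,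
    para_add_left (hf.smul _) hf' hg.l2, para_smul_left hf hg.l2,
    reso_add_left (h1.smul _) h2 hh, reso_smul_left h1 hh, mul_add_left (hf.smul _) hf' h3,
    mul_smul_left hf h3, smul_sub]
  abel

lemma mul_expand (hf : L2 f) (hf' : L2 f') (hg : L2 g) (a : ℂ) :
    P.mul (-(a • f) + f') g = (-a) • P.mul f g + P.mul f' g := by
  have e : -(a • f) = (-a) • f := by simp
  rw [e, mul_add_left (hf.smul _) hf' hg, mul_smul_left hf hg]

/-- The product `W² Z̄` of the paracontrolled calculus is the pointwise one. -/
lemma prodWWB_eq (W Z : C(T3, ℂ)) (hW : Wiener (ofFun W)) :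
    (2 : ℂ) • P.mul (ofFun W) (P.reso (ofFun W) (ofFun Z)) + P.comm (ofFun W) (ofFun Z) (ofFun W)
      + P.paras (P.para (ofFun W) (ofFun Z)) (ofFun W)
      + P.mul (ofFun W) (P.para (ofFun Z) (ofFun W)) = ofFun (W * (W * Z) : C(T3, ℂ)) := by
  have w := L2_ofFun W
  have z := L2_ofFun Z
  have wz := hW.L2_absConv z
  have zw := z.L2_absConv hW
  have p1 := L2_para (P := P) w z wz
  have p2 := L2_para (P := P) z w zw
  have r1 := L2_reso (P := P) w z wz
  have e : P.para (ofFun W) (ofFun Z) + P.reso (ofFun W) (ofFun Z) + P.para (ofFun Z) (ofFun W) =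
    ofFun (W * Z : C(T3, ℂ)) := mul_ofFun W Z
  rw [← mul_ofFun, ← e, mul_add_right w (p1.add r1) p2, mul_add_right w p1 r1,
    comm_eq w z w wz zw, reso_comm z w, mul_comm_of_L2 (P := P) w p1, paras]
  conv_rhs => rw [mul]
  module

/-- The product `W W̄ Z` of the paracontrolled calculus is the pointwise one. -/
lemma prodWWbZ_eq (W Z : C(T3, ℂ)) (hW : Wiener (ofFun W)) :
    P.mul (bar (ofFun W)) (P.reso (ofFun W) (ofFun Z))
      + P.mul (ofFun W) (P.reso (bar (ofFun W)) (ofFun Z))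
      + P.comm (bar (ofFun W)) (ofFun Z) (ofFun W)
      + P.paras (P.para (bar (ofFun W)) (ofFun Z)) (ofFun W)
      + P.mul (ofFun W) (P.para (ofFun Z) (bar (ofFun W))) =
      ofFun (W * (star W * Z) : C(T3, ℂ)) := by
  have w := L2_ofFun W
  have wb := w.bar
  have z := L2_ofFun Z
  have wz := hW.bar.L2_absConv z
  have zw := z.L2_absConv hW
  have p1 := L2_para (P := P) wb z wz
  have p2 := L2_para (P := P) z wb (z.L2_absConv hW.bar)
  have r1 := L2_reso (P := P) wb z wz
  have e : P.para (bar (ofFun W)) (ofFun Z) + P.reso (bar (ofFun W)) (ofFun Z)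
      + P.para (ofFun Z) (bar (ofFun W)) = ofFun (star W * Z : C(T3, ℂ)) := by
    rw [← mul_ofFun (P := P), ofFun_star, mul]
  rw [← mul_ofFun, ← e, mul_add_right w (p1.add r1) p2, mul_add_right w p1 r1,
    comm_eq wb z w wz zw, reso_comm z w, mul_comm_of_L2 (P := P) w p1, paras]
  conv_rhs => rw [mul]
  module

lemma mul_lincomb (Q : C(T3, ℂ)) (hg : L2 g) (hh : L2 h) (a b : ℂ) (q : PerDist)
    (U : C(T3, ℂ)) (hq : q = ofFun Q - a • g - b • h) :
    P.mul (ofFun U) q = ofFun (U * Q : C(T3, ℂ)) - a • P.mul (ofFun U) g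
      - b • P.mul (ofFun U) h := by
  have u := L2_ofFun U
  have e : q = ofFun Q + (-a) • g + (-b) • h := by rw [hq]; module
  rw [e, mul_add_right u ((L2_ofFun Q).add (hg.smul _)) (hh.smul _),
    mul_add_right u (L2_ofFun Q) (hg.smul _), mul_smul_right u hg, mul_smul_right u hh, mul_ofFun]
  module

set_option maxHeartbeats 1000000 in
/-- The right-hand sides of the equations of `v`, `w` and `-νW` add up to the renormalized
nonlinearity. The additional `Z - νW + V + Y` compensates the damping `-1` of the linear part: it
is the `1` in the factor `ν + 1` of `G₃` and `G₄`. In the map `G`, the value of `I(v₀, F(v, w))` is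
that of the solution `v` itself. -/
lemma mapF_add_mapG (P : DyadicPartition) (ν c₁ c₂₁ c₂₂ : ℂ) (Z W V Y : C(T3, ℂ)) (a b : PerDist)
    (hW : Wiener (ofFun W)) (ha : Wiener a) (hb : Wiener b) :
    (-ν) • tableZZZb c₁ (ofFun Z)
      + P.mapF ν (driverOf P c₁ c₂₁ c₂₂ (ofFun Z) a b (ofFun W)) (ofFun V) (ofFun Y)
      + P.mapG ν (driverOf P c₁ c₂₁ c₂₂ (ofFun Z) a b (ofFun W)) (ofFun V) (ofFun V) (ofFun Y)
      = ofFun (nonlin ν (2 * (c₁ - star ν * star c₂₁ - 2 * ν * c₂₂)) (Z - ν • W + V + Y))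
        + ofFun (Z - ν • W + V + Y : C(T3, ℂ)) := by
  obtain ⟨X, hX⟩ : ∃ X, X = driverOf P c₁ c₂₁ c₂₂ (ofFun Z) a b (ofFun W) := ⟨_, rfl⟩
  rw [← hX]
  -- the continuous functions at hand
  obtain ⟨U, hU⟩ : ∃ U : C(T3, ℂ), U = V + Y := ⟨_, rfl⟩
  obtain ⟨p, hp⟩ : ∃ p : C(T3, ℂ), p = -(ν • W) + U := ⟨_, rfl⟩
  obtain ⟨A, hA⟩ : ∃ A : C(T3, ℂ), A = Z * Z := ⟨_, rfl⟩
  obtain ⟨B, hB⟩ : ∃ B : C(T3, ℂ), B = Z * star Z - ContinuousMap.const T3 c₁ := ⟨_, rfl⟩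
  have w1 : X.W = ofFun W := by rw [hX]; rfl
  have w2 : X.Z = ofFun Z := by rw [hX]; rfl
  have w3 : X.IZZ = a := by rw [hX]; rfl
  have w4 : X.IZZb = b := by rw [hX]; rfl
  have w5 : X.WoZ = P.reso (ofFun W) (ofFun Z) := by rw [hX]; rfl
  have eZZ : X.ZZ = ofFun A := by rw [hA, ← fnMul_ofFun, hX]; rfl
  have ebb : fnMul (bar (ofFun Z)) (bar (ofFun Z)) = ofFun (star A : C(T3, ℂ)) := by
    rw [← ofFun_star, fnMul_ofFun, hA, star_mul]
  have eZZb : tableZZb c₁ (ofFun Z) = ofFun B := by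
    rw [tableZZb, ← ofFun_star, fnMul_ofFun, const_eq_ofFun, hB, ofFun_sub]
  have eXB : X.ZZb = ofFun B := by rw [← eZZb, hX]; rfl
  have eU : ofFun V + ofFun Y = ofFun U := by rw [hU, ofFun_add]
  have ep : -(ν • ofFun W) + ofFun V + ofFun Y = ofFun p := by
    rw [hp, ofFun_add, ofFun_neg, ofFun_smul, add_assoc, eU]
  have ep' : -(ν • ofFun W) + ofFun U = ofFun p := by rw [← eU, ← ep, add_assoc]
  have epb : -(star ν • bar (ofFun W)) + bar (ofFun V) + bar (ofFun Y) = bar (ofFun p) := by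
    rw [← ep, bar_add, bar_add, bar_neg, bar_smul]
  have epb' : -(star ν • bar (ofFun W)) + bar (ofFun U) = bar (ofFun p) := by
    rw [← ep', bar_add, bar_neg, bar_smul]
  have lW := L2_ofFun W
  have lV := L2_ofFun V
  have lY := L2_ofFun Y
  have lU := L2_ofFun U
  have lp := L2_ofFun p
  have lA := L2_ofFun A
  have lB := L2_ofFun B
  have lAb : L2 (ofFun (star A : C(T3, ℂ))) := L2_ofFun _
  have hla := ha.l2
  have hlb := hb.l2
  have eAb : bar (ofFun (star A : C(T3, ℂ))) = ofFun A := by rw [← ofFun_star, star_star]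
  have eZb : bar (ofFun (star Z : C(T3, ℂ))) = ofFun Z := by rw [← ofFun_star, star_star]
  have e21 : star (2 * c₂₁) = 2 * star c₂₁ := by simp
  -- the resonant products with `A'` and `B'`
  have r3 : P.reso a (ofFun B) = X.IZZoZZb := by rw [hX, driverOf, eZZb]
  have r5 : P.reso b (ofFun B) = X.IZZboZZb + const c₂₂ := by
    rw [hX, driverOf, eZZb, sub_add_cancel]
  have r6 : P.reso (bar b) (ofFun A) = bar X.IZZbobb := by
    rw [hX, driverOf, ebb, bar_reso hlb lAb, eAb]
  have r4 : P.reso (bar a) (ofFun A) = bar X.IZZobb + const (2 * star c₂₁) := by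
    rw [hX, driverOf, ebb, bar_sub, bar_reso hla lAb, eAb, bar_const, e21,
      sub_add_cancel]
  have r7 : P.reso (ofFun W) (ofFun B) = X.WoZZb + (2 * c₂₂) • ofFun Z := by
    rw [hX, driverOf, eZZb, sub_add_cancel]
  have r8 : P.reso (bar (ofFun W)) (ofFun A) = bar X.Wobb + (2 * star c₂₁) • ofFun Z := by
    rw [hX, driverOf, ebb, bar_sub, bar_reso lW lAb, eAb, bar_smul, bar_bar, e21,
      sub_add_cancel]
  have l3 : L2 X.IZZoZZb := r3 ▸ L2_reso hla lB (ha.L2_absConv lB)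
  have l5 : L2 X.IZZboZZb := by
    have := (L2_reso (P := P) hlb lB (hb.L2_absConv lB)).sub (L2_const c₂₂)
    rwa [r5, add_sub_cancel_right] at this
  have l6 : L2 (bar X.IZZbobb) := r6 ▸ L2_reso hlb.bar lA (hb.bar.L2_absConv lA)
  have l4 : L2 (bar X.IZZobb) := by
    have := (L2_reso (P := P) hla.bar lA (ha.bar.L2_absConv lA)).sub (L2_const (2 * star c₂₁))
    rwa [r4, add_sub_cancel_right] at this
  -- the resonant products of `v`
  obtain ⟨cm, hcm⟩ : ∃ cm, cm = P.com ν X (ofFun V) (ofFun V) (ofFun Y) := ⟨_, rfl⟩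
  have ecm : cm = ofFun V + ν • ((2 : ℂ) • P.para (ofFun p) b + P.para (bar (ofFun p)) a) := by
    rw [hcm, com, w1, w3, w4, ep, epb]
  have l1 := L2_para (P := P) lp hlb (lp.L2_absConv hb)
  have l2 := L2_para (P := P) lp.bar hla (lp.bar.L2_absConv ha)
  have l1b := L2_para (P := P) lp.bar hlb.bar (lp.bar.L2_absConv hb.bar)
  have l2b := L2_para (P := P) lp hla.bar (lp.L2_absConv ha.bar)
  have ev : P.reso cm (ofFun B) = P.reso (ofFun V) (ofFun B)
      + ν • ((2 : ℂ) • P.reso (P.para (ofFun p) b) (ofFun B)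
        + P.reso (P.para (bar (ofFun p)) a) (ofFun B)) := by
    rw [ecm, reso_add_left lV (((l1.smul _).add l2).smul _) lB,
      reso_smul_left ((l1.smul _).add l2) lB, reso_add_left (l1.smul _) l2 lB,
      reso_smul_left l1 lB]
  have evb : P.reso (bar cm) (ofFun A) = P.reso (bar (ofFun V)) (ofFun A)
      + star ν • ((2 : ℂ) • P.reso (P.para (bar (ofFun p)) (bar b)) (ofFun A)
        + P.reso (P.para (ofFun p) (bar a)) (ofFun A)) := by
    have e2 : star (2 : ℂ) = 2 := by simp
    rw [ecm, bar_add, bar_smul, bar_add, bar_smul, bar_para lp hlb, bar_para lp.bar hla, bar_bar,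
      e2, reso_add_left lV.bar (((l1b.smul _).add l2b).smul _) lA,
      reso_smul_left ((l1b.smul _).add l2b) lA, reso_add_left (l1b.smul _) l2b lA,
      reso_smul_left l1b lA]
  -- the constants removed from `X⁴` and `X⁵` come back as multiples of `p`
  have x1 := reso_para_expand (P := P) lW lU hb lB ν
  rw [ep', r5, mul_add_right lp l5 (L2_const _), mul_const lp, ← ep', mul_expand lW lU l5,
    ep'] at x1
  have x2 := reso_para_expand (P := P) lW.bar lU.bar ha lB (star ν)
  rw [r3, mul_expand lW.bar lU.bar l3, epb'] at x2
  have x3 := reso_para_expand (P := P) lW.bar lU.bar hb.bar lA (star ν)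
  rw [r6, mul_expand lW.bar lU.bar l6, epb'] at x3
  have x4 := reso_para_expand (P := P) lW lU ha.bar lA ν
  rw [ep', r4, mul_add_right lp l4 (L2_const _), mul_const lp, ← ep', mul_expand lW lU l4,
    ep'] at x4
  -- the products with `A` and `B`
  have sB : P.para (ofFun p) (ofFun B) + P.reso (ofFun p) (ofFun B) + P.para (ofFun B) (ofFun p)
      = ofFun (p * B : C(T3, ℂ)) := mul_ofFun p B
  have sA : P.para (bar (ofFun p)) (ofFun A) + P.reso (bar (ofFun p)) (ofFun A)
      + P.para (ofFun A) (bar (ofFun p)) = ofFun (star p * A : C(T3, ℂ)) := by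
    rw [← mul_ofFun (P := P), ofFun_star, mul]
  have sB1 : P.reso (ofFun p) (ofFun B) = (-ν) • P.reso (ofFun W) (ofFun B)
      + (P.reso (ofFun V) (ofFun B) + P.reso (ofFun Y) (ofFun B)) := by
    rw [← ep, ← neg_smul, add_assoc, reso_add_left (lW.smul _) (lV.add lY) lB,
      reso_add_left lV lY lB, reso_smul_left lW lB]
  have sA1 : P.reso (bar (ofFun p)) (ofFun A) = (-star ν) • P.reso (bar (ofFun W)) (ofFun A)
      + (P.reso (bar (ofFun V)) (ofFun A) + P.reso (bar (ofFun Y)) (ofFun A)) := by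
    rw [← epb, ← neg_smul, add_assoc, reso_add_left (lW.bar.smul _) (lV.bar.add lY.bar) lA,
      reso_add_left lV.bar lY.bar lA, reso_smul_left lW.bar lA]
  have sB2 : P.para (ofFun B) (ofFun p) =
      (-ν) • P.para (ofFun B) (ofFun W) + P.para (ofFun B) (ofFun U) := by
    rw [← ep', ← neg_smul, para_add_right lB (lW.smul _) lU, para_smul_right lB lW]
  have sA2 : P.para (ofFun A) (bar (ofFun p)) =
      (-star ν) • P.para (ofFun A) (bar (ofFun W)) + P.para (ofFun A) (bar (ofFun U)) := by
    rw [← epb', ← neg_smul, para_add_right lA (lW.bar.smul _) lU.bar, para_smul_right lA lW.bar]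
  -- the products of the driving vector are the pointwise ones
  have eWoB : X.WoB = P.reso (ofFun W) (ofFun (star Z : C(T3, ℂ))) := by
    rw [ofFun_star, hX]; rfl
  have eWB : P.prodWB X = ofFun (W * star Z : C(T3, ℂ)) := by
    rw [← mul_ofFun (P := P), prodWB, eWoB, paras, mul, ofFun_star, w1, w2]
    abel
  have eWZ : P.prodWZ X = ofFun (W * Z : C(T3, ℂ)) := by
    rw [← mul_ofFun (P := P), prodWZ, paras, mul, w1, w2, w5]
    abel
  have eWWB : P.prodWWB X = ofFun (W * (W * star Z) : C(T3, ℂ)) := by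
    rw [← prodWWB_eq (P := P) W (star Z) hW, prodWWB, eWoB, w1, w2, ofFun_star]
  have eWWbZ : P.prodWWbZ X = ofFun (W * (star W * Z) : C(T3, ℂ)) := by
    rw [← prodWWbZ_eq (P := P) W Z hW, prodWWbZ, eWoB, bar_reso lW (L2_ofFun _), eZb,
      w1, w2, w5]
  -- the products in `G₁`, `G₂`, `G₃`
  have g1 : P.mapG₁ ν (ofFun U) = (-ν) • ofFun (U * U * star U : C(T3, ℂ)) := by
    rw [mapG₁, mul_ofFun, ← ofFun_star, mul_ofFun]
  have g2 : P.mapG₂ ν X (ofFun U) = (-ν) • (ofFun (U * U * (star Z - star ν • star W) : C(T3, ℂ))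
      + (2 : ℂ) • ofFun (U * star U * (Z - ν • W) : C(T3, ℂ))) := by
    have e1 : bar X.Z - star ν • bar X.W = ofFun (star Z - star ν • star W : C(T3, ℂ)) := by
      rw [ofFun_sub, ofFun_smul, ofFun_star, ofFun_star, w1, w2]
    have e2 : X.Z - ν • X.W = ofFun (Z - ν • W : C(T3, ℂ)) := by
      rw [ofFun_sub, ofFun_smul, w1, w2]
    rw [mapG₂, e1, e2, mul_ofFun, mul_ofFun, ← ofFun_star, mul_ofFun, mul_ofFun]
  have g3 := mul_lincomb (P := P) ((2 * ν * star ν) • (W * star W) - (2 * ν) • (W * star Z)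
    - (2 * star ν) • star (W * star Z)) l5 l4 (4 * ν) (star ν)
    ((2 * ν * star ν) • P.mul X.W (bar X.W) - (2 * ν) • P.prodWB X
        - (2 * star ν) • bar (P.prodWB X) - (4 * ν) • X.IZZboZZb - star ν • bar X.IZZobb) U
    (by
      rw [ofFun_sub, ofFun_sub, ofFun_smul, ofFun_smul, ofFun_smul, eWB, ← ofFun_star,
        ← mul_ofFun (P := P) W (star W), ofFun_star W, w1])
  have g3' := mul_lincomb (P := P) (ν ^ 2 • (W * W) - (2 * ν) • (W * Z)) l6 l3 (2 * star ν) (2 * ν)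
    (ν ^ 2 • P.mul X.W X.W - (2 * ν) • P.prodWZ X
        - (2 * star ν) • bar X.IZZbobb - (2 * ν) • X.IZZoZZb) (star U)
    (by
      rw [ofFun_sub, ofFun_smul, ofFun_smul, eWZ, ← mul_ofFun (P := P) W W, w1])
  rw [ofFun_star U] at g3'
  have g4 : P.mul (P.mul X.W X.W) (bar X.W) = ofFun (W * W * star W : C(T3, ℂ)) := by
    rw [← mul_ofFun (P := P), ← mul_ofFun (P := P), ofFun_star, w1]
  have eZZZb : tableZZZb c₁ (ofFun Z) = ofFun (Z * Z * star Z : C(T3, ℂ)) - (2 * c₁) • ofFun Z := by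
    rw [tableZZZb, ← ofFun_star, fnMul_ofFun, fnMul_ofFun]
  -- the identity between continuous functions
  have key : (-ν) • (ofFun (Z * Z * star Z : C(T3, ℂ)) - (2 * c₁) • ofFun Z)
      + (-ν) • ((2 : ℂ) • ofFun (p * B : C(T3, ℂ)) + ofFun (star p * A : C(T3, ℂ))
        + (4 * ν * c₂₂ + 2 * star ν * star c₂₁) • ofFun Z
        + (4 * ν * c₂₂ + 2 * star ν * star c₂₁) • ofFun p
        + ofFun (U * U * star U : C(T3, ℂ))
        + ofFun (U * U * (star Z - star ν • star W) : C(T3, ℂ))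
        + (2 : ℂ) • ofFun (U * star U * (Z - ν • W) : C(T3, ℂ))
        + ofFun (U * ((2 * ν * star ν) • (W * star W) - (2 * ν) • (W * star Z)
            - (2 * star ν) • star (W * star Z)) : C(T3, ℂ))
        + ofFun (star U * (ν ^ 2 • (W * W) - (2 * ν) • (W * Z)) : C(T3, ℂ))
        - (ν ^ 2 * star ν) • ofFun (W * W * star W : C(T3, ℂ))
        + ν ^ 2 • ofFun (W * (W * star Z) : C(T3, ℂ))
        + (2 * ν * star ν) • ofFun (W * (star W * Z) : C(T3, ℂ)))
      + (ν + 1) • ofFun U + (ν + 1) • (ofFun Z - ν • ofFun W)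
      = ofFun (nonlin ν (2 * (c₁ - star ν * star c₂₁ - 2 * ν * c₂₂)) (Z - ν • W + V + Y))
        + ofFun (Z - ν • W + V + Y : C(T3, ℂ)) := by
    simp only [← ofFun_smul, ← ofFun_sub, ← ofFun_add]
    congr 2
    ext x
    simp only [nonlin, hp, hA, hB, hU, ContinuousMap.add_apply, ContinuousMap.sub_apply,
      ContinuousMap.smul_apply, ContinuousMap.mul_apply, ContinuousMap.neg_apply,
      ContinuousMap.star_apply, ContinuousMap.const_apply, smul_eq_mul, star_add, star_sub,
      star_neg, star_smul, star_mul', star_star]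
    ring
  rw [← key, mapG, eU, g1, g2, mapG₃, mapG₄, mapG₅, mapG₆, mapG₇, mapG₈, g3, g3', g4, eWWB, eWWbZ,
    mapF, eZZ, eXB, eZZZb, ← hcm, w1, w2, w3, w4, ep, epb]
  have tB : ∀ k, (P.para (ofFun p) (ofFun B)) k = (ofFun (p * B : C(T3, ℂ)) k
      - P.reso (ofFun p) (ofFun B) k - P.para (ofFun B) (ofFun p) k) := fun k => by
    rw [← sB]; simp only [Pi.add_apply]; ring
  have tA : ∀ k, (P.para (bar (ofFun p)) (ofFun A)) k = (ofFun (star p * A : C(T3, ℂ)) k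
      - P.reso (bar (ofFun p)) (ofFun A) k - P.para (ofFun A) (bar (ofFun p)) k) := fun k => by
    rw [← sA]; simp only [Pi.add_apply]; ring
  rw [ev, evb, x1, x2, x3, x4]
  funext k
  simp only [Pi.add_apply, Pi.sub_apply, Pi.smul_apply, Pi.neg_apply, smul_eq_mul, tA, tB]
  rw [sB1, sA1, sB2, sA2, r7, r8]
  simp only [Pi.add_apply, Pi.smul_apply, smul_eq_mul]
  ring

end DyadicPartition

/-! ### Besov norms -/

/-- The `k`-th Fourier coefficient as a continuous functional on the continuous functions. -/
def coeffL (k : Fin 3 → ℤ) : C(T3, ℂ) →L[ℂ] ℂ :=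
  LinearMap.mkContinuous
    { toFun := fun F => ofFun F k
      map_add' := fun F G => by rw [ofFun_add]; rfl
      map_smul' := fun c F => by rw [ofFun_smul]; rfl } 1
    fun F => by simpa using norm_ofFun_le F k

lemma coeffL_apply (k : Fin 3 → ℤ) (F : C(T3, ℂ)) : coeffL k F = ofFun F k := rfl

lemma toFun_sub {f g : PerDist} (hf : IsCont f) (hg : IsCont g) :
    toFun (f - g) = toFun f - toFun g := by
  obtain ⟨F, rfl⟩ := hf
  obtain ⟨G, rfl⟩ := hg
  rw [← ofFun_sub, toFun_ofFun, toFun_ofFun, toFun_ofFun]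

/-- `∑_{m ≥ -1} 2^{-mα}`. -/
def geomConst (α : ℝ) : ℝ := ∑' i : ℕ, (2 : ℝ) ^ (-((i : ℝ) - 1) * α)

lemma summable_geom {α : ℝ} (hα : 0 < α) :
    Summable fun i : ℕ => (2 : ℝ) ^ (-((i : ℝ) - 1) * α) := by
  have h : ∀ i : ℕ, (2 : ℝ) ^ (-((i : ℝ) - 1) * α) = 2 ^ α * ((2 : ℝ) ^ (-α)) ^ i := fun i => by
    rw [← Real.rpow_natCast, ← Real.rpow_mul (by norm_num), ← Real.rpow_add (by norm_num)]
    congr 1; ring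
  simp only [h]
  refine (summable_geometric_of_lt_one (by positivity) ?_).mul_left _
  exact Real.rpow_lt_one_of_one_lt_of_neg (by norm_num) (by linarith)

lemma geomConst_nonneg (α : ℝ) : 0 ≤ geomConst α := tsum_nonneg fun _ => by positivity

namespace DyadicPartition

variable {P : DyadicPartition} {f g : PerDist} {α : ℝ}

lemma blockC_add (i : ℕ) (f g : PerDist) : P.blockC i (f + g) = P.blockC i f + P.blockC i g := by
  simp only [blockC, ← Finset.sum_add_distrib, Pi.add_apply, mul_add]
  exact Finset.sum_congr rfl fun k _ => by ext x; simp [add_mul]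

lemma blockC_neg (i : ℕ) (f : PerDist) : P.blockC i (-f) = -P.blockC i f := by
  simp only [blockC, ← Finset.sum_neg_distrib, Pi.neg_apply, mul_neg]
  exact Finset.sum_congr rfl fun k _ => by ext x; simp

lemma iSup_enorm_block (i : ℕ) (f : PerDist) : ⨆ x, ‖P.block i f x‖ₑ = ‖P.blockC i f‖ₑ := by
  rw [← coe_blockC]
  refine le_antisymm (iSup_le fun x => ?_) ?_
  · exact enorm_le_iff_norm_le.mpr ((P.blockC i f).norm_coe_le_norm x)
  · obtain ⟨x, -, hx⟩ := isCompact_univ.exists_isMaxOn ⟨(0 : T3), mem_univ _⟩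
      (P.blockC i f).continuous.norm.continuousOn
    refine le_iSup_of_le x (enorm_le_iff_norm_le.mpr ?_)
    exact (ContinuousMap.norm_le _ (norm_nonneg _)).mpr fun y => hx (mem_univ y)

lemma besovNorm_eq (α : ℝ) (f : PerDist) :
    P.besovNorm α f = ⨆ i : ℕ, (2 : ℝ≥0∞) ^ (((i : ℝ) - 1) * α) * ‖P.blockC i f‖ₑ := by
  simp only [besovNorm, iSup_enorm_block]

lemma two_rpow_eq (x : ℝ) : (2 : ℝ≥0∞) ^ x = ENNReal.ofReal ((2 : ℝ) ^ x) := by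
  rw [← ENNReal.ofReal_rpow_of_pos (by norm_num)]; simp

lemma besovNorm_le_ofReal_iff {A : ℝ} (hA : 0 ≤ A) :
    P.besovNorm α f ≤ ENNReal.ofReal A ↔
      ∀ i : ℕ, ‖P.blockC i f‖ ≤ A * (2 : ℝ) ^ (-((i : ℝ) - 1) * α) := by
  rw [besovNorm_eq, iSup_le_iff]
  refine forall_congr' fun i => ?_
  rw [two_rpow_eq, ← ofReal_norm, ← ENNReal.ofReal_mul (by positivity),
    ENNReal.ofReal_le_ofReal_iff hA, neg_mul, Real.rpow_neg (by norm_num), ← div_eq_mul_inv,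
    le_div_iff₀ (by positivity), mul_comm]

lemma besovNorm_add_le (α : ℝ) (f g : PerDist) :
    P.besovNorm α (f + g) ≤ P.besovNorm α f + P.besovNorm α g := by
  simp only [besovNorm_eq]
  refine iSup_le fun i => ?_
  rw [blockC_add]
  refine (mul_le_mul_right (enorm_add_le (P.blockC i f) (P.blockC i g)) _).trans ?_
  rw [mul_add]
  exact add_le_add
    (le_iSup (fun i : ℕ => (2 : ℝ≥0∞) ^ (((i : ℝ) - 1) * α) * ‖P.blockC i f‖ₑ) i)
    (le_iSup (fun i : ℕ => (2 : ℝ≥0∞) ^ (((i : ℝ) - 1) * α) * ‖P.blockC i g‖ₑ) i)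

lemma besovNorm_neg (α : ℝ) (f : PerDist) : P.besovNorm α (-f) = P.besovNorm α f := by
  simp only [besovNorm_eq, blockC_neg, enorm_neg]

lemma besovNorm_sub_le (α : ℝ) (f g : PerDist) :
    P.besovNorm α (f - g) ≤ P.besovNorm α f + P.besovNorm α g := by
  rw [sub_eq_add_neg, ← besovNorm_neg α g]
  exact besovNorm_add_le α f (-g)

/-- A family with absolutely summable Littlewood-Paley blocks is a continuous function. -/
lemma isCont_of_summable {a : ℕ → ℝ} (ha : Summable a) (h : ∀ i, ‖P.blockC i f‖ ≤ a i) :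
    IsCont f ∧ ‖toFun f‖ ≤ ∑' i, a i := by
  have hs : Summable (fun i => P.blockC i f) := Summable.of_norm_bounded ha h
  have e : ofFun (∑' i, P.blockC i f : C(T3, ℂ)) = f := by
    funext k
    rw [← coeffL_apply, (coeffL k).map_tsum hs]
    simp only [coeffL_apply, ofFun_blockC]
    rw [tsum_mul_right, ← Complex.ofReal_tsum, (P.hasSum_weight k).tsum_eq]
    simp
  refine ⟨⟨_, e⟩, ?_⟩
  rw [← e, toFun_ofFun]
  exact tsum_of_norm_bounded ha.hasSum h

lemma isCont_of_besovNorm_le (hα : 0 < α) {A : ℝ} (hA : 0 ≤ A)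
    (h : P.besovNorm α f ≤ ENNReal.ofReal A) : IsCont f ∧ ‖toFun f‖ ≤ A * geomConst α := by
  rw [geomConst, ← tsum_mul_left]
  exact isCont_of_summable ((summable_geom hα).mul_left A) ((besovNorm_le_ofReal_iff hA).mp h)

/-- Interpolation of Besov norms. -/
lemma besovNorm_interpolate {a b A B θ : ℝ} (hA : 0 ≤ A) (hB : 0 ≤ B) (h0 : 0 ≤ θ) (h1 : θ ≤ 1)
    (ha : P.besovNorm a f ≤ ENNReal.ofReal A) (hb : P.besovNorm b f ≤ ENNReal.ofReal B) :
    P.besovNorm ((1 - θ) * a + θ * b) f ≤ ENNReal.ofReal (A ^ (1 - θ) * B ^ θ) := by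
  rw [besovNorm_le_ofReal_iff (by positivity)]
  intro i
  have h2 := (besovNorm_le_ofReal_iff hA).mp ha i
  have h3 := (besovNorm_le_ofReal_iff hB).mp hb i
  have hn := norm_nonneg (P.blockC i f)
  calc ‖P.blockC i f‖ = ‖P.blockC i f‖ ^ (1 - θ) * ‖P.blockC i f‖ ^ θ := by
        rw [← Real.rpow_add_of_nonneg hn (by linarith) h0]; simp
    _ ≤ (A * (2 : ℝ) ^ (-((i : ℝ) - 1) * a)) ^ (1 - θ) *
        (B * (2 : ℝ) ^ (-((i : ℝ) - 1) * b)) ^ θ := by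
        gcongr
    _ = _ := by
        rw [Real.mul_rpow hA (by positivity), Real.mul_rpow hB (by positivity),
          ← Real.rpow_mul (by norm_num), ← Real.rpow_mul (by norm_num), mul_mul_mul_comm,
          ← Real.rpow_add (by norm_num)]
        congr 2; ring

/-- Fourier coefficients are controlled by Besov norms. -/
lemma exists_norm_coeff_le (P : DyadicPartition) (α : ℝ) (k : Fin 3 → ℤ) :
    ∃ C : ℝ, 0 ≤ C ∧ ∀ (f : PerDist) (A : ℝ), 0 ≤ A → P.besovNorm α f ≤ ENNReal.ofReal A →
      ‖f k‖ ≤ C * A := by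
  obtain ⟨i, hi⟩ : ∃ i, P.weight i k ≠ 0 := by
    by_contra h
    push Not at h
    have := P.hasSum_weight k
    simp only [h] at this
    exact zero_ne_one (hasSum_zero.unique this)
  have hw : 0 < P.weight i k := lt_of_le_of_ne (P.weight_nonneg i k) hi.symm
  refine ⟨(2 : ℝ) ^ (-((i : ℝ) - 1) * α) / P.weight i k, by positivity, fun f A hA h => ?_⟩
  have h1 := (norm_ofFun_le (P.blockC i f) k).trans ((besovNorm_le_ofReal_iff hA).mp h i)
  rw [ofFun_blockC, norm_mul, Complex.norm_real, Real.norm_of_nonneg hw.le] at h1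
  rw [div_mul_eq_mul_div, le_div_iff₀ hw]
  linarith

end DyadicPartition

/-! ### Finiteness of the norms -/

lemma summable_one_add_norm_latticePoint {r : ℝ} (hr : 3 < r) :
    Summable fun k : Fin 3 → ℤ => (1 + ‖latticePoint k‖) ^ (-r) := by
  set b := (EuclideanSpace.basisFun (Fin 3) ℝ).toBasis
  set L := Submodule.span ℤ (Set.range b)
  have hrank : Module.finrank ℤ L = 3 := by
    rw [ZLattice.rank ℝ L]; simp
  have hmem : ∀ k, latticePoint k ∈ L := fun k => by
    have : latticePoint k = ∑ i, k i • b i := by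
      ext j
      simp [latticePoint, b, Finset.sum_apply, Pi.single_apply]
    rw [this]
    exact Submodule.sum_mem _ fun i _ =>
      Submodule.smul_mem _ _ (Submodule.subset_span (mem_range_self i))
  have hinj : Function.Injective fun k => (⟨latticePoint k, hmem k⟩ : L) := fun k l h => by
    have h' : latticePoint k = latticePoint l := congrArg Subtype.val h
    funext i
    have := congrArg (fun v : E3 => v i) h'
    simpa [latticePoint] using this
  have hs := (ZLattice.summable_norm_rpow L (-r) (by
    rw [hrank]; push_cast; linarith)).comp_injective hinj
  refine Summable.of_norm_bounded_eventually hs ?_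
  refine (Set.finite_singleton (0 : Fin 3 → ℤ)).subset fun k hk => ?_
  by_contra hk0
  refine hk ?_
  have hpos : 0 < ‖latticePoint k‖ := by
    rw [norm_pos_iff]
    intro h
    refine hk0 (hinj ?_)
    ext1
    change latticePoint k = latticePoint 0
    rw [h]; ext i; simp [latticePoint]
  change ‖_‖ ≤ ‖latticePoint k‖ ^ (-r)
  rw [Real.norm_of_nonneg (by positivity)]
  exact Real.rpow_le_rpow_of_nonpos hpos (by linarith) (by linarith)

namespace DyadicPartition

variable {P : DyadicPartition} {f g : PerDist} {α : ℝ}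

lemma norm_blockC_le_sum (i : ℕ) (f : PerDist) :
    ‖P.blockC i f‖ ≤ ∑ k ∈ P.freq i, ‖f k‖ := by
  refine (norm_sum_le _ _).trans (Finset.sum_le_sum fun k _ => ?_)
  rw [norm_smul, norm_mul, Complex.norm_real, Real.norm_of_nonneg (P.weight_nonneg i k),
    mFourier_norm, mul_one]
  exact mul_le_of_le_one_left (norm_nonneg _) (P.weight_le_one i k)

lemma two_rpow_le_of_mem_freq {i : ℕ} {k : Fin 3 → ℤ} (hk : k ∈ P.freq i) {N : ℕ}
    (hN : |α| ≤ N) : (2 : ℝ) ^ (((i : ℝ) - 1) * α) ≤ 2 ^ N * (1 + ‖latticePoint k‖) ^ N := by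
  have hk' : P.weight i k ≠ 0 := by simpa [freq] using hk
  have h1 : (2 : ℝ) ^ |(i : ℝ) - 1| ≤ 2 * (1 + ‖latticePoint k‖) := by
    cases i with
    | zero =>
      have := norm_nonneg (latticePoint k)
      simp
    | succ j =>
      have : ¬ ‖latticePoint k‖ < 3 / 4 * 2 ^ j := fun h => hk' (P.weight_eq_zero_of_lt h)
      push_cast
      rw [add_sub_cancel_right, abs_of_nonneg (Nat.cast_nonneg j), Real.rpow_natCast]
      have := norm_nonneg (latticePoint k)
      linarith
  calc (2 : ℝ) ^ (((i : ℝ) - 1) * α) ≤ 2 ^ (|(i : ℝ) - 1| * N) := by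
        refine Real.rpow_le_rpow_of_exponent_le (by norm_num) ((le_abs_self _).trans ?_)
        rw [abs_mul]
        exact mul_le_mul_of_nonneg_left hN (abs_nonneg _)
    _ = ((2 : ℝ) ^ |(i : ℝ) - 1|) ^ N := by rw [Real.rpow_mul (by norm_num), Real.rpow_natCast]
    _ ≤ (2 * (1 + ‖latticePoint k‖)) ^ N := by gcongr
    _ = _ := mul_pow _ _ _

lemma besovNorm_lt_top_of_isSmooth (hg : IsSmooth g) : P.besovNorm α g < ⊤ := by
  obtain ⟨N, hN⟩ := exists_nat_ge |α|
  obtain ⟨C, hC⟩ := hg (N + 4)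
  have hC0 : 0 ≤ C := le_trans (by positivity) (hC 0)
  have hs := (summable_one_add_norm_latticePoint (r := 4) (by norm_num)).mul_left (2 ^ N * C)
  set S := ∑' k : Fin 3 → ℤ, 2 ^ N * C * (1 + ‖latticePoint k‖) ^ (-4 : ℝ)
  have hS : 0 ≤ S := tsum_nonneg fun k => by positivity
  refine lt_of_le_of_lt ?_ (ENNReal.ofReal_lt_top (r := S))
  rw [besovNorm_le_ofReal_iff hS]
  intro i
  rw [neg_mul, Real.rpow_neg (by norm_num), ← div_eq_mul_inv, le_div_iff₀ (by positivity)]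
  refine (mul_le_mul_of_nonneg_right (norm_blockC_le_sum i g) (by positivity)).trans ?_
  rw [Finset.sum_mul]
  refine le_trans (Finset.sum_le_sum fun k hk => ?_) (hs.sum_le_tsum (P.freq i)
    (fun k _ => by positivity))
  have hp : 0 < 1 + ‖latticePoint k‖ := by positivity
  have h4 : (1 + ‖latticePoint k‖) ^ (-4 : ℝ) = ((1 + ‖latticePoint k‖) ^ 4)⁻¹ := by
    rw [Real.rpow_neg hp.le]; norm_cast
  rw [h4]
  refine (mul_le_mul_of_nonneg_left (two_rpow_le_of_mem_freq hk hN) (norm_nonneg _)).trans ?_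
  rw [← div_eq_mul_inv, le_div_iff₀ (by positivity)]
  have := hC k
  rw [pow_add] at this
  have h2 : (0 : ℝ) ≤ 2 ^ N := by positivity
  nlinarith

lemma besovNorm_lt_top (hf : f ∈ P.besov α) : P.besovNorm α f < ⊤ := by
  obtain ⟨g, hg, h⟩ := hf.2 1 one_pos
  have := besovNorm_add_le (P := P) α (f - g) g
  rw [sub_add_cancel] at this
  exact this.trans_lt (ENNReal.add_lt_top.mpr ⟨h.trans ENNReal.one_lt_top,
    besovNorm_lt_top_of_isSmooth hg⟩)

lemma exists_besovNorm_le (hf : f ∈ P.besov α) :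
    ∃ A : ℝ, 0 ≤ A ∧ P.besovNorm α f ≤ ENNReal.ofReal A :=
  ⟨(P.besovNorm α f).toReal, ENNReal.toReal_nonneg,
    (ENNReal.ofReal_toReal (besovNorm_lt_top hf).ne).ge⟩

lemma exists_bound_of_spaceC {T : ℝ} {u : ℝ → PerDist} (hu : u ∈ P.spaceC T α) :
    ∃ A : ℝ, 0 ≤ A ∧ ∀ t ∈ Icc 0 T, P.besovNorm α (u t) ≤ ENNReal.ofReal A := by
  refine isCompact_Icc.induction_on
    (p := fun S => ∃ A : ℝ, 0 ≤ A ∧ ∀ t ∈ S, P.besovNorm α (u t) ≤ ENNReal.ofReal A)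
    ⟨0, le_rfl, by simp⟩ ?_ ?_ ?_
  · rintro s t hst ⟨A, hA, h⟩
    exact ⟨A, hA, fun r hr => h r (hst hr)⟩
  · rintro s t ⟨A, hA, h⟩ ⟨B, hB, h'⟩
    refine ⟨A + B, by positivity, fun r hr => ?_⟩
    rcases hr with hr | hr
    · exact (h r hr).trans (ENNReal.ofReal_le_ofReal (by linarith))
    · exact (h' r hr).trans (ENNReal.ofReal_le_ofReal (by linarith))
  · intro t ht
    obtain ⟨A, hA, h⟩ := exists_besovNorm_le (hu.1 t ht)
    refine ⟨{s | P.besovNorm α (u s - u t) ≤ 1}, ?_, 1 + A, by positivity, fun s hs => ?_⟩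
    · exact (hu.2 t ht).eventually (Iic_mem_nhds one_pos)
    · have := besovNorm_add_le (P := P) α (u s - u t) (u t)
      rw [sub_add_cancel] at this
      rw [ENNReal.ofReal_add one_pos.le hA, ENNReal.ofReal_one]
      exact this.trans (add_le_add hs h)

/-! ### Continuity in time -/

lemma continuousOn_coeff {S : Set ℝ} {u : ℝ → PerDist} (hu : P.ContOn S α u) (k : Fin 3 → ℤ) :
    ContinuousOn (fun t => u t k) S := by
  obtain ⟨C, hC, h⟩ := P.exists_norm_coeff_le α k
  intro t ht
  rw [ContinuousWithinAt, Metric.tendsto_nhds]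
  intro ε hε
  have hδ : 0 < ε / (C + 1) := by positivity
  filter_upwards [(hu.2 t ht).eventually (Iic_mem_nhds (ENNReal.ofReal_pos.mpr hδ))] with s hs
  have := h (u s - u t) _ hδ.le hs
  rw [dist_eq_norm]
  refine lt_of_le_of_lt this ?_
  rw [mul_div_assoc', div_lt_iff₀ (by positivity)]
  nlinarith

lemma isCont_of_mem_besov (hα : 0 < α) (hf : f ∈ P.besov α) : IsCont f := by
  obtain ⟨A, hA, h⟩ := exists_besovNorm_le hf
  exact (isCont_of_besovNorm_le hα hA h).1

lemma continuousOn_toFun {S : Set ℝ} {u : ℝ → PerDist} (hα : 0 < α) (hu : P.ContOn S α u) :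
    ContinuousOn (fun t => toFun (u t)) S := by
  intro t ht
  rw [ContinuousWithinAt, Metric.tendsto_nhds]
  intro ε hε
  have hg := geomConst_nonneg α
  have hδ : 0 < ε / (geomConst α + 1) := by positivity
  filter_upwards [(hu.2 t ht).eventually (Iic_mem_nhds (ENNReal.ofReal_pos.mpr hδ)),
    self_mem_nhdsWithin] with s hs hsS
  rw [dist_eq_norm, ← toFun_sub (isCont_of_mem_besov hα (hu.1 s hsS))
    (isCont_of_mem_besov hα (hu.1 t ht))]
  refine lt_of_le_of_lt (isCont_of_besovNorm_le hα hδ.le hs).2 ?_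
  rw [div_mul_eq_mul_div, div_lt_iff₀ (by positivity)]
  nlinarith

/-- A family bounded in a space of positive regularity and continuous in some Besov space is
continuous in the sup norm. -/
lemma continuousOn_toFun_of_bounded {S : Set ℝ} {u : ℝ → PerDist} {a b A : ℝ} (ha : a < 0)
    (hb : 0 < b) (hu : P.ContOn S a u) (hA : 0 ≤ A)
    (hub : ∀ t ∈ S, P.besovNorm b (u t) ≤ ENNReal.ofReal A) :
    ContinuousOn (fun t => toFun (u t)) S := by
  -- at `θ` the interpolated regularity is `b / 2`
  set θ := (b / 2 - a) / (b - a) with hθ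
  have hba : 0 < b - a := by linarith
  have h0 : 0 ≤ θ := by rw [hθ]; exact div_nonneg (by linarith) hba.le
  have h1 : θ < 1 := by rw [hθ, div_lt_one hba]; linarith
  have he : (1 - θ) * a + θ * b = b / 2 := by
    have : θ * (b - a) = b / 2 - a := by rw [hθ]; field_simp
    linarith
  have hsub : ∀ s ∈ S, ∀ t ∈ S, P.besovNorm b (u s - u t) ≤ ENNReal.ofReal (2 * A) :=
    fun s hs t ht => by
      rw [two_mul, ENNReal.ofReal_add hA hA]
      exact (besovNorm_sub_le b _ _).trans (add_le_add (hub s hs) (hub t ht))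
  have hc : ∀ t ∈ S, IsCont (u t) := fun t ht => (isCont_of_besovNorm_le hb hA (hub t ht)).1
  intro t ht
  rw [ContinuousWithinAt, tendsto_iff_dist_tendsto_zero, Metric.tendsto_nhds]
  intro ε hε
  have hlim : Tendsto (fun δ : ℝ => δ ^ (1 - θ) * (2 * A) ^ θ * geomConst (b / 2))
      (𝓝[>] 0) (𝓝 0) := by
    have : Tendsto (fun δ : ℝ => δ ^ (1 - θ)) (𝓝 0) (𝓝 ((0 : ℝ) ^ (1 - θ))) :=
      (Real.continuousAt_rpow_const 0 (1 - θ) (Or.inr (by linarith))).tendsto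
    rw [Real.zero_rpow (by linarith)] at this
    simpa using (((this.mono_left nhdsWithin_le_nhds).mul_const _).mul_const _ :
      Tendsto (fun δ : ℝ => δ ^ (1 - θ) * (2 * A) ^ θ * geomConst (b / 2)) (𝓝[>] 0) _)
  obtain ⟨δ, hδ, hδ0⟩ := ((hlim.eventually (gt_mem_nhds hε)).and self_mem_nhdsWithin).exists
  have hδ0 : 0 < δ := hδ0
  filter_upwards [(hu.2 t ht).eventually (Iic_mem_nhds (ENNReal.ofReal_pos.mpr hδ0)),
    self_mem_nhdsWithin] with s hs hsS
  rw [dist_zero_right, Real.norm_of_nonneg dist_nonneg, dist_eq_norm,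
    ← toFun_sub (hc s hsS) (hc t ht)]
  have h2 := besovNorm_interpolate hδ0.le (by positivity : 0 ≤ 2 * A) h0 h1.le hs (hsub s hsS t ht)
  rw [he] at h2
  exact lt_of_le_of_lt (isCont_of_besovNorm_le (by linarith) (by positivity) h2).2 hδ

end DyadicPartition

/-! ### Fourier multipliers on trigonometric polynomials -/

/-- The trigonometric polynomial with coefficients `c` on `s`. -/
def trig (s : Finset (Fin 3 → ℤ)) (c : (Fin 3 → ℤ) → ℂ) : C(T3, ℂ) := ∑ k ∈ s, c k • mFourier k

lemma trig_apply (s : Finset (Fin 3 → ℤ)) (c : (Fin 3 → ℤ) → ℂ) (x : T3) :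
    trig s c x = ∑ k ∈ s, c k * mFourier k x := by
  simp [trig, ContinuousMap.sum_apply]

/-- The translate `x - y` of a point of the torus by a vector of `ℝ³`. -/
def translate (x : T3) (y : E3) : T3 := fun i => x i + ((-(y i) : ℝ) : UnitAddCircle)

lemma mFourier_translate (k : Fin 3 → ℤ) (x : T3) (y : E3) :
    mFourier k (translate x y) =
      Complex.exp (((-2 * Real.pi * inner ℝ y (latticePoint k) : ℝ) : ℂ) * Complex.I) *
        mFourier k x := by
  have h1 : ∀ i, fourier (k i) (translate x y i) =
      Complex.exp (((-2 * Real.pi * (y i * k i) : ℝ) : ℂ) * Complex.I) * fourier (k i) (x i) := by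
    intro i
    rw [translate, fourier_apply, smul_add, AddCircle.toCircle_add, Circle.coe_mul,
      ← fourier_apply, ← fourier_apply, fourier_coe_apply, mul_comm]
    congr 2
    push_cast
    ring
  simp only [mFourier, ContinuousMap.coe_mk]
  rw [Finset.prod_congr rfl fun i _ => h1 i, Finset.prod_mul_distrib, ← Complex.exp_sum]
  congr 2
  rw [← Finset.sum_mul, ← Complex.ofReal_sum, ← Finset.mul_sum]
  congr 3
  simp [PiLp.inner_apply, latticePoint, mul_comm]

/-- A Fourier multiplier whose symbol is, at some scale, the Fourier transform of an integrable
kernel is bounded in the sup norm by the `L¹` norm of the kernel: it averages translates. -/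
lemma norm_trig_fourier_le {K : E3 → ℂ} (hK : Integrable K) (r : ℝ) (s : Finset (Fin 3 → ℤ))
    (c : (Fin 3 → ℤ) → ℂ) :
    ‖trig s (fun k => FourierTransform.fourier K (r • latticePoint k) * c k)‖ ≤
      (∫ y, ‖K y‖) * ‖trig s c‖ := by
  rw [ContinuousMap.norm_le _ (mul_nonneg (integral_nonneg fun _ => norm_nonneg _) (norm_nonneg _))]
  intro x
  have hint : ∀ k, Integrable (fun y => Complex.exp
      (((-2 * Real.pi * inner ℝ y (r • latticePoint k) : ℝ) : ℂ) * Complex.I) • K y) := fun k => by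
    refine Integrable.bdd_smul (𝕜 := ℂ) (φ := fun y => Complex.exp
      (((-2 * Real.pi * inner ℝ y (r • latticePoint k) : ℝ) : ℂ) * Complex.I)) hK 1 ?_ ?_
    · exact Continuous.aestronglyMeasurable (by fun_prop)
    · exact ae_of_all _ fun y => by rw [Complex.norm_exp_ofReal_mul_I]
  have e : trig s (fun k => FourierTransform.fourier K (r • latticePoint k) * c k) x =
      ∫ y, K y * trig s c (translate x (r • y)) := by
    rw [trig_apply]
    simp only [Real.fourier_eq', trig_apply, Finset.mul_sum]
    rw [integral_finsetSum]
    · refine Finset.sum_congr rfl fun k _ => ?_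
      rw [mul_assoc, ← integral_mul_const]
      congr 1; ext y
      rw [mFourier_translate, inner_smul_left, inner_smul_right, smul_eq_mul]
      simp only [conj_trivial]
      ring
    · intro k _
      refine ((hint k).mul_const (c k * mFourier k x)).congr (ae_of_all _ fun y => ?_)
      simp only
      rw [mFourier_translate, inner_smul_left, inner_smul_right, smul_eq_mul]
      simp only [conj_trivial]
      ring
  rw [e, ← integral_mul_const]
  refine norm_integral_le_of_norm_le (hK.norm.mul_const _) (ae_of_all _ fun y => ?_)
  rw [norm_mul]
  gcongr
  exact (trig s c).norm_coe_le_norm _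

/-- The complex heat semigroup is bounded in the sup norm. -/
lemma norm_trig_gaussian_le {z : ℂ} (hz : 0 < z.re) (s : Finset (Fin 3 → ℤ))
    (c : (Fin 3 → ℤ) → ℂ) :
    ‖trig s (fun k => Complex.exp (-z * (‖latticePoint k‖ : ℂ) ^ 2) * c k)‖ ≤
      (‖z‖ / z.re) ^ (3 / 2 : ℝ) * ‖trig s c‖ := by
  have hz0 : z ≠ 0 := fun h => by simp [h] at hz
  have hpi := Real.pi_pos
  have hpi0 : (Real.pi : ℂ) ≠ 0 := by exact_mod_cast hpi.ne'
  -- the exponent of the kernel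
  set b : ℂ := (Real.pi : ℂ) ^ 2 / z with hb
  have hb0 : b ≠ 0 := div_ne_zero (pow_ne_zero _ hpi0) hz0
  have hbre : b.re = Real.pi ^ 2 * z.re / ‖z‖ ^ 2 := by
    rw [hb, ← Complex.ofReal_pow, Complex.div_re, Complex.ofReal_re, Complex.ofReal_im]
    simp [Complex.normSq_eq_norm_sq]
  have hzn : 0 < ‖z‖ := norm_pos_iff.mpr hz0
  have hbpos : 0 < b.re := by rw [hbre]; positivity
  have hbn : ‖b‖ = Real.pi ^ 2 / ‖z‖ := by
    rw [hb, norm_div, norm_pow, Complex.norm_real, Real.norm_of_nonneg hpi.le]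
  have hfr : Module.finrank ℝ E3 = 3 := by simp
  set q : ℂ := (Real.pi / b : ℂ) ^ (3 / 2 : ℂ) with hq
  have hq0 : q ≠ 0 := by
    rw [hq, Complex.cpow_def_of_ne_zero (div_ne_zero hpi0 hb0)]
    exact Complex.exp_ne_zero _
  have hqn : ‖q‖ = (Real.pi / ‖b‖) ^ (3 / 2 : ℝ) := by
    have : (3 / 2 : ℂ) = ((3 / 2 : ℝ) : ℂ) := by push_cast; rfl
    rw [hq, this, Complex.norm_cpow_real, norm_div, Complex.norm_real,
      Real.norm_of_nonneg hpi.le]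
  set K : E3 → ℂ := fun v => q⁻¹ * Complex.exp (-b * (‖v‖ : ℂ) ^ 2) with hKdef
  have hexp : Integrable fun v : E3 => Complex.exp (-b * (‖v‖ : ℂ) ^ 2) := by
    simpa using GaussianFourier.integrable_cexp_neg_mul_sq_norm_add hbpos 0 (0 : E3)
  have hK : Integrable K := hexp.const_mul _
  have hF : ∀ w : E3, FourierTransform.fourier K w = Complex.exp (-z * (‖w‖ : ℂ) ^ 2) := by
    intro w
    have h1 := fourier_gaussian_innerProductSpace hbpos w
    rw [hfr] at h1
    have h2 : FourierTransform.fourier K w =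
        q⁻¹ * FourierTransform.fourier (fun v : E3 => Complex.exp (-b * (‖v‖ : ℂ) ^ 2)) w := by
      simp only [Real.fourier_eq', hKdef, smul_eq_mul]
      rw [← integral_const_mul]
      congr 1; ext v; ring
    rw [h2, h1]
    push_cast
    rw [← hq, ← mul_assoc, inv_mul_cancel₀ hq0, one_mul]
    congr 1
    rw [hb]
    field_simp
  have hnorm : ∫ v, ‖K v‖ = (‖z‖ / z.re) ^ (3 / 2 : ℝ) := by
    have : ∀ v : E3, ‖K v‖ = ‖q‖⁻¹ * Real.exp (-b.re * ‖v‖ ^ 2) := fun v => by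
      rw [hKdef, norm_mul, norm_inv, Complex.norm_exp, ← Complex.ofReal_pow, Complex.re_mul_ofReal,
        Complex.neg_re]
    simp only [this]
    rw [integral_const_mul, GaussianFourier.integral_rexp_neg_mul_sq_norm hbpos, hfr, hqn,
      ← Real.inv_rpow (by positivity)]
    push_cast
    rw [← Real.mul_rpow (by positivity) (by positivity)]
    congr 1
    rw [hbn, hbre]
    field_simp
  have := norm_trig_fourier_le hK 1 s c
  simpa only [hF, hnorm, one_smul] using this

/-- The smoothing effect of the complex heat semigroup, from its boundedness on a disc of complex
times and Cauchy's estimate. -/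
lemma norm_trig_sq_mul_gaussian_le {z : ℂ} (hz : 0 < z.re) (s : Finset (Fin 3 → ℤ))
    (c : (Fin 3 → ℤ) → ℂ) :
    ‖trig s (fun k => ((‖latticePoint k‖ ^ 2 : ℝ) : ℂ) *
        (Complex.exp (-z * (‖latticePoint k‖ : ℂ) ^ 2) * c k))‖ ≤
      (4 * (‖z‖ / z.re)) ^ (3 / 2 : ℝ) * ‖trig s c‖ / (z.re / 2) := by
  set φ : ℂ → C(T3, ℂ) := fun w =>
    ∑ k ∈ s, (Complex.exp (-w * (‖latticePoint k‖ : ℂ) ^ 2) * c k) • mFourier k with hφ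
  have hd : ∀ w, HasDerivAt φ (∑ k ∈ s, (Complex.exp (-w * (‖latticePoint k‖ : ℂ) ^ 2) *
      (-1 * (‖latticePoint k‖ : ℂ) ^ 2) * c k) • mFourier k) w := fun w => by
    refine HasDerivAt.fun_sum fun k _ => ?_
    have h : HasDerivAt (fun w : ℂ => Complex.exp (-w * (‖latticePoint k‖ : ℂ) ^ 2) * c k)
        (Complex.exp (-w * (‖latticePoint k‖ : ℂ) ^ 2) * (-1 * (‖latticePoint k‖ : ℂ) ^ 2) * c k)
        w :=
      (((hasDerivAt_id w).neg.mul_const _).cexp).mul_const _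
    exact h.smul_const (mFourier k)
  have hR : 0 < z.re / 2 := by positivity
  have hdiff : DiffContOnCl ℂ φ (Metric.ball z (z.re / 2)) :=
    Differentiable.diffContOnCl fun w => (hd w).differentiableAt
  have hbound : ∀ w ∈ Metric.sphere z (z.re / 2),
      ‖φ w‖ ≤ (4 * (‖z‖ / z.re)) ^ (3 / 2 : ℝ) * ‖trig s c‖ := fun w hw => by
    have hw' : ‖w - z‖ = z.re / 2 := by rwa [mem_sphere_iff_norm] at hw
    have h1 : |(w - z).re| ≤ z.re / 2 := hw' ▸ Complex.abs_re_le_norm _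
    rw [Complex.sub_re, abs_le] at h1
    have hre : z.re / 2 ≤ w.re := by linarith [h1.1]
    have hzre : z.re ≤ ‖z‖ := Complex.re_le_norm z
    have hwn : ‖w‖ ≤ 2 * ‖z‖ := by
      have : ‖w‖ ≤ ‖w - z‖ + ‖z‖ := by simpa using norm_add_le (w - z) z
      linarith
    refine (norm_trig_gaussian_le (lt_of_lt_of_le hR hre) s c).trans ?_
    gcongr
    · exact div_nonneg (norm_nonneg _) (hR.le.trans hre)
    · rw [div_le_iff₀ (lt_of_lt_of_le hR hre)]
      refine hwn.trans ?_
      have : 4 * (‖z‖ / z.re) * (z.re / 2) ≤ 4 * (‖z‖ / z.re) * w.re := by gcongr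
      refine le_trans (le_of_eq ?_) this
      field_simp; ring
  have := Complex.norm_deriv_le_of_forall_mem_sphere_norm_le hR hdiff hbound
  rw [(hd z).deriv] at this
  refine le_trans (le_of_eq ?_) this
  rw [← norm_neg, trig, ← Finset.sum_neg_distrib]
  congr 1
  refine Finset.sum_congr rfl fun k _ => ?_
  ext x
  simp only [ContinuousMap.neg_apply, ContinuousMap.smul_apply, smul_eq_mul]
  push_cast; ring

/-- There is a Schwartz function equal to `‖x‖⁻²` on the annulus of the Littlewood-Paley blocks. -/
lemma exists_schwartz_inv_sq : ∃ ψ : SchwartzMap E3 ℂ, ∀ x : E3, 3 / 4 ≤ ‖x‖ → ‖x‖ ≤ 8 / 3 →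
    ψ x = ((‖x‖ ^ 2)⁻¹ : ℝ) := by
  set big : ContDiffBump (0 : E3) := ⟨3, 4, by norm_num, by norm_num⟩
  set small : ContDiffBump (0 : E3) := ⟨1 / 4, 1 / 2, by norm_num, by norm_num⟩
  set η : E3 → ℂ := fun x => (((big x - small x) * (‖x‖ ^ 2)⁻¹ : ℝ) : ℂ) with hη
  have hsm : ContDiff ℝ ∞ η := by
    rw [contDiff_iff_contDiffAt]
    intro x
    by_cases hx : x = 0
    · subst hx
      have : η =ᶠ[𝓝 0] fun _ => 0 := by
        filter_upwards [Metric.ball_mem_nhds (0 : E3) (by norm_num : (0 : ℝ) < 1 / 4)] with y hy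
        have h1 : small y = 1 := small.one_of_mem_closedBall (Metric.ball_subset_closedBall hy)
        have h2 : big y = 1 := big.one_of_mem_closedBall (by
          rw [mem_closedBall_zero_iff]; rw [mem_ball_zero_iff] at hy
          exact hy.le.trans (by norm_num [big]))
        simp [hη, h1, h2]
      exact contDiffAt_const.congr_of_eventuallyEq this
    · refine Complex.ofRealCLM.contDiff.contDiffAt.comp x ?_
      refine ContDiffAt.mul (big.contDiff.sub small.contDiff).contDiffAt ?_
      exact (contDiff_norm_sq ℝ).contDiffAt.inv (by simpa using hx)
  have hc : HasCompactSupport η := by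
    refine HasCompactSupport.of_support_subset_isCompact
      (isCompact_closedBall (0 : E3) 4) fun x hx => ?_
    by_contra h
    rw [mem_closedBall_zero_iff, not_le] at h
    have h1 : big x = 0 := big.zero_of_le_dist (by rw [dist_zero_right]; exact h.le)
    have h2 : small x = 0 := small.zero_of_le_dist (by
      rw [dist_zero_right]; exact le_trans (by norm_num [small]) h.le)
    exact hx (by simp [hη, h1, h2])
  refine ⟨hc.toSchwartzMap hsm, fun x h1 h2 => ?_⟩
  have e1 : big x = 1 := big.one_of_mem_closedBall (by
    rw [mem_closedBall_zero_iff]; exact h2.trans (by norm_num [big]))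
  have e2 : small x = 0 := small.zero_of_le_dist (by
    rw [dist_zero_right]; exact le_trans (by norm_num [small]) h1)
  change η x = _
  simp [hη, e1, e2]

/-! ### Smoothing by the integration map -/

/-- The action of `P¹_τ = exp(τ((i + μ)Δ - 1))` on Fourier coefficients. -/
def heat (μ τ : ℝ) (f : PerDist) : PerDist := fun k =>
  Complex.exp (-(τ : ℂ) * (symbol μ k + 1)) * f k

lemma integrable_sub_rpow {θ t : ℝ} (hθ : θ < 1) :
    IntervalIntegrable (fun s => (t - s) ^ (-θ)) volume 0 t := by
  have h : IntervalIntegrable (fun s : ℝ => s ^ (-θ)) volume 0 t :=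
    intervalIntegral.intervalIntegrable_rpow' (by linarith)
  simpa using (h.comp_sub_left t).symm

lemma integral_sub_rpow {θ t : ℝ} (hθ : θ < 1) :
    ∫ s in (0 : ℝ)..t, (t - s) ^ (-θ) = t ^ (1 - θ) / (1 - θ) := by
  rw [intervalIntegral.integral_comp_sub_left (fun s => s ^ (-θ)) t, sub_self, sub_zero,
    integral_rpow (Or.inl (by linarith)), Real.zero_rpow (by linarith)]
  rw [neg_add_eq_sub, sub_zero]

lemma symbol_re (μ : ℝ) (k : Fin 3 → ℤ) :
    (symbol μ k).re = μ * (4 * Real.pi ^ 2 * ‖latticePoint k‖ ^ 2) := by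
  rw [symbol, Complex.re_mul_ofReal]; simp

namespace DyadicPartition

variable {P : DyadicPartition}

lemma blockC_eq_trig (i : ℕ) (f : PerDist) :
    P.blockC i f = trig (P.freq i) (fun k => (P.weight i k : ℂ) * f k) := rfl

lemma blockC_heat (μ τ : ℝ) (i : ℕ) (f : PerDist) :
    P.blockC i (heat μ τ f) = Complex.exp (-τ : ℂ) • trig (P.freq i) (fun k =>
      Complex.exp (-((τ : ℂ) * ((Complex.I + μ) * (4 * Real.pi ^ 2 : ℝ))) *
        (‖latticePoint k‖ : ℂ) ^ 2) * ((P.weight i k : ℂ) * f k)) := by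
  ext x
  rw [blockC_eq_trig, ContinuousMap.smul_apply, trig_apply, trig_apply, smul_eq_mul,
    Finset.mul_sum]
  refine Finset.sum_congr rfl fun k _ => ?_
  have : Complex.exp (-(τ : ℂ) * (symbol μ k + 1)) = Complex.exp (-τ : ℂ) *
      Complex.exp (-((τ : ℂ) * ((Complex.I + μ) * (4 * Real.pi ^ 2 : ℝ))) *
        (‖latticePoint k‖ : ℂ) ^ 2) := by
    rw [← Complex.exp_add, symbol]
    congr 1; push_cast; ring
  rw [heat, this]; ring

lemma norm_exp_neg_le_one {τ : ℝ} (hτ : 0 ≤ τ) : ‖Complex.exp (-τ : ℂ)‖ ≤ 1 := by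
  rw [Complex.norm_exp]; simpa using hτ

/-- The heat semigroup on the blocks: boundedness, and a gain of two derivatives at the price of a
factor `τ⁻¹`. -/
lemma exists_norm_blockC_heat_le (P : DyadicPartition) {μ : ℝ} (hμ : 0 < μ) (T : ℝ) :
    ∃ C : ℝ, 0 ≤ C ∧ ∀ τ, 0 ≤ τ → τ ≤ T → ∀ (i : ℕ) (f : PerDist),
      ‖P.blockC i (heat μ τ f)‖ ≤ C * ‖P.blockC i f‖ ∧ (0 < τ →
      ‖P.blockC i (heat μ τ f)‖ ≤ C * ((2 : ℝ) ^ (-((i : ℝ) - 1) * 2) / τ) * ‖P.blockC i f‖) := by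
  obtain ⟨ψ, hψ⟩ := exists_schwartz_inv_sq
  have hpi := Real.pi_pos
  set q : ℂ := (Complex.I + μ) * (4 * Real.pi ^ 2 : ℝ) with hq
  have hqre : 0 < q.re := by rw [hq, Complex.re_mul_ofReal]; simp; positivity
  have hqn : 0 < ‖q‖ := lt_of_lt_of_le hqre (Complex.re_le_norm q)
  have hzre : ∀ τ : ℝ, ((τ : ℂ) * q).re = τ * q.re := fun τ => Complex.re_ofReal_mul τ q
  have hratio : ∀ τ : ℝ, 0 < τ → ‖(τ : ℂ) * q‖ / ((τ : ℂ) * q).re = ‖q‖ / q.re := fun τ hτ => by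
    rw [hzre, norm_mul, Complex.norm_real, Real.norm_of_nonneg hτ.le]
    field_simp
  set C₁ : ℝ := max 1 ((‖q‖ / q.re) ^ (3 / 2 : ℝ)) with hC₁
  have hC₁0 : 0 ≤ C₁ := le_trans zero_le_one (le_max_left _ _)
  have hb1 : ∀ τ, 0 ≤ τ → ∀ (i : ℕ) (f : PerDist),
      ‖P.blockC i (heat μ τ f)‖ ≤ C₁ * ‖P.blockC i f‖ := by
    intro τ hτ i f
    rcases hτ.eq_or_lt with rfl | hτ'
    · have : heat μ 0 f = f := by funext k; simp [heat]
      rw [this]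
      exact le_mul_of_one_le_left (norm_nonneg _) (le_max_left _ _)
    rw [blockC_heat, norm_smul]
    refine (mul_le_of_le_one_left (norm_nonneg _) (norm_exp_neg_le_one hτ)).trans ?_
    refine (norm_trig_gaussian_le (by rw [hzre]; positivity) _ _).trans ?_
    rw [hratio τ hτ', ← blockC_eq_trig]
    exact mul_le_mul_of_nonneg_right (le_max_right _ _) (norm_nonneg _)
  obtain ⟨L, hL⟩ : ∃ L, L = ∫ y, ‖FourierTransformInv.fourierInv (ψ : E3 → ℂ) y‖ := ⟨_, rfl⟩
  have hL0 : 0 ≤ L := hL ▸ integral_nonneg fun _ => norm_nonneg _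
  have hψi : Integrable (FourierTransformInv.fourierInv (ψ : E3 → ℂ)) := by
    rw [← SchwartzMap.fourierInv_coe]
    exact SchwartzMap.integrable _
  have hψF : FourierTransform.fourier (FourierTransformInv.fourierInv (ψ : E3 → ℂ)) = ψ := by
    rw [← SchwartzMap.fourierInv_coe, ← SchwartzMap.fourier_coe]
    simp
  set C₂ : ℝ := L * ((4 * (‖q‖ / q.re)) ^ (3 / 2 : ℝ) / (q.re / 2)) with hC₂
  have hC₂0 : 0 ≤ C₂ := by positivity
  refine ⟨max C₁ (max C₂ (C₁ * (T / 4))), le_max_of_le_left hC₁0, fun τ hτ hτT i f =>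
    ⟨(hb1 τ hτ i f).trans (mul_le_mul_of_nonneg_right (le_max_left _ _) (norm_nonneg _)),
      fun hτ' => ?_⟩⟩
  cases i with
  | zero =>
    -- the lowest block gains nothing, but `τ ≤ T`
    have h1 : (2 : ℝ) ^ (-(((0 : ℕ) : ℝ) - 1) * 2) = 4 := by
      norm_num
    rw [h1]
    refine (hb1 τ hτ 0 f).trans (mul_le_mul_of_nonneg_right ?_ (norm_nonneg _))
    calc C₁ ≤ C₁ * (T / τ) := le_mul_of_one_le_right hC₁0 ((one_le_div hτ').mpr hτT)
      _ = C₁ * (T / 4) * (4 / τ) := by field_simp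
      _ ≤ _ := by
        gcongr
        exact (le_max_right _ _).trans (le_max_right _ _)
  | succ j =>
    have h1 : (2 : ℝ) ^ (-(((j + 1 : ℕ) : ℝ) - 1) * 2) = ((2 ^ j) ^ 2)⁻¹ := by
      push_cast
      rw [add_sub_cancel_right, neg_mul, Real.rpow_neg (by norm_num), Real.rpow_mul (by norm_num),
        Real.rpow_natCast]
      norm_cast
    rw [h1, blockC_heat, norm_smul]
    refine (mul_le_of_le_one_left (norm_nonneg _) (norm_exp_neg_le_one hτ)).trans ?_
    have hre : 0 < ((τ : ℂ) * q).re := by rw [hzre]; positivity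
    -- on the block, divide and multiply by `|2⁻ʲ k|²`
    have e : trig (P.freq (j + 1)) (fun k =>
        Complex.exp (-((τ : ℂ) * q) * (‖latticePoint k‖ : ℂ) ^ 2) *
          ((P.weight (j + 1) k : ℂ) * f k)) =
        ((((2 : ℝ) ^ j) ^ 2)⁻¹ : ℝ) • trig (P.freq (j + 1)) (fun k =>
          FourierTransform.fourier (FourierTransformInv.fourierInv (ψ : E3 → ℂ))
            (((2 : ℝ) ^ j)⁻¹ • latticePoint k) *
          (((‖latticePoint k‖ ^ 2 : ℝ) : ℂ) *
            (Complex.exp (-((τ : ℂ) * q) * (‖latticePoint k‖ : ℂ) ^ 2) *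
              ((P.weight (j + 1) k : ℂ) * f k)))) := by
      ext x
      rw [ContinuousMap.smul_apply, trig_apply, trig_apply, Finset.smul_sum]
      refine Finset.sum_congr rfl fun k hk => ?_
      have hk' : P.weight (j + 1) k ≠ 0 := by simpa [freq] using hk
      have hlow : 3 / 4 ≤ ‖((2 : ℝ) ^ j)⁻¹ • latticePoint k‖ := by
        by_contra h
        exact hk' (P.phi_eq_zero_of_lt (not_le.mp h))
      have hhigh : ‖((2 : ℝ) ^ j)⁻¹ • latticePoint k‖ ≤ 8 / 3 := by
        by_contra h
        exact hk' (P.phi_eq_zero_of_le (not_le.mp h).le)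
      rw [hψF, hψ _ hlow hhigh]
      rw [norm_smul_latticePoint] at hlow ⊢
      have hk0 : (‖latticePoint k‖ : ℂ) ≠ 0 := by
        intro h0
        rw [Complex.ofReal_eq_zero] at h0
        rw [h0, zero_div] at hlow
        norm_num at hlow
      rw [Complex.real_smul]
      push_cast
      field_simp
    rw [e, norm_smul, Real.norm_of_nonneg (by positivity)]
    have h2 := norm_trig_fourier_le hψi ((2 : ℝ) ^ j)⁻¹ (P.freq (j + 1)) (fun k =>
      (((‖latticePoint k‖ ^ 2 : ℝ) : ℂ) *
            (Complex.exp (-((τ : ℂ) * q) * (‖latticePoint k‖ : ℂ) ^ 2) *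
              ((P.weight (j + 1) k : ℂ) * f k))))
    have h3 := norm_trig_sq_mul_gaussian_le hre (P.freq (j + 1))
      (fun k => (P.weight (j + 1) k : ℂ) * f k)
    rw [hratio τ hτ', hzre, ← blockC_eq_trig] at h3
    rw [← hL] at h2
    calc _ ≤ (((2 : ℝ) ^ j) ^ 2)⁻¹ * (L * ((4 * (‖q‖ / q.re)) ^ (3 / 2 : ℝ) *
          ‖P.blockC (j + 1) f‖ / (τ * q.re / 2))) := by
          gcongr
          exact h2.trans (by gcongr)
      _ = C₂ * ((((2 : ℝ) ^ j) ^ 2)⁻¹ / τ) * ‖P.blockC (j + 1) f‖ := by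
          rw [hC₂]; field_simp
      _ ≤ _ := by
          gcongr
          exact (le_max_left _ _).trans (le_max_right _ _)

/-- Interpolation between the two estimates of `exists_norm_blockC_heat_le`. -/
lemma exists_norm_blockC_heat_rpow_le (P : DyadicPartition) {μ : ℝ} (hμ : 0 < μ) (T : ℝ) :
    ∃ C : ℝ, 0 ≤ C ∧ ∀ τ, 0 ≤ τ → τ ≤ T → ∀ (i : ℕ) (f : PerDist),
      ‖P.blockC i (heat μ τ f)‖ ≤ C * ‖P.blockC i f‖ ∧ (0 < τ → ∀ θ ∈ Icc (0 : ℝ) 1,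
      ‖P.blockC i (heat μ τ f)‖ ≤
        C * ((2 : ℝ) ^ (-((i : ℝ) - 1) * (2 * θ)) * τ ^ (-θ)) * ‖P.blockC i f‖) := by
  obtain ⟨C, hC, h⟩ := P.exists_norm_blockC_heat_le hμ T
  refine ⟨C, hC, fun τ hτ hτT i f => ⟨(h τ hτ hτT i f).1, fun hτ' θ hθ => ?_⟩⟩
  set x : ℝ := (2 : ℝ) ^ (-((i : ℝ) - 1) * 2) / τ with hx
  have hx0 : 0 < x := by positivity
  have e : (2 : ℝ) ^ (-((i : ℝ) - 1) * (2 * θ)) * τ ^ (-θ) = x ^ θ := by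
    rw [hx, Real.div_rpow (by positivity) hτ, ← Real.rpow_mul (by norm_num), Real.rpow_neg hτ,
      ← div_eq_mul_inv, mul_assoc]
  rw [e]
  rcases le_total 1 x with h1 | h1
  · refine (h τ hτ hτT i f).1.trans (mul_le_mul_of_nonneg_right ?_ (norm_nonneg _))
    exact le_mul_of_one_le_right hC (Real.one_le_rpow h1 hθ.1)
  · refine ((h τ hτ hτT i f).2 hτ').trans (mul_le_mul_of_nonneg_right ?_ (norm_nonneg _))
    refine mul_le_mul_of_nonneg_left ?_ hC
    have := Real.rpow_le_rpow_of_exponent_ge hx0 h1 hθ.2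
    rwa [Real.rpow_one] at this

lemma continuousOn_heat_coeff {μ t : ℝ} {f : ℝ → PerDist} (k : Fin 3 → ℤ)
    (hf : ContinuousOn (fun s => f s k) (Icc 0 t)) :
    ContinuousOn (fun s => heat μ (t - s) (f s) k) (Icc 0 t) := by
  unfold heat
  exact ContinuousOn.mul (Continuous.continuousOn (by fun_prop)) hf

lemma block_integ {μ t : ℝ} (ht : 0 ≤ t) {u₀ : PerDist} {f : ℝ → PerDist}
    (hf : ∀ k, ContinuousOn (fun s => f s k) (Icc 0 t)) (i : ℕ) (x : T3) :
    P.blockC i (integ μ u₀ f t) x = P.blockC i (heat μ t u₀) x +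
      ∫ s in (0 : ℝ)..t, P.blockC i (heat μ (t - s) (f s)) x := by
  simp only [blockC_eq_trig, trig_apply]
  rw [intervalIntegral.integral_finsetSum, ← Finset.sum_add_distrib]
  · refine Finset.sum_congr rfl fun k _ => ?_
    have : integ μ u₀ f t k = heat μ t u₀ k + ∫ s in (0 : ℝ)..t, heat μ (t - s) (f s) k := rfl
    rw [this, intervalIntegral.integral_mul_const, intervalIntegral.integral_const_mul]
    ring
  · intro k _
    have := (continuousOn_heat_coeff (μ := μ) k (hf k)).intervalIntegrable_of_Icc (μ := volume) ht
    exact (this.const_mul _).mul_const _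

/-- The Schauder estimate: the integration map gains almost two derivatives, so that it maps
`C^β`, `β > -2`, to a space of positive regularity. -/
lemma exists_besovNorm_integ_le (P : DyadicPartition) {μ : ℝ} (hμ : 0 < μ) {T β : ℝ} (hβ : -2 < β)
    {f : ℝ → PerDist} (hf : f ∈ P.spaceC T β) {u₀ : PerDist} (hu₀ : u₀ ∈ P.besov (β + 2)) :
    ∃ ε : ℝ, 0 < ε ∧ ∃ A : ℝ, 0 ≤ A ∧ ∀ t ∈ Icc 0 T,
      P.besovNorm ε (integ μ u₀ f t) ≤ ENNReal.ofReal A := by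
  obtain ⟨C, hC, hheat⟩ := P.exists_norm_blockC_heat_rpow_le hμ T
  obtain ⟨A₀, hA₀, h₀⟩ := exists_besovNorm_le hu₀
  obtain ⟨B, hB, hfB⟩ := exists_bound_of_spaceC hf
  rw [besovNorm_le_ofReal_iff hA₀] at h₀
  obtain ⟨θ, hθ0, hθ1, hθβ⟩ : ∃ θ : ℝ, 0 ≤ θ ∧ θ < 1 ∧ 0 < β + 2 * θ := by
    rcases le_total β 0 with h | h
    · exact ⟨1 - (β + 2) / 4, by linarith, by linarith, by linarith⟩
    · exact ⟨1 / 2, by norm_num, by norm_num, by linarith⟩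
  set A : ℝ := C * A₀ * 2 ^ (2 - 2 * θ) + C * B * (T ^ (1 - θ) / (1 - θ)) with hA
  refine ⟨β + 2 * θ, hθβ, max A 0, le_max_right _ _, fun t ht => ?_⟩
  have hcont : ∀ k, ContinuousOn (fun s => f s k) (Icc 0 t) := fun k =>
    (continuousOn_coeff hf k).mono (Icc_subset_Icc_right ht.2)
  rw [besovNorm_le_ofReal_iff (le_max_right _ _)]
  intro i
  refine le_trans ?_ (mul_le_mul_of_nonneg_right (le_max_left A 0) (by positivity))
  have hT : 0 ≤ T := ht.1.trans ht.2
  have hA0 : 0 ≤ A := by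
    have : 0 < 1 - θ := by linarith
    positivity
  rw [ContinuousMap.norm_le _ (by positivity)]
  intro x
  rw [block_integ ht.1 hcont, hA, add_mul]
  refine (norm_add_le _ _).trans (add_le_add ?_ ?_)
  · refine ((P.blockC i _).norm_coe_le_norm x).trans (((hheat t ht.1 ht.2 i u₀).1).trans ?_)
    rw [mul_assoc, mul_assoc]
    refine mul_le_mul_of_nonneg_left ((h₀ i).trans ?_) hC
    refine mul_le_mul_of_nonneg_left ?_ hA₀
    rw [← Real.rpow_add (by norm_num)]
    refine Real.rpow_le_rpow_of_exponent_le (by norm_num) ?_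
    have : (0 : ℝ) ≤ i := Nat.cast_nonneg i
    nlinarith
  · set c : ℝ := C * B * (2 : ℝ) ^ (-((i : ℝ) - 1) * (β + 2 * θ)) with hc
    have hbd : ∀ᵐ s, s ∈ Ioc (0 : ℝ) t →
        ‖P.blockC i (heat μ (t - s) (f s)) x‖ ≤ c * (t - s) ^ (-θ) := by
      filter_upwards [compl_mem_ae_iff.mpr (measure_singleton t)] with s hst hs
      have hs' : 0 < t - s := sub_pos.mpr (lt_of_le_of_ne hs.2 hst)
      refine ((P.blockC i _).norm_coe_le_norm x).trans ?_
      refine ((hheat (t - s) hs'.le (by linarith [ht.2, hs.1]) i (f s)).2 hs' θ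
        ⟨hθ0, hθ1.le⟩).trans ?_
      have hB' := (besovNorm_le_ofReal_iff hB).mp (hfB s ⟨hs.1.le, hs.2.trans ht.2⟩) i
      calc _ ≤ C * ((2 : ℝ) ^ (-((i : ℝ) - 1) * (2 * θ)) * (t - s) ^ (-θ)) *
            (B * (2 : ℝ) ^ (-((i : ℝ) - 1) * β)) := by gcongr
        _ = C * B * ((2 : ℝ) ^ (-((i : ℝ) - 1) * β) * (2 : ℝ) ^ (-((i : ℝ) - 1) * (2 * θ))) *
            (t - s) ^ (-θ) := by ring
        _ = _ := by
          rw [← Real.rpow_add (by norm_num), hc]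
          congr 3; ring
    refine (intervalIntegral.norm_integral_le_of_norm_le ht.1 hbd
      ((integrable_sub_rpow hθ1).const_mul c)).trans ?_
    rw [intervalIntegral.integral_const_mul, integral_sub_rpow hθ1, hc]
    have : 0 < 1 - θ := by linarith
    calc _ ≤ C * B * (2 : ℝ) ^ (-((i : ℝ) - 1) * (β + 2 * θ)) * (T ^ (1 - θ) / (1 - θ)) := by
          gcongr
          · exact ht.1
          · exact ht.2
      _ = _ := by ring

end DyadicPartition

/-! ### The integration map and the Wiener algebra -/

lemma exp_neg_le_rpow {y θ : ℝ} (hy : 0 < y) (h0 : 0 ≤ θ) (h1 : θ ≤ 1) :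
    Real.exp (-y) ≤ y ^ (-θ) := by
  rw [Real.exp_neg, Real.rpow_neg hy.le]
  refine inv_anti₀ (by positivity) ?_
  rcases le_total 1 y with h | h
  · calc y ^ θ ≤ y ^ (1 : ℝ) := Real.rpow_le_rpow_of_exponent_le h h1
      _ ≤ _ := by rw [Real.rpow_one]; linarith [Real.add_one_le_exp y]
  · exact (Real.rpow_le_one hy.le h h0).trans (Real.one_le_exp hy.le)

/-- The decay of the heat factor. The exponents are such that `τ ^ (-7/8)` is integrable at `0` and
`(1 + |k|) ^ (-7/4)` is square-summable on `ℤ³`. -/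
lemma exists_norm_exp_symbol_le {μ : ℝ} (hμ : 0 < μ) : ∃ C : ℝ, 0 ≤ C ∧ ∀ τ : ℝ, 0 < τ → ∀ k,
    ‖Complex.exp (-(τ : ℂ) * (symbol μ k + 1))‖ ≤
      C * τ ^ (-(7 / 8) : ℝ) * (1 + ‖latticePoint k‖) ^ (-(7 / 4) : ℝ) := by
  have hpi := Real.pi_pos
  set c : ℝ := min (4 * Real.pi ^ 2 * μ) 1 / 2 with hc
  have hc0 : 0 < c := by positivity
  refine ⟨c ^ (-(7 / 8) : ℝ), by positivity, fun τ hτ k => ?_⟩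
  set x := ‖latticePoint k‖
  have hx : 0 ≤ x := norm_nonneg _
  have hre : (-(τ : ℂ) * (symbol μ k + 1)).re = -(τ * (μ * (4 * Real.pi ^ 2 * x ^ 2) + 1)) := by
    rw [← Complex.ofReal_neg, Complex.re_ofReal_mul, Complex.add_re, symbol_re, Complex.one_re]
    ring
  have hle : c * (1 + x) ^ 2 ≤ μ * (4 * Real.pi ^ 2 * x ^ 2) + 1 := by
    have h1 : min (4 * Real.pi ^ 2 * μ) 1 ≤ 4 * Real.pi ^ 2 * μ := min_le_left _ _
    have h2 : min (4 * Real.pi ^ 2 * μ) 1 ≤ 1 := min_le_right _ _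
    have h3 : (1 + x) ^ 2 ≤ 2 * (1 + x ^ 2) := by nlinarith [sq_nonneg (1 - x)]
    have h4 : c * (1 + x) ^ 2 ≤ c * (2 * (1 + x ^ 2)) := by gcongr
    have h5 := mul_le_mul_of_nonneg_right h1 (sq_nonneg x)
    have h6 : c * (2 * (1 + x ^ 2)) =
        min (4 * Real.pi ^ 2 * μ) 1 + min (4 * Real.pi ^ 2 * μ) 1 * x ^ 2 := by rw [hc]; ring
    rw [h6] at h4
    nlinarith
  rw [Complex.norm_exp, hre]
  have hy : 0 < τ * (c * (1 + x) ^ 2) := by positivity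
  calc Real.exp (-(τ * (μ * (4 * Real.pi ^ 2 * x ^ 2) + 1)))
      ≤ Real.exp (-(τ * (c * (1 + x) ^ 2))) := by gcongr
    _ ≤ (τ * (c * (1 + x) ^ 2)) ^ (-(7 / 8) : ℝ) :=
        exp_neg_le_rpow hy (by norm_num) (by norm_num)
    _ = _ := by
        rw [Real.mul_rpow hτ.le (by positivity), Real.mul_rpow hc0.le (by positivity),
          ← Real.rpow_natCast (1 + x) 2, ← Real.rpow_mul (by positivity)]
        norm_num
        ring

/-- The square root of `∑ₖ (1 + |k|)^{-7/2}`. -/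
def latticeConst : ℝ := √(∑' k : Fin 3 → ℤ, ((1 + ‖latticePoint k‖) ^ (-(7 / 4) : ℝ)) ^ 2)

lemma sum_weighted_le {g : PerDist} (hg : L2 g) {M : ℝ} (hM : 0 ≤ M) (h : ∑' k, ‖g k‖ ^ 2 ≤ M ^ 2)
    (s : Finset (Fin 3 → ℤ)) :
    ∑ k ∈ s, (1 + ‖latticePoint k‖) ^ (-(7 / 4) : ℝ) * ‖g k‖ ≤ latticeConst * M := by
  have hs : Summable fun k : Fin 3 → ℤ => ((1 + ‖latticePoint k‖) ^ (-(7 / 4) : ℝ)) ^ 2 := by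
    refine (summable_one_add_norm_latticePoint (r := 7 / 2) (by norm_num)).congr fun k => ?_
    rw [← Real.rpow_natCast _ 2, ← Real.rpow_mul (by positivity)]
    norm_num
  refine (Real.sum_mul_le_sqrt_mul_sqrt s _ _).trans ?_
  refine mul_le_mul (Real.sqrt_le_sqrt (hs.sum_le_tsum s fun _ _ => by positivity)) ?_
    (Real.sqrt_nonneg _) (Real.sqrt_nonneg _)
  rw [← Real.sqrt_sq hM]
  exact Real.sqrt_le_sqrt ((Summable.sum_le_tsum s (fun _ _ => by positivity) hg).trans h)

/-- At positive times, the integration map sends families bounded in `L²` to the Wiener algebra. -/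
lemma wiener_integ {μ t M : ℝ} (hμ : 0 < μ) (ht : 0 < t) (hM : 0 ≤ M) {u₀ : PerDist} (hu₀ : L2 u₀)
    {f : ℝ → PerDist} (hf : ∀ k, ContinuousOn (fun s => f s k) (Icc 0 t))
    (hL : ∀ s ∈ Icc 0 t, L2 (f s)) (hfM : ∀ s ∈ Icc 0 t, ∑' k, ‖f s k‖ ^ 2 ≤ M ^ 2) :
    Wiener (integ μ u₀ f t) := by
  obtain ⟨C, hC, hexp⟩ := exists_norm_exp_symbol_le hμ
  set h : (Fin 3 → ℤ) → ℝ → ℂ := fun k s => heat μ (t - s) (f s) k with hh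
  have hcont : ∀ k, ContinuousOn (h k) (Icc 0 t) := fun k =>
    DyadicPartition.continuousOn_heat_coeff k (hf k)
  have hheat : ∀ (τ : ℝ), 0 < τ → ∀ (g : PerDist) (k), ‖heat μ τ g k‖ ≤
      C * τ ^ (-(7 / 8) : ℝ) * ((1 + ‖latticePoint k‖) ^ (-(7 / 4) : ℝ) * ‖g k‖) := by
    intro τ hτ g k
    rw [heat, norm_mul, ← mul_assoc]
    exact mul_le_mul_of_nonneg_right (hexp τ hτ k) (norm_nonneg _)
  have hsum : ∀ (τ : ℝ), 0 < τ → ∀ (g : PerDist) (m : ℝ), 0 ≤ m → L2 g →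
      ∑' k, ‖g k‖ ^ 2 ≤ m ^ 2 → ∀ S : Finset (Fin 3 → ℤ),
      ∑ k ∈ S, ‖heat μ τ g k‖ ≤ C * τ ^ (-(7 / 8) : ℝ) * (latticeConst * m) := by
    intro τ hτ g m hm hg hgm S
    refine (Finset.sum_le_sum fun k _ => hheat τ hτ g k).trans ?_
    rw [← Finset.mul_sum]
    exact mul_le_mul_of_nonneg_left (sum_weighted_le hg hm hgm S) (by positivity)
  set m₀ := √(∑' k, ‖u₀ k‖ ^ 2)
  have hm₀ : ∑' k, ‖u₀ k‖ ^ 2 ≤ m₀ ^ 2 :=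
    (Real.sq_sqrt (tsum_nonneg fun _ => by positivity)).ge
  refine summable_of_sum_le (c := C * t ^ (-(7 / 8) : ℝ) * (latticeConst * m₀) +
    C * (latticeConst * M) * (t ^ (1 - 7 / 8 : ℝ) / (1 - 7 / 8))) (fun _ => norm_nonneg _)
    fun S => ?_
  have e : ∀ k, integ μ u₀ f t k = heat μ t u₀ k + ∫ s in (0 : ℝ)..t, h k s := fun k => rfl
  calc ∑ k ∈ S, ‖integ μ u₀ f t k‖
      ≤ ∑ k ∈ S, (‖heat μ t u₀ k‖ + ∫ s in (0 : ℝ)..t, ‖h k s‖) := by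
        refine Finset.sum_le_sum fun k _ => ?_
        rw [e]
        exact (norm_add_le _ _).trans (add_le_add le_rfl
          (intervalIntegral.norm_integral_le_integral_norm ht.le))
    _ = ∑ k ∈ S, ‖heat μ t u₀ k‖ + ∫ s in (0 : ℝ)..t, ∑ k ∈ S, ‖h k s‖ := by
        rw [Finset.sum_add_distrib, intervalIntegral.integral_finsetSum]
        exact fun k _ => ((hcont k).norm).intervalIntegrable_of_Icc ht.le
    _ ≤ _ := by
        refine add_le_add (hsum t ht u₀ m₀ (Real.sqrt_nonneg _) hu₀ hm₀ S) ?_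
        have hbd : ∀ᵐ s, s ∈ Ioc (0 : ℝ) t →
            ‖∑ k ∈ S, ‖h k s‖‖ ≤ C * (latticeConst * M) * (t - s) ^ (-(7 / 8) : ℝ) := by
          filter_upwards [compl_mem_ae_iff.mpr (measure_singleton t)] with s hst hs
          have hs' : 0 < t - s := sub_pos.mpr (lt_of_le_of_ne hs.2 hst)
          have hsI : s ∈ Icc 0 t := ⟨hs.1.le, hs.2⟩
          rw [Real.norm_of_nonneg (Finset.sum_nonneg fun _ _ => norm_nonneg _)]
          refine (hsum (t - s) hs' (f s) M hM (hL s hsI) (hfM s hsI) S).trans (le_of_eq ?_)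
          ring
        refine (le_abs_self _).trans ?_
        rw [← Real.norm_eq_abs]
        refine (intervalIntegral.norm_integral_le_of_norm_le ht.le hbd
          ((integrable_sub_rpow (by norm_num)).const_mul _)).trans (le_of_eq ?_)
        rw [intervalIntegral.integral_const_mul, integral_sub_rpow (by norm_num)]

/-! ### Changing the integrating factor -/

/-- Variation of constants: the damping `-1` of the linear part may be moved to the right-hand
side. -/
lemma eq_of_damped {l y₀ : ℂ} {y h : ℝ → ℂ} {T : ℝ} (hhc : ContinuousOn h (Ioc 0 T))
    (hyc : ContinuousOn y (Ioc 0 T)) (hhi : IntervalIntegrable h volume 0 T)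
    (hyi : IntervalIntegrable y volume 0 T)
    (hy : ∀ t ∈ Ioc 0 T, y t = Complex.exp (-(t : ℂ) * (l + 1)) * y₀ +
      ∫ s in (0 : ℝ)..t, Complex.exp (-((t - s : ℝ) : ℂ) * (l + 1)) * (h s + y s)) :
    ∀ t ∈ Ioc 0 T, y t = Complex.exp (-(t : ℂ) * l) * y₀ +
      ∫ s in (0 : ℝ)..t, Complex.exp (-((t - s : ℝ) : ℂ) * l) * h s := by
  intro t ht
  set g : ℝ → ℂ := fun s => Complex.exp ((s : ℂ) * (l + 1)) * (h s + y s) with hg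
  have hT : 0 ≤ T := ht.1.le.trans ht.2
  have hgi : IntervalIntegrable g volume 0 T :=
    (hhi.add hyi).continuousOn_mul (Continuous.continuousOn (by fun_prop))
  have hgc : ContinuousOn g (Ioc 0 T) :=
    ContinuousOn.mul (Continuous.continuousOn (by fun_prop)) (hhc.add hyc)
  set m : ℝ → ℂ := fun s => y₀ + ∫ r in (0 : ℝ)..s, g r with hm
  have hym : ∀ s ∈ Ioc 0 T, y s = Complex.exp (-(s : ℂ) * (l + 1)) * m s := fun s hs => by
    have e : m s = y₀ + ∫ r in (0 : ℝ)..s, g r := rfl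
    rw [hy s hs, e, mul_add (Complex.exp (-(s : ℂ) * (l + 1))),
      ← intervalIntegral.integral_const_mul]
    congr 1
    refine intervalIntegral.integral_congr fun r _ => ?_
    simp only [hg]
    rw [← mul_assoc, ← Complex.exp_add]
    congr 2; push_cast; ring
  have hgi' : ∀ s ∈ Icc 0 T, IntervalIntegrable g volume 0 s := fun s hs =>
    hgi.mono_set (by
      rw [uIcc_of_le hs.1, uIcc_of_le hT]; exact Icc_subset_Icc_right hs.2)
  set Φ : ℝ → ℂ := fun s => Complex.exp (-(s : ℂ)) * m s with hΦ
  have hmc : ContinuousOn m (Icc 0 t) := by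
    refine continuousOn_const.add ?_
    have := intervalIntegral.continuousOn_primitive_interval (f := g) (μ := volume)
      (a := 0) (b := t)
      (by
        rw [uIcc_of_le ht.1.le]
        exact (intervalIntegrable_iff_integrableOn_Icc_of_le ht.1.le).mp (hgi' t ⟨ht.1.le, ht.2⟩))
    rwa [uIcc_of_le ht.1.le] at this
  have hΦc : ContinuousOn Φ (Icc 0 t) :=
    ContinuousOn.mul (Continuous.continuousOn (by fun_prop)) hmc
  have hΦd : ∀ s ∈ Ioo 0 t, HasDerivAt Φ (Complex.exp ((s : ℂ) * l) * h s) s := by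
    intro s hs
    have hsT : s ∈ Ioo 0 T := ⟨hs.1, hs.2.trans_le ht.2⟩
    have hgs : ContinuousAt g s := hgc.continuousAt (Ioc_mem_nhds hsT.1 hsT.2)
    have hmd : HasDerivAt m (g s) s :=
      (intervalIntegral.integral_hasDerivAt_right (hgi' s ⟨hsT.1.le, hsT.2.le⟩)
        ((hgc.mono Ioo_subset_Ioc_self).stronglyMeasurableAtFilter isOpen_Ioo s hsT)
        hgs).const_add y₀
    have hed : HasDerivAt (fun s : ℝ => Complex.exp (-(s : ℂ))) (Complex.exp (-(s : ℂ)) * -1) s :=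
      (((hasDerivAt_id s).ofReal_comp).neg).cexp
    refine (hed.mul hmd).congr_deriv ?_
    have h1 : Complex.exp (-(s : ℂ)) * m s = Complex.exp ((s : ℂ) * l) * y s := by
      rw [hym s ⟨hsT.1, hsT.2.le⟩, ← mul_assoc, ← Complex.exp_add]
      congr 2; ring
    have h2 : Complex.exp (-(s : ℂ)) * g s = Complex.exp ((s : ℂ) * l) * (h s + y s) := by
      rw [hg, ← mul_assoc, ← Complex.exp_add]
      congr 2; ring
    rw [h2, mul_right_comm, h1]
    ring
  have hti : IntervalIntegrable (fun s : ℝ => Complex.exp ((s : ℂ) * l) * h s) volume 0 t :=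
    (hhi.mono_set (by
      rw [uIcc_of_le ht.1.le, uIcc_of_le hT]; exact Icc_subset_Icc_right ht.2)).continuousOn_mul
      (Continuous.continuousOn (by fun_prop))
  have hftc := intervalIntegral.integral_eq_sub_of_hasDerivAt_of_le ht.1.le hΦc hΦd hti
  have e1 : ∫ s in (0 : ℝ)..t, Complex.exp (-((t - s : ℝ) : ℂ) * l) * h s =
      Complex.exp (-(t : ℂ) * l) * ∫ s in (0 : ℝ)..t, Complex.exp ((s : ℂ) * l) * h s := by
    rw [← intervalIntegral.integral_const_mul]
    refine intervalIntegral.integral_congr fun r _ => ?_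
    rw [← mul_assoc, ← Complex.exp_add]
    congr 2; push_cast; ring
  have e2 : Φ 0 = y₀ := by simp [hΦ, hm]
  rw [e1, hftc, e2, mul_sub, add_sub_cancel, hΦ, hym t ht, ← mul_assoc, ← Complex.exp_add]
  congr 2; ring

/-! ### Sup norm bounds at small times -/

namespace DyadicPartition

variable {P : DyadicPartition}

/-- A path in `E_T^η C^b` which is continuous in `C^{b - 2η}`, with `b - 2η > -2/3`, has an
integrable third power of the sup norm. -/
lemma exists_norm_toFun_le_rpow {T η b : ℝ} {u : ℝ → PerDist} (hη : 0 < η) (hb : 0 < b)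
    (hneg : b - 2 * η < 0) (hbη : -(2 / 3) < b - 2 * η) (hE : u ∈ P.spaceE T η b)
    (hC : u ∈ P.spaceC T (b - 2 * η)) :
    ∃ C r : ℝ, 0 ≤ C ∧ r < 1 / 3 ∧ ∀ t ∈ Ioc 0 T, ‖toFun (u t)‖ ≤ C * t ^ (-r) := by
  obtain ⟨A, hA, hA'⟩ := exists_bound_of_spaceC hC
  obtain ⟨-, B, hB⟩ := hE
  set a := b - 2 * η with ha
  obtain ⟨ε, hε0, hεb, hεa⟩ : ∃ ε, 0 < ε ∧ ε ≤ b ∧ ε < a + 2 / 3 :=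
    ⟨min b ((a + 2 / 3) / 2), lt_min hb (by linarith), min_le_left _ _,
      (min_le_right _ _).trans_lt (by linarith)⟩
  -- at `θ` the interpolated regularity is `ε`
  set θ := (ε - a) / (2 * η) with hθ
  have hθη : θ * (2 * η) = ε - a := by rw [hθ]; field_simp
  have hθ0 : 0 ≤ θ := div_nonneg (by linarith) (by linarith)
  have hθ1 : θ ≤ 1 := by rw [hθ, div_le_one (by linarith)]; linarith
  have he : (1 - θ) * a + θ * b = ε := by
    have : b = a + 2 * η := by rw [ha]; ring
    rw [this]; linarith
  refine ⟨A ^ (1 - θ) * max B 0 ^ θ * geomConst ε, η * θ, ?_, by linarith, fun t ht => ?_⟩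
  · have := geomConst_nonneg ε
    positivity
  have hη' : 0 < t ^ η := Real.rpow_pos_of_pos ht.1 _
  have hBt : P.besovNorm b (u t) ≤ ENNReal.ofReal (max B 0 * t ^ (-η)) := by
    have h1 := (hB t ht).trans (ENNReal.ofReal_le_ofReal (le_max_left B 0))
    rw [mul_comm, ← ENNReal.le_div_iff_mul_le (Or.inl (by simpa using hη'))
      (Or.inl ENNReal.ofReal_ne_top), ← ENNReal.ofReal_div_of_pos hη'] at h1
    rwa [Real.rpow_neg ht.1.le, ← div_eq_mul_inv]
  have hB0 : 0 ≤ max B 0 := le_max_right _ _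
  have ht0 := ht.1.le
  have h2 := besovNorm_interpolate hA (by positivity : 0 ≤ max B 0 * t ^ (-η)) hθ0 hθ1
    (hA' t ⟨ht.1.le, ht.2⟩) hBt
  rw [he] at h2
  refine (isCont_of_besovNorm_le hε0 (by positivity) h2).2.trans (le_of_eq ?_)
  rw [Real.mul_rpow hB0 (by positivity), ← Real.rpow_mul ht0, neg_mul]
  ring

end DyadicPartition

/-! ### Bilinear multipliers of continuous functions -/

lemma norm_bilin_ofFun_le {σ : (Fin 3 → ℤ) → (Fin 3 → ℤ) → ℝ} (hσ : IsSymbol σ) (k : Fin 3 → ℤ)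
    (F G : C(T3, ℂ)) : ‖bilin σ (ofFun F) (ofFun G) k‖ ≤ ‖F‖ * ‖G‖ := by
  refine (hσ.norm_bilin_le (L2_ofFun F) (L2_ofFun G) k).trans ?_
  refine mul_le_mul ?_ ?_ (Real.sqrt_nonneg _) (norm_nonneg _)
  · rw [Real.sqrt_le_left (norm_nonneg _)]; exact (sum_sq_ofFun_le F).2
  · rw [Real.sqrt_le_left (norm_nonneg _)]; exact (sum_sq_ofFun_le G).2

lemma isBoundedBilinearMap_bilin_ofFun {σ : (Fin 3 → ℤ) → (Fin 3 → ℤ) → ℝ} (hσ : IsSymbol σ)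
    (k : Fin 3 → ℤ) :
    IsBoundedBilinearMap ℂ fun p : C(T3, ℂ) × C(T3, ℂ) => bilin σ (ofFun p.1) (ofFun p.2) k where
  add_left F F' G := by
    rw [ofFun_add, hσ.bilin_add_left (L2_ofFun _) (L2_ofFun _) (L2_ofFun _)]; rfl
  smul_left c F G := by rw [ofFun_smul, bilin_smul_left]; rfl
  add_right F G G' := by
    rw [ofFun_add, hσ.bilin_add_right (L2_ofFun _) (L2_ofFun _) (L2_ofFun _)]; rfl
  smul_right c F G := by rw [ofFun_smul, bilin_smul_right]; rfl
  bound := ⟨1, one_pos, fun F G => by rw [one_mul]; exact norm_bilin_ofFun_le hσ k F G⟩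

/-! ### From the paracontrolled system to the mild equation -/

/-- One Fourier coefficient of the passage from the four integral equations for `Z`, `W`, `v`, `w`
to the mild equation for `y = Z - νW + v + w`. The hypothesis `hsum` says that the right-hand sides
add up to the nonlinearity `N` plus the term `y` that compensates the damping. -/
lemma mild_of_integral_equations {l ν z₀ a₀ v₀ w₀ : ℂ} {ξ q F G N z a v w y : ℝ → ℂ} {T : ℝ}
    (hξ : ContinuousOn ξ (Icc 0 T)) (hq : ContinuousOn q (Icc 0 T))
    (hF : IntervalIntegrable F volume 0 T)
    (hNc : ContinuousOn N (Ioc 0 T)) (hN : IntervalIntegrable N volume 0 T)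
    (hyc : ContinuousOn y (Ioc 0 T)) (hyi : IntervalIntegrable y volume 0 T)
    (hsum : ∀ s ∈ Ioc 0 T, -ν * q s + F s + G s = N s + y s)
    (hy : ∀ s, y s = z s - ν * a s + v s + w s)
    (hz : ∀ t ∈ Icc 0 T, z t = Complex.exp (-(t : ℂ) * (l + 1)) * z₀ +
      ∫ s in (0 : ℝ)..t, Complex.exp (-((t - s : ℝ) : ℂ) * (l + 1)) * ξ s)
    (ha : ∀ t ∈ Icc 0 T, a t = Complex.exp (-(t : ℂ) * (l + 1)) * a₀ +
      ∫ s in (0 : ℝ)..t, Complex.exp (-((t - s : ℝ) : ℂ) * (l + 1)) * q s)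
    (hv : ∀ t ∈ Icc 0 T, v t = Complex.exp (-(t : ℂ) * (l + 1)) * v₀ +
      ∫ s in (0 : ℝ)..t, Complex.exp (-((t - s : ℝ) : ℂ) * (l + 1)) * F s)
    (hw : ∀ t ∈ Icc 0 T, w t = Complex.exp (-(t : ℂ) * (l + 1)) * w₀ +
      ∫ s in (0 : ℝ)..t, Complex.exp (-((t - s : ℝ) : ℂ) * (l + 1)) * G s) :
    ∀ t ∈ Icc 0 T,
      IntervalIntegrable (fun s => Complex.exp (-((t - s : ℝ) : ℂ) * l) * (N s + ξ s)) volume 0 t ∧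
      y t = Complex.exp (-(t : ℂ) * l) * (z₀ - ν * a₀ + v₀ + w₀) +
        ∫ s in (0 : ℝ)..t, Complex.exp (-((t - s : ℝ) : ℂ) * l) * (N s + ξ s) := by
  intro t ht
  have hT : 0 ≤ T := ht.1.trans ht.2
  have hsub : ∀ {t : ℝ}, t ∈ Icc 0 T → ∀ {g : ℝ → ℂ}, IntervalIntegrable g volume 0 T →
      IntervalIntegrable g volume 0 t := fun {t} ht {g} hg => hg.mono_set (by
    rw [uIcc_of_le ht.1, uIcc_of_le hT]; exact Icc_subset_Icc_right ht.2)
  have hker : ∀ (t : ℝ) (c : ℂ) {g : ℝ → ℂ}, IntervalIntegrable g volume 0 t →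
      IntervalIntegrable (fun s => Complex.exp (-((t - s : ℝ) : ℂ) * c) * g s) volume 0 t :=
    fun t c {g} hg => hg.continuousOn_mul (Continuous.continuousOn (by fun_prop))
  have hξi : IntervalIntegrable ξ volume 0 T := hξ.intervalIntegrable_of_Icc hT
  have hqi : IntervalIntegrable q volume 0 T := hq.intervalIntegrable_of_Icc hT
  -- `G` is integrable since `hsum` expresses it in terms of the other functions
  have hGi : IntervalIntegrable G volume 0 T := by
    refine (((hN.add hyi).add (hqi.const_mul ν)).sub hF).congr fun s hs => ?_
    rw [uIoc_of_le hT] at hs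
    show N s + y s + ν * q s - F s = G s
    rw [← hsum s hs]; ring
  refine ⟨hker t l ((hsub ht hN).add (hsub ht hξi)), ?_⟩
  rcases ht.1.eq_or_lt with h0 | h0
  · subst h0
    rw [hy, hz 0 ht, ha 0 ht, hv 0 ht, hw 0 ht]
    simp
  refine eq_of_damped (h := fun s => N s + ξ s) (hNc.add (hξ.mono Ioc_subset_Icc_self)) hyc
    (hN.add hξi) hyi (fun t ht => ?_) t ⟨h0, ht.2⟩
  have ht' : t ∈ Icc 0 T := ⟨ht.1.le, ht.2⟩
  have e : ∫ s in (0 : ℝ)..t, Complex.exp (-((t - s : ℝ) : ℂ) * (l + 1)) * (N s + ξ s + y s) =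
      ∫ s in (0 : ℝ)..t, (Complex.exp (-((t - s : ℝ) : ℂ) * (l + 1)) * ξ s
        - ν * (Complex.exp (-((t - s : ℝ) : ℂ) * (l + 1)) * q s)
        + Complex.exp (-((t - s : ℝ) : ℂ) * (l + 1)) * F s
        + Complex.exp (-((t - s : ℝ) : ℂ) * (l + 1)) * G s) := by
    refine intervalIntegral.integral_congr_ae (ae_of_all _ fun s hs => ?_)
    rw [uIoc_of_le ht.1.le] at hs
    have h := hsum s ⟨hs.1, hs.2.trans ht.2⟩
    have h' : N s + ξ s + y s = ξ s - ν * q s + F s + G s := by linear_combination -h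
    rw [h']; ring
  have i1 := hker t (l + 1) (hsub ht' hξi)
  have i2 := (hker t (l + 1) (hsub ht' hqi)).const_mul ν
  have i3 := hker t (l + 1) (hsub ht' hF)
  have i4 := hker t (l + 1) (hsub ht' hGi)
  rw [e, intervalIntegral.integral_add ((i1.sub i2).add i3) i4,
    intervalIntegral.integral_add (i1.sub i2) i3, intervalIntegral.integral_sub i1 i2,
    intervalIntegral.integral_const_mul, hy, hz t ht', ha t ht', hv t ht', hw t ht']
  ring

/-- `t ^ (-r)` is in `L³` near `0` when `r < 1/3`. -/
lemma integrableOn_norm_cube {T M C₁ r₁ C₂ r₂ : ℝ} {U : ℝ → C(T3, ℂ)}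
    (hU : ContinuousOn U (Ioc 0 T)) (hM : 0 ≤ M) (hC₁ : 0 ≤ C₁) (hC₂ : 0 ≤ C₂)
    (hr₁ : r₁ < 1 / 3) (hr₂ : r₂ < 1 / 3)
    (h : ∀ t ∈ Ioc 0 T, ‖U t‖ ≤ M + C₁ * t ^ (-r₁) + C₂ * t ^ (-r₂)) :
    IntegrableOn (fun t => ‖U t‖ ^ 3) (Ioc 0 T) := by
  have hpow : ∀ r : ℝ, r < 1 / 3 → IntegrableOn (fun t : ℝ => t ^ (-r * 3)) (Ioc 0 T) := by
    intro r hr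
    exact (intervalIntegral.intervalIntegrable_rpow' (a := 0) (b := T) (by linarith)).1
  have hb : IntegrableOn (fun t : ℝ => 4 * (4 * (M ^ 3 + C₁ ^ 3 * t ^ (-r₁ * 3)) +
      C₂ ^ 3 * t ^ (-r₂ * 3))) (Ioc 0 T) :=
    (((integrableOn_const (by simp)).add ((hpow r₁ hr₁).const_mul _)).const_mul 4 |>.add
      ((hpow r₂ hr₂).const_mul _)).const_mul 4
  refine Integrable.mono' hb ((hU.norm.pow 3).aestronglyMeasurable measurableSet_Ioc) ?_
  refine (ae_restrict_iff' measurableSet_Ioc).mpr (ae_of_all _ fun t ht => ?_)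
  have h1 : 0 ≤ t ^ (-r₁) := Real.rpow_nonneg ht.1.le _
  have h2 : 0 ≤ t ^ (-r₂) := Real.rpow_nonneg ht.1.le _
  have e1 : (t ^ (-r₁)) ^ 3 = t ^ (-r₁ * 3) := by
    rw [← Real.rpow_natCast _ 3, ← Real.rpow_mul ht.1.le]; norm_num
  have e2 : (t ^ (-r₂)) ^ 3 = t ^ (-r₂ * 3) := by
    rw [← Real.rpow_natCast _ 3, ← Real.rpow_mul ht.1.le]; norm_num
  rw [Real.norm_of_nonneg (by positivity), ← e1, ← e2, ← mul_pow, ← mul_pow]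
  refine (pow_le_pow_left₀ (norm_nonneg _) (h t ht) 3).trans ?_
  have hA := add_pow_le (a := M + C₁ * t ^ (-r₁)) (b := C₂ * t ^ (-r₂)) (by positivity)
    (by positivity) 3
  have hB := add_pow_le (a := M) (b := C₁ * t ^ (-r₁)) hM (by positivity) 3
  norm_num at hA hB
  linarith

/-- A function of time dominated by the cube of the sup norm of `U`. -/
lemma intervalIntegrable_of_le_cube {T K : ℝ} (hT : 0 ≤ T) {U : ℝ → C(T3, ℂ)}
    (hU : IntegrableOn (fun t => ‖U t‖ ^ 3) (Ioc 0 T)) {g : ℝ → ℂ} (hg : ContinuousOn g (Ioc 0 T))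
    (h : ∀ t ∈ Ioc 0 T, ‖g t‖ ≤ K * (1 + ‖U t‖ ^ 3)) : IntervalIntegrable g volume 0 T := by
  rw [intervalIntegrable_iff_integrableOn_Ioc_of_le hT]
  refine Integrable.mono' (((integrableOn_const (C := (1 : ℝ)) (by simp)).add hU).const_mul K)
    (hg.aestronglyMeasurable measurableSet_Ioc) ?_
  exact (ae_restrict_iff' measurableSet_Ioc).mpr (ae_of_all _ fun t ht => h t ht)

lemma norm_star_continuousMap (F : C(T3, ℂ)) : ‖star F‖ = ‖F‖ := by
  have h : ∀ G : C(T3, ℂ), ‖star G‖ ≤ ‖G‖ := fun G =>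
    (ContinuousMap.norm_le _ (norm_nonneg _)).mpr fun x => by
      rw [ContinuousMap.star_apply, norm_star]; exact G.norm_coe_le_norm x
  refine (h F).antisymm ?_
  simpa only [star_star] using h (star F)

lemma le_one_add_cube {x : ℝ} (hx : 0 ≤ x) : x ≤ 1 + x ^ 3 := by
  nlinarith [mul_nonneg hx (sq_nonneg (x - 1)), sq_nonneg (x - 1)]

lemma norm_nonlin_le (ν c : ℂ) (U : C(T3, ℂ)) :
    ‖nonlin ν c U‖ ≤ (2 * ‖ν‖ + ‖ν * c‖) * (1 + ‖U‖ ^ 3) := by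
  have h0 := norm_nonneg U
  have h1 := le_one_add_cube h0
  have h2 : ‖U * U * star U‖ ≤ ‖U‖ ^ 3 := by
    refine (norm_mul_le _ _).trans ?_
    rw [norm_star_continuousMap, pow_succ, pow_two]
    exact mul_le_mul_of_nonneg_right (norm_mul_le _ _) h0
  have h3 : ‖U - U * U * star U‖ ≤ 2 * (1 + ‖U‖ ^ 3) := by
    refine (norm_sub_le _ _).trans ?_
    linarith
  have h4 : ‖nonlin ν c U‖ ≤ ‖ν‖ * ‖U - U * U * star U‖ + ‖ν * c‖ * ‖U‖ := by
    refine (norm_add_le _ _).trans ?_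
    rw [norm_smul, norm_smul]
  have h5 := mul_le_mul_of_nonneg_left h3 (norm_nonneg ν)
  have h6 := mul_le_mul_of_nonneg_left h1 (norm_nonneg (ν * c))
  linarith

lemma continuous_nonlin (ν c : ℂ) : Continuous (nonlin ν c) := by
  unfold nonlin; fun_prop

/-- At positive times, the integration map sends continuous functions of space and time to the
Wiener algebra. -/
lemma wiener_integ_ofFun {μ T t : ℝ} (hμ : 0 < μ) (ht : t ∈ Ioc 0 T) {u₀ : PerDist} (hu₀ : L2 u₀)
    {f : ℝ → PerDist} {F : ℝ → C(T3, ℂ)} (hF : ContinuousOn F (Icc 0 T))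
    (hf : ∀ s ∈ Icc 0 T, f s = ofFun (F s)) : Wiener (integ μ u₀ f t) := by
  obtain ⟨M, hM⟩ := isCompact_Icc.exists_bound_of_continuousOn hF
  have hsub : ∀ s ∈ Icc 0 t, s ∈ Icc 0 T := fun s hs => ⟨hs.1, hs.2.trans ht.2⟩
  have hM0 : 0 ≤ M := (norm_nonneg _).trans (hM t ⟨ht.1.le, ht.2⟩)
  refine wiener_integ hμ ht.1 hM0 hu₀ (fun k => ?_) (fun s hs => ?_) fun s hs => ?_
  · refine ContinuousOn.congr (f := fun s => coeffL k (F s)) ?_ fun s hs => by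
      rw [hf s (hsub s hs)]; rfl
    exact (coeffL k).continuous.comp_continuousOn (hF.mono hsub)
  · rw [hf s (hsub s hs)]; exact L2_ofFun _
  · rw [hf s (hsub s hs)]
    exact (sum_sq_ofFun_le (F s)).2.trans
      (pow_le_pow_left₀ (norm_nonneg _) (hM s (hsub s hs)) 2)

namespace DyadicPartition

/-- The map `F` on continuous functions, with `p = -νW + v + w`. -/
lemma mapF_driverOf (P : DyadicPartition) (ν c₁ c₂₁ c₂₂ : ℂ) (Z W V Y : C(T3, ℂ)) (a b : PerDist)
    (k : Fin 3 → ℤ) :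
    P.mapF ν (driverOf P c₁ c₂₁ c₂₂ (ofFun Z) a b (ofFun W)) (ofFun V) (ofFun Y) k =
      -ν * (2 * bilin (P.sym lowSet) (ofFun (-(ν • W) + V + Y : C(T3, ℂ)))
          (ofFun (Z * star Z - ContinuousMap.const T3 c₁ : C(T3, ℂ))) k +
        bilin (P.sym lowSet) (ofFun (star (-(ν • W) + V + Y) : C(T3, ℂ)))
          (ofFun (Z * Z : C(T3, ℂ))) k) := by
  have h1 : -(ν • ofFun W) + ofFun V + ofFun Y = ofFun (-(ν • W) + V + Y : C(T3, ℂ)) := by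
    rw [ofFun_add, ofFun_add, ofFun_neg, ofFun_smul]
  have h2 : -(star ν • bar (ofFun W)) + bar (ofFun V) + bar (ofFun Y) =
      ofFun (star (-(ν • W) + V + Y) : C(T3, ℂ)) := by
    rw [ofFun_star, ← h1, bar_add, bar_add, bar_neg, bar_smul]
  have h3 : tableZZb c₁ (ofFun Z) = ofFun (Z * star Z - ContinuousMap.const T3 c₁ : C(T3, ℂ)) := by
    rw [tableZZb, ← ofFun_star, fnMul_ofFun, const_eq_ofFun, ofFun_sub]
  have e : P.mapF ν (driverOf P c₁ c₂₁ c₂₂ (ofFun Z) a b (ofFun W)) (ofFun V) (ofFun Y) =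
      (-ν) • ((2 : ℂ) • P.para (-(ν • ofFun W) + ofFun V + ofFun Y) (tableZZb c₁ (ofFun Z))
        + P.para (-(star ν • bar (ofFun W)) + bar (ofFun V) + bar (ofFun Y))
          (fnMul (ofFun Z) (ofFun Z))) := rfl
  rw [e, h1, h2, h3, fnMul_ofFun, para_eq_bilin (L2_ofFun _) (L2_ofFun _),
    para_eq_bilin (L2_ofFun _) (L2_ofFun _)]
  rfl

lemma norm_mapF_driverOf_le (P : DyadicPartition) (ν c₁ c₂₁ c₂₂ : ℂ) (Z W V Y : C(T3, ℂ))
    (a b : PerDist) (k : Fin 3 → ℤ) {M : ℝ} (hM : ‖Z‖ ≤ M) :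
    ‖P.mapF ν (driverOf P c₁ c₂₁ c₂₂ (ofFun Z) a b (ofFun W)) (ofFun V) (ofFun Y) k‖ ≤
      ‖ν‖ * (3 * M ^ 2 + 2 * ‖c₁‖) * (1 + M) * (1 + ‖Z - ν • W + V + Y‖ ^ 3) := by
  have hM0 : 0 ≤ M := (norm_nonneg _).trans hM
  set U := Z - ν • W + V + Y with hU
  set p := -(ν • W) + V + Y with hp
  have hpU : p = U - Z := by rw [hp, hU]; abel
  have hpn : ‖p‖ ≤ (1 + M) * (1 + ‖U‖ ^ 3) := by
    have h1 : ‖p‖ ≤ ‖U‖ + M := by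
      rw [hpU]; exact (norm_sub_le _ _).trans (add_le_add le_rfl hM)
    have h2 := le_one_add_cube (norm_nonneg U)
    have h3 : 0 ≤ ‖U‖ ^ 3 := by positivity
    nlinarith [mul_nonneg hM0 h3]
  have hZZ : ‖Z * Z‖ ≤ M ^ 2 := by
    rw [sq]; exact (norm_mul_le _ _).trans (mul_le_mul hM hM (norm_nonneg _) hM0)
  have hZb : ‖Z * star Z - ContinuousMap.const T3 c₁‖ ≤ M ^ 2 + ‖c₁‖ := by
    refine (norm_sub_le _ _).trans (add_le_add ?_ ?_)
    · rw [sq]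
      refine (norm_mul_le _ _).trans (mul_le_mul hM ?_ (norm_nonneg _) hM0)
      rwa [norm_star_continuousMap]
    · exact (ContinuousMap.norm_le _ (norm_nonneg _)).mpr fun x => le_rfl
  have b1 := norm_bilin_ofFun_le (P.isSymbol_sym lowSet) k p
    (Z * star Z - ContinuousMap.const T3 c₁)
  have b2 := norm_bilin_ofFun_le (P.isSymbol_sym lowSet) k (star p) (Z * Z)
  rw [norm_star_continuousMap] at b2
  rw [mapF_driverOf, norm_mul, norm_neg, mul_assoc, mul_assoc]
  refine mul_le_mul_of_nonneg_left ?_ (norm_nonneg ν)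
  refine (norm_add_le _ _).trans ?_
  rw [norm_mul, Complex.norm_ofNat]
  have c1 : ‖p‖ * ‖Z * star Z - ContinuousMap.const T3 c₁‖ ≤ ‖p‖ * (M ^ 2 + ‖c₁‖) :=
    mul_le_mul_of_nonneg_left hZb (norm_nonneg _)
  have c2 : ‖p‖ * ‖Z * Z‖ ≤ ‖p‖ * M ^ 2 := mul_le_mul_of_nonneg_left hZZ (norm_nonneg _)
  have c3 := mul_le_mul_of_nonneg_left hpn (by positivity : 0 ≤ 3 * M ^ 2 + 2 * ‖c₁‖)
  linarith

lemma continuousOn_mapF_driverOf (P : DyadicPartition) (ν c₁ c₂₁ c₂₂ : ℂ) {S : Set ℝ}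
    {Z W V Y : ℝ → C(T3, ℂ)} (a b : ℝ → PerDist) (hZ : ContinuousOn Z S) (hW : ContinuousOn W S)
    (hV : ContinuousOn V S) (hY : ContinuousOn Y S) (k : Fin 3 → ℤ) :
    ContinuousOn (fun s => P.mapF ν (driverOf P c₁ c₂₁ c₂₂ (ofFun (Z s)) (a s) (b s) (ofFun (W s)))
      (ofFun (V s)) (ofFun (Y s)) k) S := by
  have hp : ContinuousOn (fun s => -(ν • W s) + V s + Y s) S :=
    ((hW.const_smul ν).neg.add hV).add hY
  have hp' : ContinuousOn (fun s => star (-(ν • W s) + V s + Y s)) S := hp.star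
  have hB : ContinuousOn (fun s => Z s * star (Z s) - ContinuousMap.const T3 c₁) S :=
    (hZ.mul hZ.star).sub continuousOn_const
  have hA : ContinuousOn (fun s => Z s * Z s) S := hZ.mul hZ
  have hbil := (isBoundedBilinearMap_bilin_ofFun (P.isSymbol_sym lowSet) k).continuous
  have h1 := hbil.comp_continuousOn (hp.prodMk hB)
  have h2 := hbil.comp_continuousOn (hp'.prodMk hA)
  simp only [mapF_driverOf]
  exact continuousOn_const.mul ((continuousOn_const.mul h1).add h2)

end DyadicPartition

/-- The mild equation, for a driving vector and a solution whose components are continuous functions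
with enough regularity. -/
theorem isMildSolution_of_continuousOn (P : DyadicPartition) {μ T : ℝ} {ν c₁ c₂₁ c₂₂ c : ℂ}
    (hc : c = 2 * (c₁ - star ν * star c₂₁ - 2 * ν * c₂₂)) (hT : 0 ≤ T)
    {ξ : ℝ → PerDist} (hξ : ∀ k, ContinuousOn (fun s => ξ s k) (Icc 0 T))
    {Z W V Y : ℝ → C(T3, ℂ)} (hZ : ContinuousOn Z (Icc 0 T)) (hW : ContinuousOn W (Icc 0 T))
    (hV : ContinuousOn V (Ioc 0 T)) (hY : ContinuousOn Y (Ioc 0 T))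
    (hU : IntegrableOn (fun t => ‖Z t - ν • W t + V t + Y t‖ ^ 3) (Ioc 0 T))
    {X : ℝ → Driver} {a b : ℝ → PerDist}
    (hX : ∀ t ∈ Icc 0 T,
      X t = driverOf P c₁ c₂₁ c₂₂ (ofFun (Z t)) (a t) (b t) (ofFun (W t)))
    (hwW : ∀ t ∈ Ioc 0 T, Wiener (ofFun (W t))) (hwa : ∀ t ∈ Ioc 0 T, Wiener (a t))
    (hwb : ∀ t ∈ Ioc 0 T, Wiener (b t)) {v w : ℝ → PerDist}
    (hv : ∀ t ∈ Ioc 0 T, v t = ofFun (V t)) (hw : ∀ t ∈ Ioc 0 T, w t = ofFun (Y t))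
    {Z₀ W₀ v₀ w₀ : PerDist} (heqZ : ∀ t ∈ Icc 0 T, (X t).Z = integ μ Z₀ ξ t)
    (heqW : ∀ t ∈ Icc 0 T, (X t).W = integ μ W₀ (fun s => tableZZZb c₁ (X s).Z) t)
    (heqv : ∀ t ∈ Icc 0 T, v t = P.mapM₁ μ ν X v₀ v w t)
    (heqw : ∀ t ∈ Icc 0 T, w t = P.mapM₂ μ ν X v₀ w₀ v w t) :
    IsMildSolution μ ν c ξ T (Z₀ - ν • W₀ + v₀ + w₀)
      (fun t => (X t).Z - ν • (X t).W + v t + w t) := by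
  have hIoc : ∀ t ∈ Ioc 0 T, t ∈ Icc 0 T := fun t ht => Ioc_subset_Icc_self ht
  have hXZ : ∀ t ∈ Icc 0 T, (X t).Z = ofFun (Z t) := fun t ht => by rw [hX t ht]; rfl
  have hXW : ∀ t ∈ Icc 0 T, (X t).W = ofFun (W t) := fun t ht => by rw [hX t ht]; rfl
  obtain ⟨U, hU'⟩ : ∃ U : ℝ → C(T3, ℂ), U = fun t => Z t - ν • W t + V t + Y t := ⟨_, rfl⟩
  have hUt : ∀ t, Z t - ν • W t + V t + Y t = U t := fun t => by rw [hU']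
  simp only [hUt] at hU
  have hUc : ContinuousOn U (Ioc 0 T) := by
    rw [hU']
    exact (((hZ.mono hIoc).sub ((hW.mono hIoc).const_smul ν)).add hV).add hY
  have hUeq : ∀ t ∈ Ioc 0 T, ofFun (U t) = (X t).Z - ν • (X t).W + v t + w t := fun t ht => by
    rw [← hUt, hXZ t (hIoc t ht), hXW t (hIoc t ht), hv t ht, hw t ht, ofFun_add, ofFun_add,
      ofFun_sub, ofFun_smul]
  have hsum : ∀ s ∈ Ioc 0 T, (-ν) • tableZZZb c₁ (X s).Z + P.mapF ν (X s) (v s) (w s)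
      + P.mapG ν (X s) (P.mapM₁ μ ν X v₀ v w s) (v s) (w s) =
      ofFun (nonlin ν c (U s)) + ofFun (U s) := fun s hs => by
    have h := P.mapF_add_mapG ν c₁ c₂₁ c₂₂ (Z s) (W s) (V s) (Y s) (a s) (b s) (hwW s hs)
      (hwa s hs) (hwb s hs)
    rw [← hX s (hIoc s hs), ← hXZ s (hIoc s hs), ← hv s hs, ← hw s hs, ← hc, hUt] at h
    rw [← heqv s (hIoc s hs), h]
  refine ⟨U, hUeq, hUc, hU, fun t ht k => ?_⟩
  have hfun : ∀ s, (fun x => ν * (1 - (‖U s x‖ : ℂ) ^ 2) * U s x + ν * c * U s x) =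
      nonlin ν c (U s) := fun s => funext fun x => (nonlin_apply ν c (U s) x).symm
  simp only [hfun]
  have hcoeff : ∀ {S : Set ℝ} {H : ℝ → C(T3, ℂ)}, ContinuousOn H S →
      ContinuousOn (fun s => ofFun (H s) k) S := fun hH =>
    (coeffL k).continuous.comp_continuousOn hH
  have hq : ContinuousOn (fun s => tableZZZb c₁ (X s).Z k) (Icc 0 T) :=
    (hcoeff (((hZ.mul hZ).mul hZ.star).sub (hZ.const_smul (2 * c₁)))).congr fun s hs => by
      simp only
      rw [hXZ s hs, tableZZZb, ← ofFun_star, fnMul_ofFun, fnMul_ofFun, ← ofFun_smul, ← ofFun_sub]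
      rfl
  have hyc : ContinuousOn (fun s => ((X s).Z - ν • (X s).W + v s + w s) k) (Ioc 0 T) :=
    (hcoeff hUc).congr fun s hs => by rw [← hUeq s hs]
  have hNc : ContinuousOn (fun s => ofFun (nonlin ν c (U s)) k) (Ioc 0 T) :=
    hcoeff ((continuous_nonlin ν c).comp_continuousOn hUc)
  have hFeq : ∀ s ∈ Ioc 0 T, P.mapF ν (X s) (v s) (w s) k =
      P.mapF ν (driverOf P c₁ c₂₁ c₂₂ (ofFun (Z s)) (a s) (b s) (ofFun (W s))) (ofFun (V s))
        (ofFun (Y s)) k := fun s hs => by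
    rw [← hX s (hIoc s hs), ← hv s hs, ← hw s hs]
  have hFc : ContinuousOn (fun s => P.mapF ν (X s) (v s) (w s) k) (Ioc 0 T) :=
    (P.continuousOn_mapF_driverOf ν c₁ c₂₁ c₂₂ a b (hZ.mono hIoc) (hW.mono hIoc) hV hY k).congr
      hFeq
  obtain ⟨M, hM⟩ := isCompact_Icc.exists_bound_of_continuousOn hZ
  have hFi : IntervalIntegrable (fun s => P.mapF ν (X s) (v s) (w s) k) volume 0 T :=
    intervalIntegrable_of_le_cube hT hU hFc fun s hs => by
      rw [hFeq s hs, ← hUt]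
      exact P.norm_mapF_driverOf_le ν c₁ c₂₁ c₂₂ (Z s) (W s) (V s) (Y s) (a s) (b s) k
        (hM s (hIoc s hs))
  have hNi : IntervalIntegrable (fun s => ofFun (nonlin ν c (U s)) k) volume 0 T :=
    intervalIntegrable_of_le_cube hT hU hNc fun s hs =>
      (norm_ofFun_le _ k).trans (norm_nonlin_le ν c (U s))
  have hyi : IntervalIntegrable (fun s => ((X s).Z - ν • (X s).W + v s + w s) k) volume 0 T :=
    intervalIntegrable_of_le_cube (K := 1) hT hU hyc fun s hs => by
      rw [← hUeq s hs, one_mul]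
      exact (norm_ofFun_le _ k).trans (le_one_add_cube (norm_nonneg _))
  refine mild_of_integral_equations (l := symbol μ k) (ν := ν) (T := T) (z₀ := Z₀ k)
    (a₀ := W₀ k) (v₀ := v₀ k) (w₀ := w₀ k) (ξ := fun s => ξ s k)
    (q := fun s => tableZZZb c₁ (X s).Z k) (F := fun s => P.mapF ν (X s) (v s) (w s) k)
    (G := fun s => P.mapG ν (X s) (P.mapM₁ μ ν X v₀ v w s) (v s) (w s) k)
    (N := fun s => ofFun (nonlin ν c (U s)) k) (z := fun s => (X s).Z k)
    (a := fun s => (X s).W k) (v := fun s => v s k) (w := fun s => w s k)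
    (y := fun s => ((X s).Z - ν • (X s).W + v s + w s) k)
    (hξ k) hq hFi hNc hNi hyc hyi (fun s hs => ?_) (fun s => rfl)
    (fun t ht => congrFun (heqZ t ht) k) (fun t ht => congrFun (heqW t ht) k)
    (fun t ht => congrFun (heqv t ht) k) (fun t ht => congrFun (heqw t ht) k) t ht
  have h := congrFun (hsum s hs) k
  rw [hUeq s hs] at h
  exact h

end CGL

end

open CGL in
theorem mainTheorem8 (P : CGL.DyadicPartition) (μ : ℝ) (hμ : 0 < μ) (ν c₁ c₂₁ c₂₂ : ℂ)
    (κ κ' : ℝ) (hκ : 0 < κ) (hκκ' : κ < κ') (hκ' : κ' < 1 / 18)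
    (T : ℝ) (hT : 0 < T) (β : ℝ) (hβ : -2 < β)
    (ξ : ℝ → CGL.PerDist) (hξ : ξ ∈ P.spaceC T β)
    (Z₀ IZZ₀ IZZb₀ W₀ : CGL.PerDist)
    (hZ₀ : Z₀ ∈ P.besov (β + 2)) (hIZZ₀ : IZZ₀ ∈ P.besov (β + 2))
    (hIZZb₀ : IZZb₀ ∈ P.besov (β + 2)) (hW₀ : W₀ ∈ P.besov (β + 2))
    (X : ℝ → CGL.Driver)
    (hX : X = CGL.tableDriver P μ c₁ c₂₁ c₂₂ ξ Z₀ IZZ₀ IZZb₀ W₀)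
    (hXmem : CGL.IsDrivingVector P μ T κ X)
    (v₀ w₀ : CGL.PerDist)
    (hv₀ : v₀ ∈ P.besov (-2 / 3 + κ')) (hw₀ : w₀ ∈ P.besov (-1 / 2 - 2 * κ))
    (v w : ℝ → CGL.PerDist)
    (hvw : CGL.IsParacontrolledSolution P μ ν T κ κ' X v₀ w₀ v w) :
    CGL.IsMildSolution μ ν (2 * (c₁ - star ν * star c₂₁ - 2 * ν * c₂₂)) ξ T
      (Z₀ - ν • W₀ + v₀ + w₀)
      (fun t => (X t).Z - ν • (X t).W + v t + w t) := by
  have hβ' : 0 < β + 2 := by linarith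
  have L2_of_mem : ∀ f ∈ P.besov (β + 2), L2 f := fun f hf => by
    rw [← ofFun_toFun (DyadicPartition.isCont_of_mem_besov hβ' hf)]; exact L2_ofFun _
  have hT0 := hT.le
  -- `Z` and `W` are continuous functions of space and time, up to time `0`
  obtain ⟨z, hz⟩ : ∃ z, z = tableZ μ ξ Z₀ := ⟨_, rfl⟩
  obtain ⟨ε, hε, A, hA, hzA⟩ := P.exists_besovNorm_integ_le hμ hβ hξ hZ₀
  have hzX : ∀ t, (X t).Z = z t := fun t => by rw [hX, hz]; rfl
  have hzC : P.ContOn (Icc 0 T) (-1 / 2 - κ) z := by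
    have := hXmem.Z; simp only [hzX] at this; exact this
  have hzA' : ∀ t ∈ Icc 0 T, P.besovNorm ε (z t) ≤ ENNReal.ofReal A := fun t ht => by
    rw [hz]; exact hzA t ht
  have hZc := DyadicPartition.continuousOn_toFun_of_bounded (by linarith) hε hzC hA hzA'
  have hzeq : ∀ t ∈ Icc 0 T, z t = ofFun (toFun (z t)) := fun t ht =>
    (ofFun_toFun (DyadicPartition.isCont_of_besovNorm_le hε hA (hzA' t ht)).1).symm
  have hWmem := hXmem.W.1
  have hWc : ContinuousOn (fun t => toFun (X t).W) (Icc 0 T) :=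
    DyadicPartition.continuousOn_toFun (by linarith) hWmem
  have hWeq : ∀ t ∈ Icc 0 T, (X t).W = ofFun (toFun (X t).W) := fun t ht =>
    (ofFun_toFun (DyadicPartition.isCont_of_mem_besov (by linarith) (hWmem.1 t ht))).symm
  obtain ⟨Z, hZ⟩ : ∃ Z : ℝ → C(T3, ℂ), Z = fun t => toFun (z t) := ⟨_, rfl⟩
  obtain ⟨W, hW⟩ : ∃ W : ℝ → C(T3, ℂ), W = fun t => toFun (X t).W := ⟨_, rfl⟩
  rw [← hZ] at hZc
  rw [← hW] at hWc
  replace hzeq : ∀ t ∈ Icc 0 T, z t = ofFun (Z t) := fun t ht => by rw [hZ]; exact hzeq t ht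
  replace hWeq : ∀ t ∈ Icc 0 T, (X t).W = ofFun (W t) := fun t ht => by rw [hW]; exact hWeq t ht
  -- `v` and `w` are continuous functions at positive times
  obtain ⟨⟨⟨hvE, hvC⟩, -⟩, ⟨⟨hwE, hwC⟩, -⟩, heqv, heqw⟩ := hvw
  obtain ⟨V, hV⟩ : ∃ V : ℝ → C(T3, ℂ), V = fun t => toFun (v t) := ⟨_, rfl⟩
  obtain ⟨Y, hY⟩ : ∃ Y : ℝ → C(T3, ℂ), Y = fun t => toFun (w t) := ⟨_, rfl⟩
  have hVc : ContinuousOn V (Ioc 0 T) := by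
    rw [hV]; exact DyadicPartition.continuousOn_toFun (by linarith) hvE.1
  have hYc : ContinuousOn Y (Ioc 0 T) := by
    rw [hY]; exact DyadicPartition.continuousOn_toFun (by linarith) hwE.1
  have hveq : ∀ t ∈ Ioc 0 T, v t = ofFun (V t) := fun t ht => by
    rw [hV]
    exact (ofFun_toFun (DyadicPartition.isCont_of_mem_besov (by linarith) (hvE.1.1 t ht))).symm
  have hweq : ∀ t ∈ Ioc 0 T, w t = ofFun (Y t) := fun t ht => by
    rw [hY]
    exact (ofFun_toFun (DyadicPartition.isCont_of_mem_besov (by linarith) (hwE.1.1 t ht))).symm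
  obtain ⟨C₁, r₁, hC₁, hr₁, hVb⟩ := DyadicPartition.exists_norm_toFun_le_rpow (by linarith)
    (by linarith) (by linarith) (by linarith) hvE hvC
  obtain ⟨C₂, r₂, hC₂, hr₂, hYb⟩ := DyadicPartition.exists_norm_toFun_le_rpow (by linarith)
    (by linarith) (by linarith) (by linarith) hwE hwC
  obtain ⟨MZ, hMZ⟩ := isCompact_Icc.exists_bound_of_continuousOn hZc
  obtain ⟨MW, hMW⟩ := isCompact_Icc.exists_bound_of_continuousOn hWc
  have hMZ0 : 0 ≤ MZ := (norm_nonneg _).trans (hMZ T ⟨hT0, le_rfl⟩)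
  have hMW0 : 0 ≤ MW := (norm_nonneg _).trans (hMW T ⟨hT0, le_rfl⟩)
  have hIoc : ∀ t ∈ Ioc 0 T, t ∈ Icc 0 T := fun t ht => Ioc_subset_Icc_self ht
  have hUcube : IntegrableOn (fun t => ‖Z t - ν • W t + V t + Y t‖ ^ 3) (Ioc 0 T) := by
    refine integrableOn_norm_cube
      ((((hZc.mono hIoc).sub ((hWc.mono hIoc).const_smul ν)).add hVc).add hYc)
      (M := MZ + ‖ν‖ * MW) (by positivity) hC₁ hC₂ hr₁ hr₂ fun t ht => ?_
    have h1 : ‖ν • W t‖ ≤ ‖ν‖ * MW := by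
      rw [norm_smul]
      exact mul_le_mul_of_nonneg_left (hMW t (hIoc t ht)) (norm_nonneg _)
    have h2 : ‖V t‖ ≤ C₁ * t ^ (-r₁) := by rw [hV]; exact hVb t ht
    have h3 : ‖Y t‖ ≤ C₂ * t ^ (-r₂) := by rw [hY]; exact hYb t ht
    have h4 : ‖Z t - ν • W t + V t + Y t‖ ≤ ‖Z t‖ + ‖ν • W t‖ + ‖V t‖ + ‖Y t‖ :=
      (norm_add_le _ _).trans (add_le_add ((norm_add_le _ _).trans
        (add_le_add (norm_sub_le _ _) le_rfl)) le_rfl)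
    have h5 := hMZ t (hIoc t ht)
    linarith
  -- at positive times, the integrated components of the driving vector are in the Wiener algebra
  obtain ⟨a, ha⟩ : ∃ a, a = integ μ IZZ₀ (fun s => fnMul (z s) (z s)) := ⟨_, rfl⟩
  obtain ⟨b, hb⟩ : ∃ b, b = integ μ IZZb₀ (fun s => tableZZb c₁ (z s)) := ⟨_, rfl⟩
  have hWint : ∀ t, (X t).W = integ μ W₀ (fun s => tableZZZb c₁ (z s)) t := fun t => by
    rw [hX, hz]; rfl
  have hXt : ∀ t ∈ Icc 0 T,
      X t = driverOf P c₁ c₂₁ c₂₂ (ofFun (Z t)) (a t) (b t) (ofFun (W t)) := fun t ht => by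
    rw [← hzeq t ht, ← hWeq t ht, hWint, ha, hb, hX, hz]; rfl
  have hwa : ∀ t ∈ Ioc 0 T, Wiener (a t) := fun t ht => by
    rw [ha]
    exact wiener_integ_ofFun hμ ht (L2_of_mem _ hIZZ₀) (hZc.mul hZc) fun s hs => by
      rw [hzeq s hs, fnMul_ofFun]; rfl
  have hwb : ∀ t ∈ Ioc 0 T, Wiener (b t) := fun t ht => by
    rw [hb]
    exact wiener_integ_ofFun (F := fun s => Z s * star (Z s) - ContinuousMap.const T3 c₁) hμ ht
      (L2_of_mem _ hIZZb₀) ((hZc.mul hZc.star).sub continuousOn_const) fun s hs => by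
      rw [tableZZb, hzeq s hs, ← ofFun_star, fnMul_ofFun, const_eq_ofFun, ofFun_sub]
  have hwW : ∀ t ∈ Ioc 0 T, Wiener (ofFun (W t)) := fun t ht => by
    rw [← hWeq t (hIoc t ht), hWint]
    exact wiener_integ_ofFun (F := fun s => Z s * Z s * star (Z s) - (2 * c₁) • Z s) hμ ht
      (L2_of_mem _ hW₀) (((hZc.mul hZc).mul hZc.star).sub (hZc.const_smul (2 * c₁)))
      fun s hs => by
      rw [tableZZZb, hzeq s hs, ← ofFun_star, fnMul_ofFun, fnMul_ofFun, ofFun_sub, ofFun_smul]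
  exact isMildSolution_of_continuousOn P rfl hT0
    (fun k => DyadicPartition.continuousOn_coeff hξ k) hZc hWc hVc hYc hUcube hXt hwW hwa hwb hveq
    hweq (fun t _ => by rw [hzX, hz]; rfl) (fun t _ => by simp only [hzX]; exact hWint t) heqv heqw
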